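/- **Setting.** Let $E$ be a separable real Banach space with norm dual $E^*$ and open unit ball $B$, and let $\mathbb{R}_+=[0,\infty)$ carry Lebesgue measure. An *arc* is an element of $W^{1,1}_{\mathrm{loc}}(\mathbb{R}_+,E)$: a function $x:\mathbb{R}_+\to E$ that is strongly differentiable a.e., with locally Bochner integrable derivative $\dot x$ and $x(t)=x(0)+\int_0^t\dot x(s)\,ds$ for all $t$. Let $L:\mathbb{R}_+\times E\times E\to\mathbb{R}\cup\{+\infty\}$ and let $\Gamma:\mathbb{R}_+\times E\twoheadrightarrow E$ be a multifunction. Put $$\mathcal{A}_{(t,\xi)}=\{x \text{ an arc}\mid \dot x(s)\in\Gamma(s,x(s))\text{ for a.e. }s\ge t,\ x(t)=\xi\},\qquad V(t,\xi)=\inf_{x\in\mathcal{A}_{(t,\xi)}}\int_t^\infty L(s,x(s),\dot x(s))\,ds,$$ where $\int_t^\infty=\lim_{T\to\infty}\int_t^T$, the infimum is over those $x$ for which this limit is well defined, and $\inf\emptyset=+\infty$. A trajectory $x_0\in\mathcal{A}_{(0,\xi_0)}$ is *optimal* if $\int_0^\infty L(s,x_0(s),\dot x_0(s))\,ds=V(0,\xi_0)$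 and this value is finite. For $\varphi:E\to\mathbb{R}\cup\{\pm\infty\}$ finite at $\bar x$, let $\varphi^-(\bar x;v)$ and $\varphi^+(\bar x;v)$ be the $\liminf$ and the $\limsup$ of $\theta^{-1}(\varphi(\bar x+\theta u)-\varphi(\bar x))$ as $u\to v$, $\theta\downarrow0$. The Gateaux sub- and superdifferential are $$\partial^-\varphi(\bar x)=\{x^*\in E^*\mid\langle x^*,v\rangle\le\varphi^-(\bar x;v)\ \forall v\in E\},\qquad \partial^+\varphi(\bar x)=\{x^*\in E^*\mid\langle x^*,v\rangle\ge\varphi^+(\bar x;v)\ \forall v\in E\}.$$ For $\varphi$ Lipschitz near $\bar x$, let $\varphi^\circ(\bar x;v)=\limsup_{x\to\bar x,\,\theta\downarrow0}\theta^{-1}(\varphi(x+\theta v)-\varphi(x))$, and let $\partial^\circ\varphi(\bar x)=\{x^*\mid\langle x^*,v\rangle\le\varphi^\circ(\bar x;v)\ \forall v\}$ be the Clarke subdifferential. For $C\subset E$ with distance function $d_C$ and $\bar x\in C$, the Clarke normal cone is $N_C(\bar x)=\{x^*\mid\langle x^*,v\rangle\le0\text{ whenever }d_C^\circ(\bar x;v)=0\}$.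 A subscript $x$ or $y$ denotes the partial object with respect to that variable. The Hamiltonian is $H(t,x,x^*)=\sup_{y\in\Gamma(t,x)}\{\langle x^*,y\rangle-L(t,x,y)\}$. **Hypotheses.** - (H1) $\mathcal{A}_{(t,\xi)}\neq\emptyset$ for all $(t,\xi)\in\mathbb{R}_+\times E$. - (H2) $L(\cdot,x,y)$ is Lebesgue measurable for all $x,y\in E$. - (H3) There are integrable $l_0,l_1,l_2:\mathbb{R}_+\to\mathbb{R}_+$, with $l_2$ locally bounded, such that for a.e. $t$: $|L(t,0,0)|\le l_0(t)$ and $|L(t,x,y)-L(t,x',y')|\le l_1(t)\|x-x'\|+l_2(t)\|y-y'\|$ for all $x,y,x',y'\in E$. - (H4) $\Gamma$ has nonempty closed values. - (H5') $\Gamma(\cdot,x)$ is lower semicontinuous on $\mathbb{R}_+$ for every $x\in E$. - (H6) There are locally integrable $\gamma_0,\gamma_1:\mathbb{R}_+\to\mathbb{R}_+$ with $\Gamma(t,0)\subset\gamma_0(t)B$ and $\Gamma(t,x)\subset\Gamma(t,x')+\gamma_1(t)\|x-x'\|B$ for all $t\in\mathbb{R}_+$, $x,x'\in E$. - (H7)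 $\displaystyle\int_0^\infty e^{\int_0^s\gamma_1(\tau)d\tau}\Big(1+\int_0^s\gamma_0(\tau)d\tau\Big)\big(l_1(s)+l_2(s)\gamma_1(s)\big)ds<\infty$ and $\displaystyle\int_0^\infty l_2(s)\gamma_0(s)\,ds<\infty$. - $x_0\in\mathcal{A}_{(0,\xi_0)}$ is an optimal trajectory. - (H8) For every $t\in\mathbb{R}_+$ there is $\eta>0$ such that for a.e. $s\in[0,t]$: $\dot x_0(s)\in\Gamma(s,x)$ for all $x\in x_0(s)+\eta B$. **Theorem (Euler–Lagrange condition and maximum principle).** Assume all of the above, that $\partial^-_xV(0,x_0(0))\neq\emptyset$, and that $\partial^+_xL(t,x_0(t),\dot x_0(t))\neq\emptyset$ for a.e. $t\in\mathbb{R}_+$. Then for every $x^*\in\partial^-_xV(0,x_0(0))$ there is a locally absolutely continuous $p:\mathbb{R}_+\to E^*$ (for the dual norm) with $p(0)=-x^*$ such that: 1. $-p(t)\in\partial^-_xV(t,x_0(t))$ for every $t\in\mathbb{R}_+$; 2. $p(t)\in\partial^\circ_yL(t,x_0(t),\dot x_0(t))+N_{\Gamma(t,x_0(t))}(\dot x_0(t))$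 for a.e. $t\in\mathbb{R}_+$; 3. for a.e. $t\in\mathbb{R}_+$ the weak$^*$ derivative $\dot p(t)$ exists (that is, $\frac{d}{dt}\langle p(t),x\rangle=\langle\dot p(t),x\rangle$ for every $x\in E$) and $\dot p(t)\in\partial^+_xL(t,x_0(t),\dot x_0(t))$; 4. $H(t,x_0(t),p(t))=\langle p(t),\dot x_0(t)\rangle-L(t,x_0(t),\dot x_0(t))$ for a.e. $t\in\mathbb{R}_+$; 5. $\lim_{t\to\infty}p(t)=0$ in the norm of $E^*$. In particular, under these assumptions $\partial^-_xV(t,x_0(t))\neq\emptyset$ for every $t\in\mathbb{R}_+$. -/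

import Mathlib

open Set Filter Topology MeasureTheory
open scoped Pointwise ENNReal

namespace InfHorizon

noncomputable section

/-! ### Generalized differentiation -/

section Subdifferentials

variable {E : Type*} [NormedAddCommGroup E] [NormedSpace ℝ E]

/-- The difference quotient `(φ (x + θ u) - φ x) / θ` of an extended real valued function
(used with `φ x` finite and `θ > 0`). -/
def diffQuot (φ : E → EReal) (x u : E) (θ : ℝ) : EReal :=
  (φ (x + θ • u) - φ x) / (θ : EReal)

/-- Lower directional derivative: liminf of the difference quotients as `u → v`, `θ ↓ 0`. -/
def lowerDirDeriv (φ : E → EReal) (x v : E) : EReal :=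
  liminf (fun q : E × ℝ => diffQuot φ x q.1 q.2) (𝓝 v ×ˢ 𝓝[>] (0 : ℝ))

/-- Upper directional derivative: limsup of the difference quotients as `u → v`, `θ ↓ 0`. -/
def upperDirDeriv (φ : E → EReal) (x v : E) : EReal :=
  limsup (fun q : E × ℝ => diffQuot φ x q.1 q.2) (𝓝 v ×ˢ 𝓝[>] (0 : ℝ))

/-- Clarke directional derivative: limsup of `(φ (z + θ v) - φ z) / θ` as `z → x`, `θ ↓ 0`
(meaningful when `φ` is finite and Lipschitz near `x`). -/
def clarkeDirDeriv (φ : E → EReal) (x v : E) : EReal :=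
  limsup (fun q : E × ℝ => diffQuot φ q.1 v q.2) (𝓝 x ×ˢ 𝓝[>] (0 : ℝ))

/-- Gateaux subdifferential of `φ` at a point `x` where `φ` is finite. -/
def gateauxSubdiff (φ : E → EReal) (x : E) : Set (StrongDual ℝ E) :=
  {p | φ x ≠ ⊥ ∧ φ x ≠ ⊤ ∧ ∀ v : E, ((p v : ℝ) : EReal) ≤ lowerDirDeriv φ x v}

/-- Gateaux superdifferential of `φ` at a point `x` where `φ` is finite. -/
def gateauxSuperdiff (φ : E → EReal) (x : E) : Set (StrongDual ℝ E) :=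
  {p | φ x ≠ ⊥ ∧ φ x ≠ ⊤ ∧ ∀ v : E, upperDirDeriv φ x v ≤ ((p v : ℝ) : EReal)}

/-- Clarke subdifferential of `φ` at `x`. -/
def clarkeSubdiff (φ : E → EReal) (x : E) : Set (StrongDual ℝ E) :=
  {p | φ x ≠ ⊥ ∧ φ x ≠ ⊤ ∧ ∀ v : E, ((p v : ℝ) : EReal) ≤ clarkeDirDeriv φ x v}

/-- Clarke tangent cone to `C` at `x ∈ C`, through the distance function of `C`. -/
def clarkeTangentCone (C : Set E) (x : E) : Set E :=
  {v | clarkeDirDeriv (fun z => ((Metric.infDist z C : ℝ) : EReal)) x v = 0}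

/-- Clarke normal cone to `C` at `x ∈ C`: the polar of the Clarke tangent cone. -/
def clarkeNormalCone (C : Set E) (x : E) : Set (StrongDual ℝ E) :=
  {p | ∀ v ∈ clarkeTangentCone C x, p v ≤ 0}

/-- `q` is the weak* derivative of `p` at `t`. -/
def HasWeakStarDerivAt (p : ℝ → StrongDual ℝ E) (q : StrongDual ℝ E) (t : ℝ) : Prop :=
  ∀ x : E, HasDerivAt (fun s => p s x) (q x) t

/-- `p` restricted to `[0, ∞)` is locally absolutely continuous (for the dual norm). -/
def LocallyAbsolutelyContinuous (p : ℝ → StrongDual ℝ E) : Prop :=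
  ∀ τ : ℝ, 0 < τ → AbsolutelyContinuousOnInterval p 0 τ

end Subdifferentials

/-! ### Improper integrals of extended real valued functions -/

/-- The integral of the positive part of `f` over `(a, b]`. -/
def posIntegral (f : ℝ → EReal) (a b : ℝ) : ℝ≥0∞ := ∫⁻ s in Ioc a b, (f s).toENNReal

/-- The integral of the negative part of `f` over `(a, b]`. -/
def negIntegral (f : ℝ → EReal) (a b : ℝ) : ℝ≥0∞ := ∫⁻ s in Ioc a b, (-f s).toENNReal

/-- The Lebesgue integral of `f` over `(a, b]` is well defined: `f` is Lebesgue measurable there and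
its positive and negative parts do not both have infinite integral. -/
def IntegralDefined (f : ℝ → EReal) (a b : ℝ) : Prop :=
  AEMeasurable f (volume.restrict (Ioc a b)) ∧ (posIntegral f a b ≠ ⊤ ∨ negIntegral f a b ≠ ⊤)

/-- The (extended real) Lebesgue integral of `f` over `(a, b]`. -/
def extIntegral (f : ℝ → EReal) (a b : ℝ) : EReal :=
  (posIntegral f a b : EReal) - (negIntegral f a b : EReal)

/-- The improper integral `∫_t^∞ f = lim_{T → ∞} ∫_t^T f` is well defined and equals `I`. -/
def HasImproperIntegral (f : ℝ → EReal) (t : ℝ) (I : EReal) : Prop :=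
  (∀ T : ℝ, t ≤ T → IntegralDefined f t T) ∧ Tendsto (fun T => extIntegral f t T) atTop (𝓝 I)

/-! ### The variational problem -/

section Problem

variable {E : Type*} [NormedAddCommGroup E] [NormedSpace ℝ E]

/-- `x` (restricted to `[0, ∞)`) is an arc, that is, an element of `W^{1,1}_loc([0, ∞), E)`: it is
strongly differentiable almost everywhere, its derivative is locally Bochner integrable and `x` is
the integral of its derivative. -/
def IsArc (x : ℝ → E) : Prop :=
  (∀ᵐ t ∂volume.restrict (Ioi (0 : ℝ)), DifferentiableAt ℝ x t) ∧
  LocallyIntegrableOn (deriv x) (Ici (0 : ℝ)) ∧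
  ∀ t : ℝ, 0 ≤ t → x t = x 0 + ∫ s in (0 : ℝ)..t, deriv x s

/-- The admissible trajectories starting at time `t` from `ξ`. -/
def admissible (Γ : ℝ → E → Set E) (t : ℝ) (ξ : E) : Set (ℝ → E) :=
  {x | IsArc x ∧ (∀ᵐ s ∂volume.restrict (Ici t), deriv x s ∈ Γ s (x s)) ∧ x t = ξ}

/-- The integrand `s ↦ L (s, x s, x' s)` along an arc. -/
def along (L : ℝ → E → E → EReal) (x : ℝ → E) : ℝ → EReal := fun s => L s (x s) (deriv x s)

/-- The value function: the infimum of the well-defined improper integrals along admissible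
trajectories (`⊤` if there are none). -/
def value (L : ℝ → E → E → EReal) (Γ : ℝ → E → Set E) (t : ℝ) (ξ : E) : EReal :=
  sInf {I | ∃ x ∈ admissible Γ t ξ, HasImproperIntegral (along L x) t I}

/-- `x` is an optimal trajectory starting at time `t` from `ξ`. -/
def IsOptimal (L : ℝ → E → E → EReal) (Γ : ℝ → E → Set E) (t : ℝ) (ξ : E) (x : ℝ → E) : Prop :=
  x ∈ admissible Γ t ξ ∧ HasImproperIntegral (along L x) t (value L Γ t ξ) ∧
    value L Γ t ξ ≠ ⊥ ∧ value L Γ t ξ ≠ ⊤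

/-- The Hamiltonian. -/
def hamiltonian (L : ℝ → E → E → EReal) (Γ : ℝ → E → Set E) (t : ℝ) (x : E)
    (p : StrongDual ℝ E) : EReal :=
  ⨆ y ∈ Γ t x, (((p y : ℝ) : EReal) - L t x y)

end Problem

end

end InfHorizon

/-! Dynamic programming and the interiority hypothesis carry the argument. Let `V` be the value
function, `x₀` the optimal trajectory, `y₀` its velocity. By interiority a small translate `x₀ + w`,
followed with the same velocity `y₀`, is still admissible on `[0, t]`. Hence `V(0, ξ₀ + w) ≤ ∫₀ᵗ
L(s, x₀ + w, y₀) ds + V(t, x₀(t) + w)`, with equality at `w = 0` by the principle of optimality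
(`le_value_translate`, `value_eq_costToGo`). Comparing difference quotients, if `x*` is a
subgradient of `V(0, ·)` at `ξ₀` and `q(s)` is a supergradient of `L(s, ·, y₀(s))` at `x₀(s)`, then
`x* - ∫₀ᵗ q` is a subgradient of `V(t, ·)` at `x₀(t)` (`mem_gateauxSubdiff_value_of_superdiff`). So
`p(t) = -x* + ∫₀ᵗ q`, a weak* integral, is the costate, and its derivative is `q` almost everywhere.

The selection `q` has to be weak* measurable although `E*` need not be separable. The upper
directional derivatives of `L` are measurable in time, and a linear functional above them is
produced by an explicit form of the Hahn-Banach theorem that uses only infima over separable index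
sets: a sublinear hull, then linearization along a dense sequence
(`exists_aemeasurable_linear_minorant`).

For the maximum principle, fix `t` and `y ∈ Γ(t, x₀(t))`. Filippov's theorem
(`IsLipschitzVelocity.exists_trajectory`), run backward from `x₀(t + h)` with velocity near `y`,
reaches at time `t` a point near `x₀(t) + h (y₀(t) - y)`. From this point one can join the optimal
trajectory at time `t + h`, which bounds `V(t, ·)` above there; the subgradient `-p(t)` bounds it
below. Dividing by `h` gives the inequality (`apply_sub_le_of_mem_gateauxSubdiff_value`). Going
backward is essential: only `V(t, ·)` is known to first order, while at time `t + h` only the value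
on the optimal trajectory is used.

The inclusion for `p(t)` is the first-order condition for the minimum of `L(t, x₀(t), ·) - p(t)`
over the velocity set, obtained by exact penalization with the distance function and a Hahn-Banach
sum rule (`mem_clarkeSubdiff_add_clarkeNormalCone`).

Finally, Filippov's theorem with a Gronwall bound gives `V(t, x₀(t) + w) ≤ V(t, x₀(t)) + κ(t) ‖w‖`,
where `κ(t)` is the tail of a convergent integral (`value_le_add_norm_mul`). Subgradients of `V(t,
·)` at `x₀(t)` thus have norm at most `κ(t)`, so `p(t) → 0`. -/

namespace InfHorizon

/-! ### Measurability -/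

section Measurability

variable {Ω E : Type*} [MeasurableSpace Ω] {μ : Measure Ω}

/-- A Carathéodory function composed with a strongly measurable function is measurable. -/
theorem aestronglyMeasurable_caratheodory_comp [TopologicalSpace E]
    {F : Ω → E → ℝ} (hF : ∀ v, AEMeasurable (fun ω => F ω v) μ)
    (hc : ∀ᵐ ω ∂μ, Continuous (F ω)) {x : Ω → E} (hx : AEStronglyMeasurable x μ) :
    AEMeasurable (fun ω => F ω (x ω)) μ := by
  have simple : ∀ f : SimpleFunc Ω E, AEMeasurable (fun ω => F ω (f ω)) μ := by
    intro f
    have : (fun ω => F ω (f ω)) =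
        fun ω => ∑ v ∈ f.range, (f ⁻¹' {v}).indicator (fun ω => F ω v) ω := by
      funext ω
      rw [Finset.sum_eq_single (f ω)]
      · simp
      · intro b _ hb
        rw [indicator_of_notMem]
        simpa using fun h : f ω = b => hb h.symm
      · intro h
        exact absurd (f.mem_range_self ω) h
    rw [this]
    exact Finset.aemeasurable_fun_sum _ fun v _ => (hF v).indicator (f.measurableSet_fiber v)
  obtain ⟨g, hg, hxg⟩ := hx
  refine aemeasurable_of_tendsto_metrizable_ae atTop (fun n => simple (hg.approx n)) ?_
  filter_upwards [hc, hxg] with ω hω hωg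
  rw [hωg]
  exact (hω.tendsto _).comp (hg.tendsto_approx ω)

/-- Choice of an index, depending measurably on the parameter, at which a function is negative. -/
theorem exists_measurable_index {A : ℕ → Ω → ℝ} (hA : ∀ i, AEMeasurable (A i) μ)
    (h : ∀ᵐ ω ∂μ, ∃ i, A i ω < 0) :
    ∃ N : Ω → ℕ, Measurable N ∧ ∀ᵐ ω ∂μ, A (N ω) ω < 0 := by
  classical
  let B : ℕ → Ω → ℝ := fun i => (hA i).mk (A i)
  have hB : ∀ i, Measurable (B i) := fun i => (hA i).measurable_mk
  have hAB : ∀ᵐ ω ∂μ, ∀ i, A i ω = B i ω := ae_all_iff.2 fun i => (hA i).ae_eq_mk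
  -- The second alternative makes the search total: where no index works, it stops at `0`. Both
  -- alternatives define measurable sets.
  have hex : ∀ ω, ∃ i, B i ω < 0 ∨ ¬ ∃ j, B j ω < 0 := fun ω => by
    by_cases hj : ∃ j, B j ω < 0
    · obtain ⟨j, hj⟩ := hj
      exact ⟨j, .inl hj⟩
    · exact ⟨0, .inr hj⟩
  refine ⟨fun ω => Nat.find (hex ω), measurable_find hex fun i => ?_, ?_⟩
  · have h1 : ∀ j, MeasurableSet {ω | B j ω < 0} := fun j =>
      measurableSet_lt (hB j) measurable_const
    have : {ω | B i ω < 0 ∨ ¬ ∃ j, B j ω < 0} = {ω | B i ω < 0} ∪ (⋃ j, {ω | B j ω < 0})ᶜ := by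
      ext ω
      simp
    exact this ▸ (h1 i).union (MeasurableSet.iUnion h1).compl
  · filter_upwards [h, hAB] with ω ⟨i, hi⟩ hω
    rcases Nat.find_spec (hex ω) with h' | h'
    · rw [hω]
      exact h'
    · exact absurd ⟨i, hω i ▸ hi⟩ h'

/-- The infimum of a continuous family over a separable index space is measurable. -/
theorem aemeasurable_iInf_of_continuous {ι : Type*} [TopologicalSpace ι]
    [TopologicalSpace.SeparableSpace ι] {F : ι → Ω → ℝ} (hF : ∀ i, AEMeasurable (F i) μ)
    (hc : ∀ᵐ ω ∂μ, Continuous fun i => F i ω) : AEMeasurable (fun ω => ⨅ i, F i ω) μ := by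
  obtain ⟨s, hs, hd⟩ := TopologicalSpace.exists_countable_dense ι
  have := hs.to_subtype
  refine (AEMeasurable.iInf fun i : s => hF i).congr ?_
  filter_upwards [hc] with ω hω
  exact hd.ciInf' hω

/-- The supremum of a continuous family over a separable index space is measurable. -/
theorem aemeasurable_iSup_of_continuous {ι : Type*} [TopologicalSpace ι]
    [TopologicalSpace.SeparableSpace ι] {F : ι → Ω → ℝ} (hF : ∀ i, AEMeasurable (F i) μ)
    (hc : ∀ᵐ ω ∂μ, Continuous fun i => F i ω) : AEMeasurable (fun ω => ⨆ i, F i ω) μ := by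
  obtain ⟨s, hs, hd⟩ := TopologicalSpace.exists_countable_dense ι
  have := hs.to_subtype
  refine (AEMeasurable.iSup fun i : s => hF i).congr ?_
  filter_upwards [hc] with ω hω
  exact hd.ciSup' hω

end Measurability

/-! ### Integrals over intervals -/

section Intervals

variable {E : Type*} [NormedAddCommGroup E]

theorem intervalIntegrable_of_locallyIntegrable {f : ℝ → E} (hf : LocallyIntegrable f)
    (a b : ℝ) : IntervalIntegrable f volume a b :=
  (hf.integrableOn_isCompact isCompact_uIcc).mono_set uIoc_subset_uIcc |> intervalIntegrable_iff.2

theorem integrableOn_uIoc_of_locallyIntegrable {f : ℝ → E} (hf : LocallyIntegrable f)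
    (a b : ℝ) : IntegrableOn f (uIoc a b) :=
  intervalIntegrable_iff.1 (intervalIntegrable_of_locallyIntegrable hf a b)

theorem locallyIntegrable_of_intervalIntegrable {f : ℝ → E}
    (hf : ∀ a b, IntervalIntegrable f volume a b) : LocallyIntegrable f := by
  refine (locallyIntegrable_iff).2 fun k hk => ?_
  obtain ⟨a, b, hab⟩ : ∃ a b : ℝ, k ⊆ Ioc a b := by
    obtain ⟨R, hR⟩ := hk.isBounded.subset_closedBall 0
    refine ⟨-R - 1, R, hR.trans fun x hx => ?_⟩
    rw [Metric.mem_closedBall, dist_zero_right, Real.norm_eq_abs, abs_le] at hx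
    exact ⟨by linarith, hx.2⟩
  exact ((intervalIntegrable_iff.1 (hf a b)).mono_set Ioc_subset_uIoc).mono_set hab

theorem locallyIntegrable_indicator_Ici {f : ℝ → E} (hf : LocallyIntegrableOn f (Ici (0 : ℝ))) :
    LocallyIntegrable ((Ici (0 : ℝ)).indicator f) := by
  refine (locallyIntegrable_iff).2 fun k hk => ?_
  have h : IntegrableOn f (k ∩ Ici 0) :=
    hf.integrableOn_compact_subset inter_subset_right (hk.inter_right isClosed_Ici)
  rw [IntegrableOn, integrable_indicator_iff measurableSet_Ici, IntegrableOn,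
    Measure.restrict_restrict measurableSet_Ici, inter_comm]
  exact h

theorem continuous_primitive_of_locallyIntegrable [NormedSpace ℝ E] {f : ℝ → E} (hf : LocallyIntegrable f) (c : ℝ) :
    Continuous fun s => ∫ τ in c..s, f τ :=
  intervalIntegral.continuous_primitive (intervalIntegrable_of_locallyIntegrable hf) c

/-- The exponential of a primitive of a nonnegative function is a supersolution of the linear
equation. -/
theorem integral_mul_exp_primitive_le {a : ℝ → ℝ} (ha : LocallyIntegrable a) (ha0 : ∀ s, 0 ≤ a s)
    {t s : ℝ} (hts : t ≤ s) :
    ∫ τ in t..s, a τ * Real.exp (∫ r in t..τ, a r) ≤ Real.exp (∫ r in t..s, a r) - 1 := by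
  have hmono : Monotone fun τ => Real.exp (∫ r in t..τ, a r) := by
    intro u v huv
    refine Real.exp_le_exp.2 ?_
    rw [← intervalIntegral.integral_add_adjacent_intervals
      (intervalIntegrable_of_locallyIntegrable ha t u)
      (intervalIntegrable_of_locallyIntegrable ha u v)]
    linarith [intervalIntegral.integral_nonneg (μ := volume) huv fun r _ => ha0 r]
  -- Only an inequality is needed, so monotonicity replaces absolute continuity of the exponential.
  have h := MonotoneOn.intervalIntegral_deriv_mem_uIcc (hmono.monotoneOn (uIcc t s))
  rw [uIcc_of_le (sub_nonneg.2 (hmono hts))] at h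
  have heq : ∫ τ in t..s, a τ * Real.exp (∫ r in t..τ, a r) =
      ∫ τ in t..s, deriv (fun τ => Real.exp (∫ r in t..τ, a r)) τ := by
    refine intervalIntegral.integral_congr_ae ?_
    filter_upwards [_root_.LocallyIntegrable.ae_hasDerivAt_integral ha] with τ hτ _
    rw [((hτ t).exp).deriv, mul_comm]
  rw [heq]
  simpa using h.2

end Intervals

end InfHorizon

namespace InfHorizon

noncomputable section

/-! ### Measurable selection of linear minorants -/

section LinearMinorants

theorem continuous_of_le_add_norm {E : Type*} [SeminormedAddCommGroup E] {c : ℝ} {k : E → ℝ} (h : ∀ v w, k v ≤ k w + c * ‖v - w‖) :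
    Continuous k := by
  refine (LipschitzWith.of_le_add_mul (Real.toNNReal c) fun v w => ?_).continuous
  rw [dist_eq_norm]
  refine (h v w).trans ?_
  gcongr
  exact Real.le_coe_toNNReal c

variable {E : Type*} [NormedAddCommGroup E] [NormedSpace ℝ E]

/-- `k` is positively homogeneous, `c`-Lipschitz and minorized by the functional `Q`. -/
structure IsHomLipschitzAbove (c : ℝ) (Q : StrongDual ℝ E) (k : E → ℝ) : Prop where
  lip : ∀ v w, k v ≤ k w + c * ‖v - w‖
  -- The inequality is enough: applied to `r⁻¹` it gives the reverse one.
  hom : ∀ r : ℝ, 0 < r → ∀ v, k (r • v) ≤ r * k v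
  ge : ∀ v, Q v ≤ k v

/-- `P` is sublinear and bounded by `c ‖·‖`. -/
structure IsSublinearBounded (c : ℝ) (P : E → ℝ) : Prop where
  add : ∀ v w, P (v + w) ≤ P v + P w
  hom : ∀ r : ℝ, 0 < r → ∀ v, P (r • v) ≤ r * P v
  le : ∀ v, P v ≤ c * ‖v‖

theorem apply_zero_nonpos_of_hom {k : E → ℝ} (h : ∀ r : ℝ, 0 < r → ∀ v, k (r • v) ≤ r * k v) :
    k 0 ≤ 0 := by
  have := h (1 / 2) (by norm_num) 0
  rw [smul_zero] at this
  linarith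

/-- The infimal convolution of a function with itself. -/
def selfInfConv (k : E → ℝ) (v : E) : ℝ := ⨅ w, k w + k (v - w)

namespace IsHomLipschitzAbove

variable {c : ℝ} {Q : StrongDual ℝ E} {k : E → ℝ}

theorem bddBelow (h : IsHomLipschitzAbove c Q k) (v : E) :
    BddBelow (range fun w => k w + k (v - w)) := by
  refine ⟨Q v, ?_⟩
  rintro _ ⟨w, rfl⟩
  have h1 := h.ge w
  have h2 := h.ge (v - w)
  rw [map_sub] at h2
  show Q v ≤ k w + k (v - w)
  linarith

theorem selfInfConv_le (h : IsHomLipschitzAbove c Q k) (v w : E) :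
    selfInfConv k v ≤ k w + k (v - w) := ciInf_le (h.bddBelow v) w

theorem selfInfConv_le_self (h : IsHomLipschitzAbove c Q k) (v : E) : selfInfConv k v ≤ k v := by
  have h1 := h.selfInfConv_le v v
  have h2 := apply_zero_nonpos_of_hom h.hom
  rw [sub_self] at h1
  linarith

/-- The Lipschitz constant does not double, because with the splitting vector `w` fixed only one of
the two terms depends on `v`. The linear minorant survives because it is additive. -/
theorem isHomLipschitzAbove_selfInfConv (h : IsHomLipschitzAbove c Q k) :
    IsHomLipschitzAbove c Q (selfInfConv k) where
  lip v v' := by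
    rw [← sub_le_iff_le_add]
    refine le_ciInf fun w => ?_
    have h1 := h.selfInfConv_le v w
    have h2 := h.lip (v - w) (v' - w)
    rw [sub_sub_sub_cancel_right] at h2
    linarith
  hom r hr v := by
    rw [selfInfConv, selfInfConv, Real.mul_iInf_of_nonneg hr.le]
    refine le_ciInf fun w => (ciInf_le (h.bddBelow (r • v)) (r • w)).trans ?_
    rw [← smul_sub, mul_add]
    exact add_le_add (h.hom r hr w) (h.hom r hr _)
  ge v := by
    refine le_ciInf fun w => ?_
    have h1 := h.ge w
    have h2 := h.ge (v - w)
    rw [map_sub] at h2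
    linarith

theorem iterate (h : IsHomLipschitzAbove c Q k) (n : ℕ) :
    IsHomLipschitzAbove c Q (selfInfConv^[n] k) := by
  induction n with
  | zero => exact h
  | succ n ih =>
    rw [Function.iterate_succ_apply']
    exact ih.isHomLipschitzAbove_selfInfConv

end IsHomLipschitzAbove

/-- The largest sublinear minorant of a positively homogeneous Lipschitz function. -/
def sublinearHull (k : E → ℝ) (v : E) : ℝ := ⨅ n : ℕ, selfInfConv^[n] k v

theorem IsHomLipschitzAbove.tendsto_sublinearHull {c : ℝ} {Q : StrongDual ℝ E} {k : E → ℝ}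
    (h : IsHomLipschitzAbove c Q k) (v : E) :
    Tendsto (fun n : ℕ => selfInfConv^[n] k v) atTop (𝓝 (sublinearHull k v)) := by
  refine tendsto_atTop_ciInf (antitone_nat_of_succ_le fun n => ?_) ⟨Q v, ?_⟩
  · rw [Function.iterate_succ_apply']
    exact (h.iterate n).selfInfConv_le_self v
  · rintro _ ⟨n, rfl⟩
    exact (h.iterate n).ge v

theorem IsHomLipschitzAbove.sublinearHull_le {c : ℝ} {Q : StrongDual ℝ E} {k : E → ℝ}
    (h : IsHomLipschitzAbove c Q k) (v : E) : sublinearHull k v ≤ k v := by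
  refine ciInf_le (f := fun n : ℕ => selfInfConv^[n] k v) ⟨Q v, ?_⟩ 0
  rintro _ ⟨n, rfl⟩
  exact (h.iterate n).ge v

/-- The `(n+1)`-st iterate at `v + w` is at most the sum of the `n`-th iterates at `v` and at `w`.
Subadditivity appears in the limit, where the shift of index disappears. -/
theorem IsHomLipschitzAbove.isSublinearBounded_sublinearHull {c : ℝ} {Q : StrongDual ℝ E} {k : E → ℝ}
    (h : IsHomLipschitzAbove c Q k) : IsSublinearBounded c (sublinearHull k) where
  add v w := by
    refine le_of_tendsto_of_tendsto' ((tendsto_add_atTop_iff_nat 1).2 (h.tendsto_sublinearHull _))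
      ((h.tendsto_sublinearHull v).add (h.tendsto_sublinearHull w)) fun n => ?_
    rw [Function.iterate_succ_apply']
    have := (h.iterate n).selfInfConv_le (v + w) v
    rwa [add_sub_cancel_left] at this
  hom r hr v := le_of_tendsto_of_tendsto' (h.tendsto_sublinearHull _)
    ((h.tendsto_sublinearHull v).const_mul r) fun n => (h.iterate n).hom r hr v
  le v := by
    have h1 := h.lip v 0
    have h2 := apply_zero_nonpos_of_hom h.hom
    rw [sub_zero] at h1
    linarith [h.sublinearHull_le v]

/-- The greatest sublinear minorant of `P` taking the value `-P e` at `-e`. -/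
def linearizeAlong (e : E) (P : E → ℝ) (v : E) : ℝ := ⨅ t : NNReal, P (v + t • e) - t * P e

namespace IsSublinearBounded

variable {c : ℝ} {P : E → ℝ}

theorem lip (h : IsSublinearBounded c P) (v w : E) : P v ≤ P w + c * ‖v - w‖ := by
  have h1 := h.add w (v - w)
  rw [add_sub_cancel] at h1
  linarith [h.le (v - w)]

theorem zero (h : IsSublinearBounded c P) : P 0 = 0 := by
  have h1 := apply_zero_nonpos_of_hom h.hom
  have h2 := h.add 0 0
  rw [add_zero] at h2
  linarith

theorem neg_le (h : IsSublinearBounded c P) (v : E) : -P (-v) ≤ P v := by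
  have h1 := h.add v (-v)
  rw [add_neg_cancel, h.zero] at h1
  linarith

theorem mul_le (h : IsSublinearBounded c P) (t : NNReal) (e : E) : t * P e ≤ P (t • e) := by
  rcases eq_or_ne t 0 with rfl | ht
  · simp [h.zero]
  · have ht' : (0 : ℝ) < t := by positivity
    have h1 := h.hom (t : ℝ)⁻¹ (by positivity) ((t : ℝ) • e)
    rw [inv_smul_smul₀ ht'.ne', inv_mul_eq_div, le_div_iff₀ ht'] at h1
    rw [mul_comm]
    exact h1

theorem linearizeAlong_aux (h : IsSublinearBounded c P) (e v : E) (t : NNReal) :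
    -P (-v) ≤ P (v + t • e) - t * P e := by
  have h1 := h.mul_le t e
  have h2 := h.add (v + t • e) (-v)
  rw [add_neg_cancel_comm] at h2
  linarith

theorem linearizeAlong_le (h : IsSublinearBounded c P) (e v : E) (t : NNReal) :
    linearizeAlong e P v ≤ P (v + t • e) - t * P e := by
  refine ciInf_le (f := fun t : NNReal => P (v + t • e) - t * P e) ⟨-P (-v), ?_⟩ t
  rintro _ ⟨t, rfl⟩
  exact h.linearizeAlong_aux e v t

theorem linearizeAlong_le_self (h : IsSublinearBounded c P) (e v : E) :
    linearizeAlong e P v ≤ P v := by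
  simpa using h.linearizeAlong_le e v 0

/-- The parameter `t = 1` at `-e` gives the value `P 0 - P e = -P e`, and `t = 0` at `e` gives `P
e`. Together with subadditivity this makes the new function linear on the line through `e`. -/
theorem linearizeAlong_add_neg (h : IsSublinearBounded c P) (e : E) :
    linearizeAlong e P e + linearizeAlong e P (-e) ≤ 0 := by
  have h1 := h.linearizeAlong_le e (-e) 1
  have h2 := h.linearizeAlong_le_self e e
  simp only [one_smul, neg_add_cancel, h.zero, NNReal.coe_one] at h1
  linarith

theorem isSublinearBounded_linearizeAlong (h : IsSublinearBounded c P) (e : E) :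
    IsSublinearBounded c (linearizeAlong e P) where
  add v w := by
    refine le_ciInf_add_ciInf fun t t' => (h.linearizeAlong_le e _ (t + t')).trans ?_
    have h1 := h.add (v + t • e) (w + t' • e)
    rw [add_add_add_comm, ← add_smul] at h1
    push_cast
    linarith
  hom r hr v := by
    rw [linearizeAlong, linearizeAlong, Real.mul_iInf_of_nonneg hr.le]
    lift r to NNReal using hr.le
    refine le_ciInf fun t => (h.linearizeAlong_le e ((r : ℝ) • v) (r * t)).trans ?_
    have h1 := h.hom r hr (v + t • e)
    have h2 : (r : ℝ) • v + (r * t) • e = (r : ℝ) • (v + t • e) := by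
      rw [mul_smul, smul_add]
      rfl
    rw [h2]
    push_cast
    linarith
  le v := (h.linearizeAlong_le_self e v).trans (h.le v)

end IsSublinearBounded

/-- Successive linearization of a sublinear function along a sequence. -/
def linearizeSeq (e : ℕ → E) (P : E → ℝ) : ℕ → E → ℝ
  | 0 => P
  | n + 1 => linearizeAlong (e n) (linearizeSeq e P n)

/-- The limit of the successive linearizations. -/
def linearizeLim (e : ℕ → E) (P : E → ℝ) (v : E) : ℝ := ⨅ n, linearizeSeq e P n v

namespace IsSublinearBounded

variable {c : ℝ} {P : E → ℝ}

theorem seq (h : IsSublinearBounded c P) (e : ℕ → E) (n : ℕ) :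
    IsSublinearBounded c (linearizeSeq e P n) := by
  induction n with
  | zero => exact h
  | succ n ih => exact ih.isSublinearBounded_linearizeAlong (e n)

theorem bddBelow_seq (h : IsSublinearBounded c P) (e : ℕ → E) (v : E) :
    BddBelow (range fun n => linearizeSeq e P n v) := by
  refine ⟨-(c * ‖v‖), ?_⟩
  rintro _ ⟨n, rfl⟩
  have h1 := (h.seq e n).neg_le v
  have h2 := (h.seq e n).le (-v)
  rw [norm_neg] at h2
  show _ ≤ linearizeSeq e P n v
  linarith

theorem tendsto_linearizeLim (h : IsSublinearBounded c P) (e : ℕ → E) (v : E) :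
    Tendsto (fun n => linearizeSeq e P n v) atTop (𝓝 (linearizeLim e P v)) :=
  tendsto_atTop_ciInf
    (antitone_nat_of_succ_le fun n => (h.seq e n).linearizeAlong_le_self (e n) v)
    (h.bddBelow_seq e v)

theorem linearizeLim_le (h : IsSublinearBounded c P) (e : ℕ → E) (n : ℕ) (v : E) :
    linearizeLim e P v ≤ linearizeSeq e P n v := ciInf_le (h.bddBelow_seq e v) n

theorem isSublinearBounded_linearizeLim (h : IsSublinearBounded c P) (e : ℕ → E) :
    IsSublinearBounded c (linearizeLim e P) where
  add v w := le_of_tendsto_of_tendsto' (h.tendsto_linearizeLim e _)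
    ((h.tendsto_linearizeLim e v).add (h.tendsto_linearizeLim e w)) fun n => (h.seq e n).add v w
  hom r hr v := le_of_tendsto_of_tendsto' (h.tendsto_linearizeLim e _)
    ((h.tendsto_linearizeLim e v).const_mul r) fun n => (h.seq e n).hom r hr v
  le v := (h.linearizeLim_le e 0 v).trans (h.le v)

/-- The step `n` forces oddness at `e n`, and later steps keep it: decreasing a sublinear function
cannot destroy `P e + P (-e) ≤ 0`. Continuity extends this from the dense sequence to all vectors.
-/
theorem linearizeLim_neg (h : IsSublinearBounded c P) {e : ℕ → E} (he : DenseRange e) (v : E) :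
    linearizeLim e P (-v) = -linearizeLim e P v := by
  have hL := h.isSublinearBounded_linearizeLim e
  have hcont := continuous_of_le_add_norm hL.lip
  have key : linearizeLim e P v + linearizeLim e P (-v) ≤ 0 := by
    refine he.induction_on (p := fun v => linearizeLim e P v +
      linearizeLim e P (-v) ≤ 0) v
      (isClosed_le (hcont.add (hcont.comp continuous_neg)) continuous_const) fun n => ?_
    have h1 := (h.seq e n).linearizeAlong_add_neg (e n)
    have h2 := h.linearizeLim_le e (n + 1) (e n)
    have h3 := h.linearizeLim_le e (n + 1) (-e n)
    simp only [linearizeSeq] at h2 h3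
    linarith
  linarith [hL.neg_le v]

/-- The limit of the successive linearizations along a dense sequence is linear. -/
theorem exists_linearizeLim_eq (h : IsSublinearBounded c P) {e : ℕ → E} (he : DenseRange e) :
    ∃ Q : StrongDual ℝ E, ∀ v, Q v = linearizeLim e P v := by
  have hL := h.isSublinearBounded_linearizeLim e
  refine ⟨AddMonoidHom.toRealLinearMap (AddMonoidHom.mk' (linearizeLim e P)
    fun v w => le_antisymm (hL.add v w) ?_) (continuous_of_le_add_norm hL.lip), fun v => rfl⟩
  have h1 := hL.add (-v) (-w)
  rw [← neg_add, h.linearizeLim_neg he, h.linearizeLim_neg he, h.linearizeLim_neg he] at h1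
  linarith

end IsSublinearBounded

/-! ### Measurable dependence of the linearization on a parameter -/

section Selection

variable {Ω : Type*} [MeasurableSpace Ω] {μ : Measure Ω}

/-- For fixed parameter the convolved sum is continuous in the splitting vector, so the infimum over
the separable space `E` reduces to a countable one. -/
theorem aemeasurable_iterate_selfInfConv [TopologicalSpace.SeparableSpace E] {c : Ω → ℝ} {Q : Ω → StrongDual ℝ E} {k : Ω → E → ℝ}
    (hk : ∀ᵐ ω ∂μ, IsHomLipschitzAbove (c ω) (Q ω) (k ω))
    (hm : ∀ v, AEMeasurable (fun ω => k ω v) μ) (n : ℕ) (v : E) :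
    AEMeasurable (fun ω => selfInfConv^[n] (k ω) v) μ := by
  induction n generalizing v with
  | zero => exact hm v
  | succ n ih =>
    simp only [Function.iterate_succ_apply']
    refine aemeasurable_iInf_of_continuous (fun w => (ih w).add (ih (v - w))) ?_
    filter_upwards [hk] with ω hω
    have := continuous_of_le_add_norm (hω.iterate n).lip
    fun_prop

theorem aemeasurable_linearizeSeq {c : Ω → ℝ} {P : Ω → E → ℝ}
    (hP : ∀ᵐ ω ∂μ, IsSublinearBounded (c ω) (P ω))
    (hm : ∀ v, AEMeasurable (fun ω => P ω v) μ) (e : ℕ → E) (n : ℕ) (v : E) :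
    AEMeasurable (fun ω => linearizeSeq e (P ω) n v) μ := by
  induction n generalizing v with
  | zero => exact hm v
  | succ n ih =>
    refine aemeasurable_iInf_of_continuous
      (fun t : NNReal => (ih (v + t • e n)).sub ((ih (e n)).const_mul (t : ℝ))) ?_
    filter_upwards [hP] with ω hω
    have := continuous_of_le_add_norm (hω.seq e n).lip
    fun_prop

/-- A measurable family of positively homogeneous Lipschitz functions with linear minorants has a
weak* measurable family of linear minorants. -/
theorem exists_aemeasurable_linear_minorant [TopologicalSpace.SeparableSpace E]
    {c : Ω → ℝ} {k : Ω → E → ℝ}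
    (hk : ∀ᵐ ω ∂μ, ∃ Q, IsHomLipschitzAbove (c ω) Q (k ω))
    (hm : ∀ v, AEMeasurable (fun ω => k ω v) μ) :
    ∃ Q : Ω → StrongDual ℝ E, (∀ᵐ ω ∂μ, ∀ v, Q ω v ≤ k ω v) ∧
      ∀ v, AEMeasurable (fun ω => Q ω v) μ := by
  have : ∃ R : Ω → StrongDual ℝ E, ∀ᵐ ω ∂μ, IsHomLipschitzAbove (c ω) (R ω) (k ω) := by
    classical
    -- This choice need not be measurable: `R` only witnesses, point by point, that the infima are
    -- bounded below.
    refine ⟨fun ω => if h : ∃ Q, IsHomLipschitzAbove (c ω) Q (k ω) then h.choose else 0, ?_⟩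
    filter_upwards [hk] with ω hω
    rw [dif_pos hω]
    exact hω.choose_spec
  obtain ⟨R, hR⟩ := this
  let e := TopologicalSpace.denseSeq E
  have he : DenseRange e := TopologicalSpace.denseRange_denseSeq E
  have hs : ∀ᵐ ω ∂μ, IsSublinearBounded (c ω) (sublinearHull (k ω)) :=
    hR.mono fun ω hω => hω.isSublinearBounded_sublinearHull
  have : ∃ Q : Ω → StrongDual ℝ E, ∀ᵐ ω ∂μ, ∀ v, Q ω v = linearizeLim e (sublinearHull (k ω)) v := by
    classical
    refine ⟨fun ω => if h : ∃ Q : StrongDual ℝ E, ∀ v, Q v = linearizeLim e (sublinearHull (k ω)) v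
      then h.choose else 0, ?_⟩
    filter_upwards [hs] with ω hω
    rw [dif_pos (hω.exists_linearizeLim_eq he)]
    exact (hω.exists_linearizeLim_eq he).choose_spec
  obtain ⟨Q, hQ⟩ := this
  refine ⟨Q, ?_, fun v => ?_⟩
  · filter_upwards [hQ, hs, hR] with ω h1 h2 h3 v
    rw [h1]
    exact (h2.linearizeLim_le e 0 v).trans (h3.sublinearHull_le v)
  · refine AEMeasurable.congr (AEMeasurable.iInf fun n => aemeasurable_linearizeSeq hs
      (fun w => AEMeasurable.iInf fun n => aemeasurable_iterate_selfInfConv hR hm n w) e n v)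
      (hQ.mono fun ω hω => (hω v).symm)

end Selection

end LinearMinorants

end

end InfHorizon

namespace InfHorizon

noncomputable section

/-! ### Characterizations of the generalized differentials -/

section Characterizations

theorem ereal_limsup_le_iff {α : Type*} {F : Filter α} {u : α → EReal} {c : ℝ} :
    limsup u F ≤ c ↔ ∀ ε : ℝ, 0 < ε → ∀ᶠ q in F, u q ≤ ((c + ε : ℝ) : EReal) := by
  constructor
  · intro h ε hε
    have : limsup u F < ((c + ε : ℝ) : EReal) :=
      h.trans_lt (EReal.coe_lt_coe_iff.2 (by linarith))
    exact (eventually_lt_of_limsup_lt this).mono fun q hq => hq.le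
  · intro h
    by_contra! hlt
    obtain ⟨r, hr1, hr2⟩ := EReal.lt_iff_exists_real_btwn.1 hlt
    have := h (r - c) (by linarith [EReal.coe_lt_coe_iff.1 hr1])
    rw [add_sub_cancel] at this
    exact absurd (limsup_le_of_le (h := this)) (not_le.2 hr2)

theorem le_ereal_liminf_iff {α : Type*} {F : Filter α} {u : α → EReal} {c : ℝ} :
    (c : EReal) ≤ liminf u F ↔ ∀ ε : ℝ, 0 < ε → ∀ᶠ q in F, ((c - ε : ℝ) : EReal) ≤ u q := by
  constructor
  · intro h ε hε
    have : ((c - ε : ℝ) : EReal) < liminf u F :=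
      (EReal.coe_lt_coe_iff.2 (by linarith)).trans_le h
    exact (eventually_lt_of_lt_liminf this).mono fun q hq => hq.le
  · intro h
    by_contra! hlt
    obtain ⟨r, hr1, hr2⟩ := EReal.lt_iff_exists_real_btwn.1 hlt
    have := h (c - r) (by linarith [EReal.coe_lt_coe_iff.1 hr2])
    rw [sub_sub_cancel] at this
    exact absurd (le_liminf_of_le (h := this)) (not_le.2 hr1)

theorem ereal_sub_div_coe_le_iff {y : EReal} {a θ c : ℝ} (hθ : 0 < θ) :
    (y - a) / (θ : EReal) ≤ c ↔ y ≤ ((a + θ * c : ℝ) : EReal) := by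
  induction y with
  | bot => simp [EReal.bot_div_of_pos_ne_top (EReal.coe_pos.2 hθ)]
  | top =>
    rw [EReal.top_sub_coe, EReal.top_div_of_pos_ne_top (EReal.coe_pos.2 hθ) (EReal.coe_ne_top θ)]
    exact iff_of_false (EReal.coe_lt_top _).not_ge (EReal.coe_lt_top _).not_ge
  | coe y =>
    rw [← EReal.coe_sub, ← EReal.coe_div, EReal.coe_le_coe_iff, EReal.coe_le_coe_iff,
      div_le_iff₀ hθ, sub_le_iff_le_add', mul_comm c]

theorem le_ereal_sub_div_coe_iff {y : EReal} {a θ c : ℝ} (hθ : 0 < θ) :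
    (c : EReal) ≤ (y - a) / (θ : EReal) ↔ ((a + θ * c : ℝ) : EReal) ≤ y := by
  induction y with
  | bot =>
    rw [EReal.bot_sub, EReal.bot_div_of_pos_ne_top (EReal.coe_pos.2 hθ) (EReal.coe_ne_top θ)]
    exact iff_of_false (EReal.bot_lt_coe _).not_ge (EReal.bot_lt_coe _).not_ge
  | top => simp [EReal.top_div_of_pos_ne_top (EReal.coe_pos.2 hθ)]
  | coe y =>
    rw [← EReal.coe_sub, ← EReal.coe_div, EReal.coe_le_coe_iff, EReal.coe_le_coe_iff,
      le_div_iff₀ hθ, le_sub_iff_add_le', mul_comm c]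

theorem tendsto_const_prod_nhds {α X : Type*} [TopologicalSpace X] (v : X) (F : Filter α) :
    Tendsto (fun θ => (v, θ)) F (𝓝 v ×ˢ F) := tendsto_const_nhds.prodMk tendsto_id

variable {E : Type*} [NormedAddCommGroup E] [NormedSpace ℝ E]

theorem eventually_snd_pos {α : Type*} (F : Filter α) :
    ∀ᶠ q : α × ℝ in F ×ˢ 𝓝[>] (0 : ℝ), 0 < q.2 :=
  tendsto_snd.eventually self_mem_nhdsWithin

theorem mem_gateauxSubdiff_iff {φ : E → EReal} {x : E} {a : ℝ} (hx : φ x = a)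
    {p : StrongDual ℝ E} :
    p ∈ gateauxSubdiff φ x ↔ ∀ v, ∀ ε : ℝ, 0 < ε → ∀ᶠ q : E × ℝ in 𝓝 v ×ˢ 𝓝[>] (0 : ℝ),
      ((a + q.2 * (p v - ε) : ℝ) : EReal) ≤ φ (x + q.2 • q.1) := by
  simp only [gateauxSubdiff, Set.mem_ofPred_eq, hx, EReal.coe_ne_bot, EReal.coe_ne_top, ne_eq,
    not_false_eq_true, true_and, lowerDirDeriv, le_ereal_liminf_iff]
  refine forall_congr' fun v => forall_congr' fun ε => forall_congr' fun _ =>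
    eventually_congr ((eventually_snd_pos _).mono fun q hq => ?_)
  rw [diffQuot, hx, le_ereal_sub_div_coe_iff hq]

theorem mem_gateauxSuperdiff_iff {f : E → ℝ} {x : E} {p : StrongDual ℝ E} :
    p ∈ gateauxSuperdiff (fun y => (f y : EReal)) x ↔
      ∀ v, ∀ ε : ℝ, 0 < ε → ∀ᶠ q : E × ℝ in 𝓝 v ×ˢ 𝓝[>] (0 : ℝ),
        f (x + q.2 • q.1) ≤ f x + q.2 * (p v + ε) := by
  simp only [gateauxSuperdiff, Set.mem_ofPred_eq, EReal.coe_ne_bot, EReal.coe_ne_top, ne_eq,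
    not_false_eq_true, true_and, upperDirDeriv, ereal_limsup_le_iff]
  refine forall_congr' fun v => forall_congr' fun ε => forall_congr' fun _ =>
    eventually_congr ((eventually_snd_pos _).mono fun q hq => ?_)
  rw [diffQuot, ereal_sub_div_coe_le_iff hq, EReal.coe_le_coe_iff]

/-- For a Lipschitz function only the difference quotients along `v` matter. -/
theorem mem_gateauxSuperdiff_iff_of_lipschitz {f : E → ℝ} {K : ℝ}
    (hf : ∀ y z, f y ≤ f z + K * ‖y - z‖) {x : E} {p : StrongDual ℝ E} :
    p ∈ gateauxSuperdiff (fun y => (f y : EReal)) x ↔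
      ∀ v, ∀ ε : ℝ, 0 < ε → ∀ᶠ θ in 𝓝[>] (0 : ℝ), f (x + θ • v) ≤ f x + θ * (p v + ε) := by
  rw [mem_gateauxSuperdiff_iff]
  refine forall_congr' fun v => ⟨fun h ε hε => (tendsto_const_prod_nhds v _).eventually (h ε hε),
    fun h ε hε => ?_⟩
  have h1 := (tendsto_snd (f := 𝓝 v)).eventually (h (ε / 2) (by linarith))
  have h2 : ∀ᶠ q : E × ℝ in 𝓝 v ×ˢ 𝓝[>] (0 : ℝ), K * ‖q.1 - v‖ < ε / 2 := by
    refine tendsto_fst.eventually (p := fun u => K * ‖u - v‖ < ε / 2) ?_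
    have : Continuous fun u : E => K * ‖u - v‖ := by fun_prop
    exact this.continuousAt.eventually_lt continuousAt_const (by simp; linarith)
  filter_upwards [h1, h2, eventually_snd_pos _] with q hq1 hq2 hq
  have h3 := hf (x + q.2 • q.1) (x + q.2 • v)
  rw [add_sub_add_left_eq_sub, ← smul_sub, norm_smul, Real.norm_of_nonneg hq.le] at h3
  nlinarith

end Characterizations

/-! ### Clarke calculus for Lipschitz functions -/

section Clarke

variable {E : Type*} [NormedAddCommGroup E] [NormedSpace ℝ E]

/-- The real valued Clarke directional derivative of a real valued function. -/
def clarkeReal (f : E → ℝ) (x v : E) : ℝ :=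
  (clarkeDirDeriv (fun y => (f y : EReal)) x v).toReal

theorem clarkeDirDeriv_le_iff {f : E → ℝ} {x v : E} {c : ℝ} :
    clarkeDirDeriv (fun y => (f y : EReal)) x v ≤ c ↔
      ∀ ε : ℝ, 0 < ε → ∀ᶠ q : E × ℝ in 𝓝 x ×ˢ 𝓝[>] (0 : ℝ),
        f (q.1 + q.2 • v) ≤ f q.1 + q.2 * (c + ε) := by
  rw [clarkeDirDeriv, ereal_limsup_le_iff]
  refine forall_congr' fun ε => forall_congr' fun _ =>
    eventually_congr ((eventually_snd_pos _).mono fun q hq => ?_)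
  rw [diffQuot, ereal_sub_div_coe_le_iff hq, EReal.coe_le_coe_iff]

variable {f : E → ℝ} {K : ℝ}

theorem clarkeDirDeriv_le_of_lipschitz (hf : ∀ y z, f y ≤ f z + K * ‖y - z‖) (x v : E) :
    clarkeDirDeriv (fun y => (f y : EReal)) x v ≤ ((K * ‖v‖ : ℝ) : EReal) := by
  refine clarkeDirDeriv_le_iff.2 fun ε hε => (eventually_snd_pos _).mono fun q hq => ?_
  have h := hf (q.1 + q.2 • v) q.1
  rw [add_sub_cancel_left, norm_smul, Real.norm_of_nonneg hq.le] at h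
  nlinarith

theorem le_clarkeDirDeriv_of_lipschitz (hf : ∀ y z, f y ≤ f z + K * ‖y - z‖) (x v : E) :
    ((-(K * ‖v‖) : ℝ) : EReal) ≤ clarkeDirDeriv (fun y => (f y : EReal)) x v := by
  by_contra! hlt
  obtain ⟨r, hr1, hr2⟩ := EReal.lt_iff_exists_real_btwn.1 hlt
  rw [EReal.coe_lt_coe_iff] at hr2
  have h := clarkeDirDeriv_le_iff.1 hr1.le ((-(K * ‖v‖) - r) / 2) (by linarith)
  obtain ⟨q, hq1, hq⟩ := (h.and (eventually_snd_pos _)).exists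
  have h := hf q.1 (q.1 + q.2 • v)
  rw [sub_add_cancel_left, norm_neg, norm_smul, Real.norm_of_nonneg hq.le] at h
  nlinarith

theorem coe_clarkeReal (hf : ∀ y z, f y ≤ f z + K * ‖y - z‖) (x v : E) :
    (clarkeReal f x v : EReal) = clarkeDirDeriv (fun y => (f y : EReal)) x v :=
  EReal.coe_toReal ((clarkeDirDeriv_le_of_lipschitz hf x v).trans_lt (EReal.coe_lt_top _)).ne
    ((EReal.bot_lt_coe _).trans_le (le_clarkeDirDeriv_of_lipschitz hf x v)).ne'

theorem clarkeReal_le_iff (hf : ∀ y z, f y ≤ f z + K * ‖y - z‖) {x v : E} {c : ℝ} :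
    clarkeReal f x v ≤ c ↔ ∀ ε : ℝ, 0 < ε → ∀ᶠ q : E × ℝ in 𝓝 x ×ˢ 𝓝[>] (0 : ℝ),
        f (q.1 + q.2 • v) ≤ f q.1 + q.2 * (c + ε) := by
  rw [← EReal.coe_le_coe_iff, coe_clarkeReal hf, clarkeDirDeriv_le_iff]

theorem tendsto_mul_right_nhdsGT {r : ℝ} (hr : 0 < r) :
    Tendsto (fun θ : ℝ => θ * r) (𝓝[>] (0 : ℝ)) (𝓝[>] (0 : ℝ)) := by
  refine tendsto_nhdsWithin_iff.2 ⟨?_, ?_⟩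
  · have : Continuous fun θ : ℝ => θ * r := by fun_prop
    simpa using (this.tendsto 0).mono_left nhdsWithin_le_nhds
  · filter_upwards [self_mem_nhdsWithin] with θ hθ
    exact mul_pos hθ hr

theorem tendsto_snd_mul_nhdsGT {α : Type*} (F : Filter α) {r : ℝ} (hr : 0 < r) :
    Tendsto (fun q : α × ℝ => q.2 * r) (F ×ˢ 𝓝[>] (0 : ℝ)) (𝓝[>] (0 : ℝ)) :=
  (tendsto_mul_right_nhdsGT hr).comp tendsto_snd

/-- Subadditivity holds because the base point is free: the increment along `v` may be taken from `z
+ θ w`, which still tends to `x`. -/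
theorem isSublinearBounded_clarkeReal (hf : ∀ y z, f y ≤ f z + K * ‖y - z‖) (x : E) :
    IsSublinearBounded K (clarkeReal f x) where
  add v w := by
    refine (clarkeReal_le_iff hf).2 fun ε hε => ?_
    have h1 := (clarkeReal_le_iff hf).1 (le_refl (clarkeReal f x v)) (ε / 2) (by linarith)
    have h2 := (clarkeReal_le_iff hf).1 (le_refl (clarkeReal f x w)) (ε / 2) (by linarith)
    have ht : Tendsto (fun q : E × ℝ => (q.1 + q.2 • w, q.2)) (𝓝 x ×ˢ 𝓝[>] (0 : ℝ))
        (𝓝 x ×ˢ 𝓝[>] (0 : ℝ)) := by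
      refine Tendsto.prodMk ?_ tendsto_snd
      have hc : Continuous fun q : E × ℝ => q.1 + q.2 • w := by fun_prop
      have hle : 𝓝 x ×ˢ 𝓝[>] (0 : ℝ) ≤ 𝓝 (x, (0 : ℝ)) := by
        rw [nhds_prod_eq]
        exact prod_mono_right (𝓝 x) nhdsWithin_le_nhds
      have := (hc.tendsto (x, 0)).mono_left hle
      simpa using this
    filter_upwards [ht.eventually h1, h2] with q hq1 hq2
    rw [smul_add, add_comm (q.2 • v), ← add_assoc]
    linarith
  hom r hr v := by
    refine (clarkeReal_le_iff hf).2 fun ε hε => ?_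
    have h1 := (clarkeReal_le_iff hf).1 (le_refl (clarkeReal f x v)) (ε / r) (by positivity)
    have ht : Tendsto (fun q : E × ℝ => (q.1, q.2 * r)) (𝓝 x ×ˢ 𝓝[>] (0 : ℝ))
        (𝓝 x ×ˢ 𝓝[>] (0 : ℝ)) := tendsto_fst.prodMk (tendsto_snd_mul_nhdsGT _ hr)
    filter_upwards [ht.eventually h1] with q hq1
    rw [smul_smul]
    refine hq1.trans (le_of_eq ?_)
    field_simp
  le v := by
    rw [← EReal.coe_le_coe_iff, coe_clarkeReal hf]
    exact clarkeDirDeriv_le_of_lipschitz hf x v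

theorem IsSublinearBounded.hom_eq {c : ℝ} {P : E → ℝ} (h : IsSublinearBounded c P) {r : ℝ}
    (hr : 0 < r) (v : E) : P (r • v) = r * P v := by
  refine le_antisymm (h.hom r hr v) ?_
  have h1 := h.hom r⁻¹ (by positivity) (r • v)
  rwa [inv_smul_smul₀ hr.ne', inv_mul_eq_div, le_div_iff₀' hr] at h1

/-- A linear functional below the sum of two sublinear functions is the sum of functionals below
each of them. -/
theorem exists_add_eq_of_le_add_sublinear {a b : ℝ} {A B : E → ℝ} (hA : IsSublinearBounded a A)
    (hB : IsSublinearBounded b B) {p : StrongDual ℝ E} (hp : ∀ v, p v ≤ A v + B v) :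
    ∃ q r : StrongDual ℝ E, (∀ v, q v ≤ A v) ∧ (∀ v, r v ≤ B v) ∧ q + r = p := by
  -- On the diagonal of `E × E` the functional `(v, v) ↦ p v` lies below the sublinear function `(v,
  -- w) ↦ A v + B w`. The restrictions of a Hahn-Banach extension to the two axes are the summands.
  let diag : E × E →ₗ.[ℝ] ℝ := ⟨LinearMap.eqLocus (LinearMap.fst ℝ E E) (LinearMap.snd ℝ E E),
    (p : E →ₗ[ℝ] ℝ) ∘ₗ LinearMap.fst ℝ E E ∘ₗ Submodule.subtype _⟩
  obtain ⟨g, hg1, hg2⟩ := exists_extension_of_le_sublinear diag (fun z => A z.1 + B z.2)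
    (fun c hc z => by
      show A (c • z.1) + B (c • z.2) = _
      rw [hA.hom_eq hc, hB.hom_eq hc, mul_add])
    (fun z w => by
      show A (z.1 + w.1) + B (z.2 + w.2) ≤ _
      linarith [hA.add z.1 w.1, hB.add z.2 w.2])
    (fun z => by
      have h1 : z.1.1 = z.1.2 := z.2
      have h2 := hp z.1.1
      show p z.1.1 ≤ _
      simp only [← h1]
      exact h2)
  have hq : ∀ v, g (v, 0) ≤ A v := fun v => by simpa [hB.zero] using hg2 (v, 0)
  have hr : ∀ v, g (0, v) ≤ B v := fun v => by simpa [hA.zero] using hg2 (0, v)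
  have bound : ∀ {c : ℝ} {P : E → ℝ}, IsSublinearBounded c P → ∀ ℓ : E →ₗ[ℝ] ℝ, (∀ v, ℓ v ≤ P v) →
      ∀ v, ‖ℓ v‖ ≤ c * ‖v‖ := by
    intro c P hP ℓ hℓ v
    rw [Real.norm_eq_abs, abs_le]
    have h1 := (hℓ v).trans (hP.le v)
    have h2 := (hℓ (-v)).trans (hP.le (-v))
    rw [map_neg, norm_neg] at h2
    constructor <;> linarith
  refine ⟨(g ∘ₗ LinearMap.inl ℝ E E).mkContinuous a (bound hA _ hq),
    (g ∘ₗ LinearMap.inr ℝ E E).mkContinuous b (bound hB _ hr), hq, hr, ?_⟩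
  ext v
  have h1 := hg1 ⟨(v, v), rfl⟩
  have h2 : g (v, v) = g (v, 0) + g (0, v) := by
    rw [← map_add]
    simp
  exact h2.symm.trans h1

/-- The multiplier rule: if `f - p` is minimal over `C` at `x` then `p` lies in the sum of the
Clarke subdifferential of `f` and of the Clarke normal cone to `C`. -/
theorem mem_clarkeSubdiff_add_clarkeNormalCone (hf : ∀ y z, f y ≤ f z + K * ‖y - z‖)
    (hK : 0 ≤ K) {C : Set E} {x : E} (hx : x ∈ C) {p : StrongDual ℝ E}
    (hmin : ∀ y ∈ C, f x - p x ≤ f y - p y) :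
    p ∈ clarkeSubdiff (fun y => (f y : EReal)) x + clarkeNormalCone C x := by
  have hd : ∀ y z, Metric.infDist y C ≤ Metric.infDist z C + 1 * ‖y - z‖ := fun y z => by
    rw [one_mul, ← dist_eq_norm]
    exact Metric.infDist_le_infDist_add_dist
  have hM : 0 ≤ K + ‖p‖ := by positivity
  -- Exact penalization: `f - p` is Lipschitz with constant `K + ‖p‖`, so adding that multiple of
  -- the distance to `C` turns the constrained minimum into an unconstrained one.
  have pen : ∀ z, f x - p x ≤ f z - p z + (K + ‖p‖) * Metric.infDist z C := by
    intro z
    refine le_of_forall_pos_le_add fun ε hε => ?_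
    obtain ⟨y, hy, hzy⟩ := (Metric.infDist_lt_iff ⟨x, hx⟩).1
      (show Metric.infDist z C < Metric.infDist z C + ε / (K + ‖p‖ + 1) by
        have : 0 < ε / (K + ‖p‖ + 1) := by positivity
        linarith)
    have h1 := hmin y hy
    have h2 := hf y z
    have h3 : p z - p y ≤ ‖p‖ * ‖y - z‖ := by
      rw [← map_sub, norm_sub_rev y z]
      exact (le_abs_self _).trans (p.le_opNorm _)
    rw [dist_comm, dist_eq_norm] at hzy
    have h4 : (K + ‖p‖) * ‖y - z‖ ≤
        (K + ‖p‖) * (Metric.infDist z C + ε / (K + ‖p‖ + 1)) := by gcongr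
    have h5 : (K + ‖p‖) * (ε / (K + ‖p‖ + 1)) ≤ ε := by
      rw [mul_div_assoc', div_le_iff₀ (by positivity)]
      nlinarith
    linarith
  have hB := isSublinearBounded_clarkeReal hd x
  have hB' : IsSublinearBounded ((K + ‖p‖) * 1)
      (fun v => (K + ‖p‖) * clarkeReal (fun y => Metric.infDist y C) x v) :=
    ⟨fun v w => by nlinarith [hB.add v w], fun r hr v => by nlinarith [hB.hom r hr v],
      fun v => by nlinarith [hB.le v]⟩
  obtain ⟨q, r, hq, hr, rfl⟩ := exists_add_eq_of_le_add_sublinear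
    (isSublinearBounded_clarkeReal hf x) hB' (p := p) fun v => by
      refine le_of_forall_pos_le_add fun ε hε => ?_
      -- The error enters once through `f` and `K + ‖p‖` times through the distance function, so
      -- this share makes the total equal to `ε`.
      have hη : 0 < ε / (1 + (K + ‖p‖)) := by positivity
      have h1 := (clarkeReal_le_iff hf).1 (le_refl (clarkeReal f x v)) _ hη
      have h2 := (clarkeReal_le_iff hd).1
        (le_refl (clarkeReal (fun y => Metric.infDist y C) x v)) _ hη
      obtain ⟨θ, ⟨hθ1, hθ2⟩, hθ⟩ := (((tendsto_const_prod_nhds x _).eventually (h1.and h2)).and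
        self_mem_nhdsWithin).exists
      replace hθ : 0 < θ := hθ
      have h3 := pen (x + θ • v)
      simp only [Metric.infDist_zero_of_mem hx, zero_add] at hθ2
      rw [map_add, map_smul, smul_eq_mul] at h3
      have h4 := mul_le_mul_of_nonneg_left hθ2 hM
      refine le_of_mul_le_mul_left ?_ hθ
      have h5 : ε / (1 + (K + ‖p‖)) * (1 + (K + ‖p‖)) = ε := by field_simp
      calc θ * p v ≤ θ * (clarkeReal f x v + ε / (1 + (K + ‖p‖))) + (K + ‖p‖) *
            (θ * (clarkeReal (fun y => Metric.infDist y C) x v + ε / (1 + (K + ‖p‖)))) := by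
            linarith
        _ = θ * (clarkeReal f x v + (K + ‖p‖) * clarkeReal (fun y => Metric.infDist y C) x v +
            ε / (1 + (K + ‖p‖)) * (1 + (K + ‖p‖))) := by ring
        _ = _ := by rw [h5]
  refine Set.add_mem_add ⟨EReal.coe_ne_bot _, EReal.coe_ne_top _, fun v => ?_⟩ fun v hv => ?_
  · rw [← coe_clarkeReal hf, EReal.coe_le_coe_iff]
    exact hq v
  -- On tangent vectors the penalty has Clarke derivative zero, so the functional below it is
  -- nonpositive there.
  · have h1 : clarkeReal (fun y => Metric.infDist y C) x v = 0 := by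
      rw [clarkeReal, show clarkeDirDeriv _ x v = 0 from hv, EReal.toReal_zero]
    simpa [h1] using hr v

end Clarke

end

end InfHorizon

namespace InfHorizon

noncomputable section

/-! ### Existence of trajectories of Lipschitz differential inclusions -/

section Filippov

variable {E : Type*} [NormedAddCommGroup E] [NormedSpace ℝ E]

/-- The trajectory with velocity `y` that passes through `ξ` at time `c`. -/
def trajectory (c : ℝ) (ξ : E) (y : ℝ → E) (s : ℝ) : E := ξ + ∫ τ in c..s, y τ

/-- The distance of the velocity `y` from the admissible velocities along its trajectory. -/
def defect (Γ : ℝ → E → Set E) (c : ℝ) (ξ : E) (y : ℝ → E) (s : ℝ) : ℝ :=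
  Metric.infDist (y s) (Γ s (trajectory c ξ y s))

theorem defect_nonneg (Γ : ℝ → E → Set E) (c : ℝ) (ξ : E) (y : ℝ → E) (s : ℝ) :
    0 ≤ defect Γ c ξ y s := Metric.infDist_nonneg

theorem locallyIntegrable_norm {E : Type*} [NormedAddCommGroup E] {f : ℝ → E} (hf : LocallyIntegrable f) :
    LocallyIntegrable fun s => ‖f s‖ :=
  hf.mono hf.aestronglyMeasurable.norm (Eventually.of_forall fun _ => (norm_norm _).le)

/-- `Γ` has nonempty closed values, is measurable in time and Lipschitz in space with the locally
integrable modulus `γ`. -/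
structure IsLipschitzVelocity (Γ : ℝ → E → Set E) (γ : ℝ → ℝ) : Prop where
  nonempty : ∀ s x, (Γ s x).Nonempty
  closed : ∀ s x, IsClosed (Γ s x)
  aemeasurable : ∀ x v, AEMeasurable (fun s => Metric.infDist v (Γ s x))
  nonneg : ∀ s, 0 ≤ γ s
  locallyIntegrable : LocallyIntegrable γ
  lip : ∀ s x x' v, Metric.infDist v (Γ s x) ≤ Metric.infDist v (Γ s x') + γ s * ‖x - x'‖

theorem continuous_trajectory (c : ℝ) (ξ : E) {y : ℝ → E} (hy : LocallyIntegrable y) :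
    Continuous (trajectory c ξ y) :=
  continuous_const.add (continuous_primitive_of_locallyIntegrable hy c)

theorem trajectory_sub_trajectory (c : ℝ) (ξ : E) {y z : ℝ → E} (hy : LocallyIntegrable y)
    (hz : LocallyIntegrable z) (s : ℝ) :
    trajectory c ξ y s - trajectory c ξ z s = ∫ τ in c..s, y τ - z τ := by
  rw [trajectory, trajectory, add_sub_add_left_eq_sub, intervalIntegral.integral_sub
    (intervalIntegrable_of_locallyIntegrable hy c s)
    (intervalIntegrable_of_locallyIntegrable hz c s)]

theorem norm_trajectory_sub_le (c : ℝ) (ξ : E) {y z : ℝ → E} (hy : LocallyIntegrable y)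
    (hz : LocallyIntegrable z) {M : ℝ → ℝ} (hM : LocallyIntegrable M)
    (h : ∀ᵐ s, ‖y s - z s‖ ≤ M s) (s : ℝ) :
    ‖trajectory c ξ y s - trajectory c ξ z s‖ ≤ ∫ τ in uIoc c s, M τ := by
  rw [trajectory_sub_trajectory c ξ hy hz]
  refine intervalIntegral.norm_integral_le_integral_norm_uIoc.trans ?_
  refine setIntegral_mono_ae ?_ (integrableOn_uIoc_of_locallyIntegrable hM c s) h
  exact (integrableOn_uIoc_of_locallyIntegrable (hy.sub hz) c s).norm

variable {Γ : ℝ → E → Set E} {γ : ℝ → ℝ}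

namespace IsLipschitzVelocity

omit [NormedSpace ℝ E] in
theorem lip_prod (h : IsLipschitzVelocity Γ γ) (s : ℝ) (x x' v v' : E) :
    Metric.infDist v (Γ s x) ≤ Metric.infDist v' (Γ s x') + (‖v - v'‖ + γ s * ‖x - x'‖) := by
  have h1 := h.lip s x x' v'
  have h2 : Metric.infDist v (Γ s x) ≤ Metric.infDist v' (Γ s x) + dist v v' :=
    Metric.infDist_le_infDist_add_dist
  rw [dist_eq_norm] at h2
  linarith

omit [NormedSpace ℝ E] in
theorem continuous_infDist (h : IsLipschitzVelocity Γ γ) (s : ℝ) :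
    Continuous fun z : E × E => Metric.infDist z.2 (Γ s z.1) := by
  refine continuous_of_le_add_norm (c := 1 + γ s) fun z w =>
    (h.lip_prod s z.1 w.1 z.2 w.2).trans ?_
  have h1 : ‖z.1 - w.1‖ ≤ ‖z - w‖ := norm_fst_le (z - w)
  have h2 : ‖z.2 - w.2‖ ≤ ‖z - w‖ := norm_snd_le (z - w)
  have h3 := mul_le_mul_of_nonneg_left h1 (h.nonneg s)
  linarith

omit [NormedSpace ℝ E] in
theorem aemeasurable_infDist (h : IsLipschitzVelocity Γ γ) {x v : ℝ → E}
    (hx : AEStronglyMeasurable x) (hv : AEStronglyMeasurable v) :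
    AEMeasurable fun s => Metric.infDist (v s) (Γ s (x s)) := by
  have hp : AEStronglyMeasurable (fun s => (x s, v s)) volume := hx.prodMk hv
  have h1 : ∀ z : E × E, AEMeasurable (fun s => Metric.infDist z.2 (Γ s z.1)) volume :=
    fun z => h.aemeasurable z.1 z.2
  have h2 : ∀ᵐ s : ℝ, Continuous fun z : E × E => Metric.infDist z.2 (Γ s z.1) :=
    Eventually.of_forall h.continuous_infDist
  have h3 := aestronglyMeasurable_caratheodory_comp
    (F := fun s (z : E × E) => Metric.infDist z.2 (Γ s z.1)) h1 h2 hp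
  exact h3

theorem defect_le (h : IsLipschitzVelocity Γ γ) (c : ℝ) (ξ : E) (y z : ℝ → E) (s : ℝ) :
    defect Γ c ξ y s ≤ defect Γ c ξ z s +
      (‖y s - z s‖ + γ s * ‖trajectory c ξ y s - trajectory c ξ z s‖) := h.lip_prod _ _ _ _ _

theorem aemeasurable_defect (h : IsLipschitzVelocity Γ γ) (c : ℝ) (ξ : E) {y : ℝ → E}
    (hy : LocallyIntegrable y) : AEMeasurable (defect Γ c ξ y) :=
  h.aemeasurable_infDist (continuous_trajectory c ξ hy).aestronglyMeasurable
    hy.aestronglyMeasurable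

/-- The defects of two velocities differ by locally integrable terms, so one velocity with
integrable defect controls all the others. -/
theorem defect_locallyIntegrable (h : IsLipschitzVelocity Γ γ) (c : ℝ) (ξ : E) {y z : ℝ → E}
    (hy : LocallyIntegrable y) (hz : LocallyIntegrable z)
    (hd : LocallyIntegrable (defect Γ c ξ z)) : LocallyIntegrable (defect Γ c ξ y) := by
  have hb : LocallyIntegrable fun s => defect Γ c ξ z s +
      (‖y s - z s‖ + γ s * ‖trajectory c ξ y s - trajectory c ξ z s‖) :=
    hd.add ((locallyIntegrable_norm (hy.sub hz)).add (h.locallyIntegrable.mul_continuous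
      ((continuous_trajectory c ξ hy).sub (continuous_trajectory c ξ hz)).norm))
  refine hb.mono (h.aemeasurable_defect c ξ hy).aestronglyMeasurable
    (Eventually.of_forall fun s => ?_)
  rw [Real.norm_of_nonneg (defect_nonneg Γ c ξ y s)]
  exact (h.defect_le c ξ y z s).trans (Real.le_norm_self _)

/-- One step of the approximation scheme: the velocity is moved close to the admissible velocities
along the current trajectory. -/
theorem exists_approximate_selection [TopologicalSpace.SeparableSpace E]
    (h : IsLipschitzVelocity Γ γ) (c : ℝ) (ξ : E) {y z : ℝ → E}
    (hy : LocallyIntegrable y) (hz : LocallyIntegrable z)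
    (hd : LocallyIntegrable (defect Γ c ξ z)) {ε : ℝ → ℝ} (hε : LocallyIntegrable ε)
    (hε0 : ∀ s, 0 < ε s) :
    ∃ y' : ℝ → E, LocallyIntegrable y' ∧ (∀ᵐ s, ‖y' s - y s‖ ≤ defect Γ c ξ y s + ε s) ∧
      ∀ᵐ s, Metric.infDist (y' s) (Γ s (trajectory c ξ y s)) ≤ ε s := by
  let e := TopologicalSpace.denseSeq E
  have he : DenseRange e := TopologicalSpace.denseRange_denseSeq E
  have hym := hy.aestronglyMeasurable
  have hem : ∀ i, AEStronglyMeasurable (fun s => y s + e i) := fun i =>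
    hym.add aestronglyMeasurable_const
  -- Both requirements on the correction `e i`, being short and landing near the velocity set, are
  -- encoded by the negativity of one function, so that a measurable index can be chosen.
  let A : ℕ → ℝ → ℝ := fun i s => max (‖e i‖ - (defect Γ c ξ y s + ε s))
    (Metric.infDist (y s + e i) (Γ s (trajectory c ξ y s)) - ε s)
  have hA : ∀ i, AEMeasurable (A i) := fun i =>
    (aemeasurable_const.sub ((h.aemeasurable_defect c ξ hy).add
      hε.aestronglyMeasurable.aemeasurable)).max
    ((h.aemeasurable_infDist (continuous_trajectory c ξ hy).aestronglyMeasurable (hem i)).sub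
      hε.aestronglyMeasurable.aemeasurable)
  have hex : ∀ s, ∃ i, A i s < 0 := by
    intro s
    obtain ⟨w, hw, hyw⟩ := (Metric.infDist_lt_iff (h.nonempty s (trajectory c ξ y s))).1
      (show defect Γ c ξ y s < defect Γ c ξ y s + ε s / 2 by linarith [hε0 s])
    obtain ⟨i, hi⟩ := he.exists_dist_lt (w - y s) (half_pos (hε0 s))
    rw [dist_eq_norm] at hi hyw
    refine ⟨i, max_lt ?_ ?_⟩
    · have := norm_sub_norm_le (e i) (w - y s)
      rw [norm_sub_rev (e i)] at this
      rw [norm_sub_rev] at hyw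
      linarith
    · have := Metric.infDist_le_dist_of_mem (x := y s + e i) hw
      rw [dist_eq_norm, show y s + e i - w = -(w - y s - e i) by abel, norm_neg] at this
      linarith [hε0 s]
  obtain ⟨N, hN, hAN⟩ := exists_measurable_index hA (Eventually.of_forall hex)
  have hNm : StronglyMeasurable fun s => e (N s) :=
    (StronglyMeasurable.of_discrete (f := e)).comp_measurable hN
  have h1 : ∀ᵐ s, ‖e (N s)‖ ≤ defect Γ c ξ y s + ε s := hAN.mono fun s hs => by
    linarith [(max_lt_iff.1 hs).1]
  refine ⟨fun s => y s + e (N s), hy.add ?_, ?_, ?_⟩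
  · refine ((h.defect_locallyIntegrable c ξ hy hz hd).add hε).mono hNm.aestronglyMeasurable ?_
    filter_upwards [h1] with s hs using hs.trans (Real.le_norm_self _)
  · filter_upwards [h1] with s hs
    rwa [add_sub_cancel_left]
  · filter_upwards [hAN] with s hs
    linarith [(max_lt_iff.1 hs).2]

end IsLipschitzVelocity

theorem sum_range_div_pow_le {ε : ℝ} (hε : 0 ≤ ε) (n : ℕ) :
    ∑ k ∈ Finset.range n, ε / 2 ^ (k + 1) ≤ ε := by
  have h : ∑ k ∈ Finset.range n, ε / 2 ^ (k + 1) = ε - ε / 2 ^ n := by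
    induction n with
    | zero => simp
    | succ n ih =>
      rw [Finset.sum_range_succ, ih, pow_succ]
      field_simp
      ring
  rw [h]
  have : 0 ≤ ε / 2 ^ n := by positivity
  linarith

/-- Filippov's theorem: if `M` is a supersolution of the error equation, then there is a solution of
the differential inclusion whose velocity differs from `y₀` by at most `M`. -/
theorem IsLipschitzVelocity.exists_trajectory [CompleteSpace E]
    [TopologicalSpace.SeparableSpace E] (h : IsLipschitzVelocity Γ γ) (c : ℝ) (ξ : E) {y₀ : ℝ → E}
    (hy₀ : LocallyIntegrable y₀) {ε : ℝ → ℝ} (hε : LocallyIntegrable ε) (hε0 : ∀ s, 0 < ε s)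
    {M : ℝ → ℝ} (hM : LocallyIntegrable M)
    (hsup : ∀ᵐ s, defect Γ c ξ y₀ s + 2 * ε s + γ s * ∫ τ in uIoc c s, M τ ≤ M s)
    (hM0 : ∀ s, 0 ≤ M s) :
    ∃ y : ℝ → E, LocallyIntegrable y ∧ (∀ᵐ s, y s ∈ Γ s (trajectory c ξ y s)) ∧
      ∀ᵐ s, ‖y s - y₀ s‖ ≤ M s := by
  have hd₀ : LocallyIntegrable (defect Γ c ξ y₀) := by
    refine hM.mono (h.aemeasurable_defect c ξ hy₀).aestronglyMeasurable
      (hsup.mono fun s hs => ?_)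
    rw [Real.norm_of_nonneg (defect_nonneg Γ c ξ y₀ s), Real.norm_of_nonneg (hM0 s)]
    have h1 : 0 ≤ γ s * ∫ τ in uIoc c s, M τ :=
      mul_nonneg (h.nonneg s) (integral_nonneg fun τ => hM0 τ)
    linarith [hε0 s]
  -- Each step spends two consecutive tolerances. The two geometric series sum to at most `ε` each,
  -- which accounts for `2 * ε s` in the supersolution inequality.
  let ε' : ℕ → ℝ → ℝ := fun n s => ε s / 2 ^ (n + 1)
  have hε' : ∀ n, LocallyIntegrable (ε' n) := fun n => by
    have := hε.smul ((2 : ℝ) ^ (n + 1))⁻¹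
    refine this.congr (Eventually.of_forall fun s => ?_)
    simp only [Pi.smul_apply, smul_eq_mul, ε']
    ring
  have hε'0 : ∀ n s, 0 < ε' n s := fun n s => div_pos (hε0 s) (by positivity)
  choose step hstep1 hstep2 hstep3 using fun (y : {y : ℝ → E // LocallyIntegrable y}) (n : ℕ) =>
    h.exists_approximate_selection c ξ y.2 hy₀ hd₀ (hε' n) (hε'0 n)
  let Y : ℕ → {y : ℝ → E // LocallyIntegrable y} := fun n =>
    Nat.rec ⟨y₀, hy₀⟩ (fun n y => ⟨step y n, hstep1 y n⟩) n
  let σ : ℕ → ℝ → ℝ := fun n s => defect Γ c ξ (Y n).1 s + ε' n s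
  have hσ : ∀ n, LocallyIntegrable (σ n) := fun n =>
    (h.defect_locallyIntegrable c ξ (Y n).2 hy₀ hd₀).add (hε' n)
  have hσ0 : ∀ n s, 0 ≤ σ n s := fun n s => add_nonneg Metric.infDist_nonneg (hε'0 n s).le
  have hYσ : ∀ n, ∀ᵐ s, ‖(Y (n + 1)).1 s - (Y n).1 s‖ ≤ σ n s := fun n => hstep2 (Y n) n
  -- The new velocity is almost admissible along the old trajectory. Its defect along its own
  -- trajectory therefore comes only from the distance between the two trajectories, at most the
  -- integral of `σ n`.
  have hσ_succ : ∀ n, ∀ᵐ s, σ (n + 1) s ≤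
      ε' n s + ε' (n + 1) s + γ s * ∫ τ in uIoc c s, σ n τ := by
    intro n
    filter_upwards [hstep3 (Y n) n] with s hs
    have h1 := norm_trajectory_sub_le c ξ (Y (n + 1)).2 (Y n).2 (hσ n) (hYσ n) s
    have h2 := h.lip s (trajectory c ξ (Y (n + 1)).1 s) (trajectory c ξ (Y n).1 s) ((Y (n + 1)).1 s)
    have h3 := mul_le_mul_of_nonneg_left h1 (h.nonneg s)
    have h4 : Metric.infDist ((Y (n + 1)).1 s) (Γ s (trajectory c ξ (Y n).1 s)) ≤ ε' n s := hs
    show Metric.infDist ((Y (n + 1)).1 s) (Γ s (trajectory c ξ (Y (n + 1)).1 s)) + ε' (n + 1) s ≤ _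
    linarith
  -- The partial sums satisfy the integral recursion for which `M` is a supersolution, so `M`
  -- dominates them by induction. This yields pointwise convergence of the velocities and the bound
  -- on the limit together.
  have hsum : ∀ n, ∀ᵐ s, ∑ k ∈ Finset.range (n + 1), σ k s ≤ M s := by
    intro n
    induction n with
    | zero =>
      refine hsup.mono fun s hs => ?_
      have h1 : 0 ≤ γ s * ∫ τ in uIoc c s, M τ :=
        mul_nonneg (h.nonneg s) (integral_nonneg fun τ => hM0 τ)
      have h2 : ε' 0 s = ε s / 2 := by simp [ε']
      have h3 : σ 0 s = defect Γ c ξ y₀ s + ε' 0 s := rfl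
      rw [zero_add, Finset.sum_range_one]
      linarith [hε0 s]
    | succ n ih =>
      filter_upwards [ae_all_iff.2 hσ_succ, hsup] with s hs hsup'
      have h1 : ∑ k ∈ Finset.range (n + 1), ∫ τ in uIoc c s, σ k τ ≤ ∫ τ in uIoc c s, M τ := by
        rw [← integral_finsetSum _ fun k _ => integrableOn_uIoc_of_locallyIntegrable (hσ k) c s]
        exact setIntegral_mono_ae (integrable_finsetSum _ fun k _ =>
          integrableOn_uIoc_of_locallyIntegrable (hσ k) c s)
          (integrableOn_uIoc_of_locallyIntegrable hM c s) ih
      have h2 := mul_le_mul_of_nonneg_left h1 (h.nonneg s)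
      have h3 : ∑ k ∈ Finset.range (n + 1), σ (k + 1) s ≤
          ∑ k ∈ Finset.range (n + 1), ε' k s + ∑ k ∈ Finset.range (n + 1), ε' (k + 1) s +
          γ s * ∑ k ∈ Finset.range (n + 1), ∫ τ in uIoc c s, σ k τ := by
        rw [Finset.mul_sum, ← Finset.sum_add_distrib, ← Finset.sum_add_distrib]
        exact Finset.sum_le_sum fun k _ => hs k
      have h4 := sum_range_div_pow_le (hε0 s).le (n + 1)
      have h5 := sum_range_div_pow_le (hε0 s).le (n + 2)
      rw [Finset.sum_range_succ'] at h5 ⊢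
      have h6 : σ 0 s = defect Γ c ξ y₀ s + ε' 0 s := rfl
      have h7 : ε' 0 s = ε s / 2 ^ (0 + 1) := rfl
      have h8 : ∑ k ∈ Finset.range (n + 1), ε' k s = ∑ k ∈ Finset.range (n + 1), ε s / 2 ^ (k + 1) :=
        rfl
      have h9 : ∑ k ∈ Finset.range (n + 1), ε' (k + 1) s =
        ∑ k ∈ Finset.range (n + 1), ε s / 2 ^ (k + 1 + 1) := rfl
      linarith
  have hsum' : ∀ᵐ s, ∀ n, ∑ k ∈ Finset.range n, σ k s ≤ M s := by
    filter_upwards [ae_all_iff.2 hsum] with s hs n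
    refine le_trans ?_ (hs n)
    rw [Finset.sum_range_succ]
    linarith [hσ0 n s]
  have hYσ' := ae_all_iff.2 hYσ
  have hdist : ∀ᵐ s, ∀ n, dist ((Y n).1 s) ((Y (n + 1)).1 s) ≤ σ n s :=
    hYσ'.mono fun s hs n => by
      rw [dist_comm, dist_eq_norm]
      exact hs n
  have hsummable : ∀ᵐ s, Summable fun n => σ n s := hsum'.mono fun s hs =>
    summable_of_sum_range_le (fun n => hσ0 n s) hs
  have hYM : ∀ᵐ s, ∀ n, ‖(Y n).1 s - y₀ s‖ ≤ M s := by
    filter_upwards [hsum', hdist] with s h1 h2 n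
    rw [← dist_eq_norm, dist_comm]
    exact (dist_le_range_sum_of_dist_le (f := fun n => (Y n).1 s) n fun {k} _ => h2 k).trans (h1 n)
  obtain ⟨y, hym, hylim⟩ := exists_stronglyMeasurable_limit_of_tendsto_ae
    (fun n => (Y n).2.aestronglyMeasurable) (by
      filter_upwards [hdist, hsummable] with s h1 h2
      exact cauchySeq_tendsto_of_complete (cauchySeq_of_dist_le_of_summable _ h1 h2))
  have hyM : ∀ᵐ s, ‖y s - y₀ s‖ ≤ M s := by
    filter_upwards [hylim, hYM] with s h1 h2
    exact le_of_tendsto' (h1.sub_const _).norm h2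
  have hy : LocallyIntegrable y := by
    refine ((locallyIntegrable_norm hy₀).add hM).mono hym.aestronglyMeasurable ?_
    filter_upwards [hyM] with s hs
    have h1 := norm_sub_norm_le (y s) (y₀ s)
    refine le_trans ?_ (Real.le_norm_self _)
    show ‖y s‖ ≤ ‖y₀ s‖ + M s
    linarith
  refine ⟨y, hy, ?_, hyM⟩
  have htraj : ∀ s, Tendsto (fun n => trajectory c ξ (Y n).1 s) atTop (𝓝 (trajectory c ξ y s)) := by
    intro s
    refine tendsto_const_nhds.add ?_
    refine intervalIntegral.tendsto_integral_filter_of_dominated_convergence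
      (fun s => ‖y₀ s‖ + M s)
      (Eventually.of_forall fun n => (Y n).2.aestronglyMeasurable.restrict)
      (Eventually.of_forall fun n => ?_)
      (intervalIntegrable_of_locallyIntegrable ((locallyIntegrable_norm hy₀).add hM) c s) ?_
    · filter_upwards [hYM] with τ hτ _
      have h1 := norm_sub_norm_le ((Y n).1 τ) (y₀ τ)
      linarith [hτ n]
    · filter_upwards [hylim] with τ hτ _ using hτ
  filter_upwards [hylim, hsummable] with s h1 h2
  rw [(h.closed s _).mem_iff_infDist_zero (h.nonempty s _)]
  have h3 : Tendsto (fun n => (trajectory c ξ (Y n).1 s, (Y n).1 s)) atTop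
      (𝓝 (trajectory c ξ y s, y s)) := (htraj s).prodMk_nhds h1
  have h4 := ((h.continuous_infDist s).tendsto _).comp h3
  refine tendsto_nhds_unique h4 ?_
  -- The defect of the `n`-th iterate is at most `σ n s`, the general term of a convergent series.
  refine squeeze_zero (fun n => Metric.infDist_nonneg) (fun n => ?_) h2.tendsto_atTop_zero
  show defect Γ c ξ (Y n).1 s ≤ defect Γ c ξ (Y n).1 s + ε' n s
  linarith [hε'0 n s]

end Filippov

end

end InfHorizon

namespace InfHorizon

noncomputable section

/-! ### Improper integrals of real functions -/

section Improper

theorem posIntegral_congr_ae {f g : ℝ → EReal} {a b : ℝ}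
    (h : f =ᵐ[volume.restrict (Ioc a b)] g) : posIntegral f a b = posIntegral g a b :=
  lintegral_congr_ae (h.fun_comp EReal.toENNReal)

theorem negIntegral_congr_ae {f g : ℝ → EReal} {a b : ℝ}
    (h : f =ᵐ[volume.restrict (Ioc a b)] g) : negIntegral f a b = negIntegral g a b :=
  lintegral_congr_ae (h.fun_comp fun z => (-z).toENNReal)

theorem coe_ennreal_eq_coe_toReal {a : ℝ≥0∞} (h : a ≠ ⊤) : (a : EReal) = ((a.toReal : ℝ) : EReal) := by
  lift a to NNReal using h
  rfl

theorem lintegral_ofReal_ne_top {α : Type*} [MeasurableSpace α] {μ : Measure α} {g : α → ℝ}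
    (hg : Integrable g μ) : ∫⁻ s, ENNReal.ofReal (g s) ∂μ ≠ ⊤ :=
  (hg.lintegral_lt_top).ne

theorem extIntegral_coe {g : ℝ → ℝ} {a b : ℝ} (hab : a ≤ b) (hg : LocallyIntegrable g) :
    IntegralDefined (fun s => (g s : EReal)) a b ∧
      extIntegral (fun s => (g s : EReal)) a b = ((∫ s in a..b, g s : ℝ) : EReal) := by
  have hi : IntegrableOn g (Ioc a b) :=
    (intervalIntegrable_iff_integrableOn_Ioc_of_le hab).1
      (intervalIntegrable_of_locallyIntegrable hg a b)
  have h1 : posIntegral (fun s => (g s : EReal)) a b = ∫⁻ s in Ioc a b, ENNReal.ofReal (g s) := rfl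
  have h2 : negIntegral (fun s => (g s : EReal)) a b = ∫⁻ s in Ioc a b, ENNReal.ofReal (-g s) := rfl
  have h3 := lintegral_ofReal_ne_top hi
  have h4 : ∫⁻ s in Ioc a b, ENNReal.ofReal (-g s) ≠ ⊤ := lintegral_ofReal_ne_top hi.neg
  refine ⟨⟨hi.1.aemeasurable.coe_real_ereal, .inl (h1 ▸ h3)⟩, ?_⟩
  rw [extIntegral, h1, h2, coe_ennreal_eq_coe_toReal h3, coe_ennreal_eq_coe_toReal h4,
    ← EReal.coe_sub, intervalIntegral.integral_of_le hab,
    integral_eq_lintegral_pos_part_sub_lintegral_neg_part hi]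

theorem hasImproperIntegral_iff {f : ℝ → EReal} {g : ℝ → ℝ} {t : ℝ} {I : EReal}
    (hfg : ∀ᵐ s ∂volume.restrict (Ici t), f s = (g s : EReal)) (hg : LocallyIntegrable g) :
    HasImproperIntegral f t I ↔
      Tendsto (fun T => ((∫ s in t..T, g s : ℝ) : EReal)) atTop (𝓝 I) := by
  have hres : ∀ T, f =ᵐ[volume.restrict (Ioc t T)] fun s => (g s : EReal) := fun T =>
    ae_mono (Measure.restrict_mono (fun s hs => hs.1.le) le_rfl) hfg
  have hdef : ∀ T, t ≤ T → IntegralDefined f t T := by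
    intro T hT
    obtain ⟨⟨h1, h2⟩, -⟩ := extIntegral_coe hT hg
    refine ⟨h1.congr (hres T).symm, ?_⟩
    rwa [posIntegral_congr_ae (hres T), negIntegral_congr_ae (hres T)]
  rw [HasImproperIntegral, and_iff_right hdef]
  refine tendsto_congr' ?_
  filter_upwards [eventually_ge_atTop t] with T hT
  rw [extIntegral, posIntegral_congr_ae (hres T), negIntegral_congr_ae (hres T), ← extIntegral,
    (extIntegral_coe hT hg).2]

end Improper

/-! ### Processes and running costs -/

section Processes

variable {E : Type*} [NormedAddCommGroup E] [NormedSpace ℝ E]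

/-- `y` is the velocity of an admissible trajectory on `[t, ∞)` starting from `ξ`. -/
def IsProcess (Γ : ℝ → E → Set E) (t : ℝ) (ξ : E) (y : ℝ → E) : Prop :=
  LocallyIntegrable y ∧ ∀ᵐ s ∂volume.restrict (Ici t), y s ∈ Γ s (trajectory t ξ y s)

/-- The cost per unit of time along the trajectory with velocity `y`. -/
def runningCost (ℓ : ℝ → E → E → ℝ) (c : ℝ) (ξ : E) (y : ℝ → E) (s : ℝ) : ℝ :=
  ℓ s (trajectory c ξ y s) (y s)

/-- A real valued integrand, measurable in time, Lipschitz in the state and the velocity. -/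
structure IsLipschitzIntegrand (ℓ : ℝ → E → E → ℝ) (l₀ l₁ l₂ : ℝ → ℝ) : Prop where
  aemeasurable : ∀ x y, AEMeasurable (fun s => ℓ s x y)
  integrable₀ : Integrable l₀
  integrable₁ : Integrable l₁
  integrable₂ : Integrable l₂
  nonneg₁ : ∀ s, 0 ≤ l₁ s
  nonneg₂ : ∀ s, 0 ≤ l₂ s
  bdd₂ : ∀ T, ∃ M, ∀ s ≤ T, l₂ s ≤ M
  bound : ∀ s, |ℓ s 0 0| ≤ l₀ s
  lip : ∀ s x y x' y', ℓ s x y ≤ ℓ s x' y' + (l₁ s * ‖x - x'‖ + l₂ s * ‖y - y'‖)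

namespace IsLipschitzIntegrand

variable {ℓ : ℝ → E → E → ℝ} {l₀ l₁ l₂ : ℝ → ℝ}

omit [NormedSpace ℝ E] in
theorem abs_sub_le (h : IsLipschitzIntegrand ℓ l₀ l₁ l₂) (s : ℝ) (x y x' y' : E) :
    |ℓ s x y - ℓ s x' y'| ≤ l₁ s * ‖x - x'‖ + l₂ s * ‖y - y'‖ := by
  have h1 := h.lip s x y x' y'
  have h2 := h.lip s x' y' x y
  rw [norm_sub_rev x', norm_sub_rev y'] at h2
  rw [abs_le]
  constructor <;> linarith

omit [NormedSpace ℝ E] in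
theorem abs_le (h : IsLipschitzIntegrand ℓ l₀ l₁ l₂) (s : ℝ) (x y : E) :
    |ℓ s x y| ≤ l₀ s + (l₁ s * ‖x‖ + l₂ s * ‖y‖) := by
  have h1 := h.abs_sub_le s x y 0 0
  rw [sub_zero, sub_zero] at h1
  have h2 := abs_sub_abs_le_abs_sub (ℓ s x y) (ℓ s 0 0)
  linarith [h.bound s]

omit [NormedSpace ℝ E] in
theorem continuous (h : IsLipschitzIntegrand ℓ l₀ l₁ l₂) (s : ℝ) :
    Continuous fun z : E × E => ℓ s z.1 z.2 := by
  refine continuous_of_le_add_norm (c := l₁ s + l₂ s) fun z w =>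
    (h.lip s z.1 z.2 w.1 w.2).trans ?_
  have h1 := mul_le_mul_of_nonneg_left (norm_fst_le (z - w)) (h.nonneg₁ s)
  have h2 := mul_le_mul_of_nonneg_left (norm_snd_le (z - w)) (h.nonneg₂ s)
  simp only [Prod.fst_sub, Prod.snd_sub] at h1 h2
  linarith

omit [NormedSpace ℝ E] in
theorem aemeasurable_comp (h : IsLipschitzIntegrand ℓ l₀ l₁ l₂) {x v : ℝ → E}
    (hx : AEStronglyMeasurable x) (hv : AEStronglyMeasurable v) :
    AEMeasurable fun s => ℓ s (x s) (v s) := by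
  have hp : AEStronglyMeasurable (fun s => (x s, v s)) volume := hx.prodMk hv
  have h1 : ∀ z : E × E, AEMeasurable (fun s => ℓ s z.1 z.2) volume :=
    fun z => h.aemeasurable z.1 z.2
  have h2 : ∀ᵐ s : ℝ, Continuous fun z : E × E => ℓ s z.1 z.2 :=
    Eventually.of_forall h.continuous
  have h3 := aestronglyMeasurable_caratheodory_comp
    (F := fun s (z : E × E) => ℓ s z.1 z.2) h1 h2 hp
  exact h3

-- Local boundedness of `l₂` is what makes this work: a product of two locally integrable functions
-- need not be locally integrable.
omit [NormedSpace ℝ E] in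
theorem locallyIntegrable_mul₂ (h : IsLipschitzIntegrand ℓ l₀ l₁ l₂) {g : ℝ → ℝ}
    (hg : LocallyIntegrable g) : LocallyIntegrable fun s => l₂ s * g s := by
  refine locallyIntegrable_of_intervalIntegrable fun a b => ?_
  rw [intervalIntegrable_iff]
  obtain ⟨M, hM⟩ := h.bdd₂ (max a b)
  refine Integrable.bdd_mul (c := M) (integrableOn_uIoc_of_locallyIntegrable hg a b)
    h.integrable₂.1.restrict ?_
  refine (ae_restrict_iff' measurableSet_uIoc).2 (Eventually.of_forall fun s hs => ?_)
  rw [Real.norm_of_nonneg (h.nonneg₂ s)]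
  exact hM s hs.2

omit [NormedSpace ℝ E] in
theorem locallyIntegrable_comp (h : IsLipschitzIntegrand ℓ l₀ l₁ l₂) {x v : ℝ → E}
    (hx : Continuous x) (hv : LocallyIntegrable v) :
    LocallyIntegrable fun s => ℓ s (x s) (v s) := by
  have hb : LocallyIntegrable fun s => l₀ s + (l₁ s * ‖x s‖ + l₂ s * ‖v s‖) :=
    h.integrable₀.locallyIntegrable.add
      ((h.integrable₁.locallyIntegrable.mul_continuous hx.norm).add
        (h.locallyIntegrable_mul₂ (locallyIntegrable_norm hv)))
  refine hb.mono
    (h.aemeasurable_comp hx.aestronglyMeasurable hv.aestronglyMeasurable).aestronglyMeasurable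
    (Eventually.of_forall fun s => ?_)
  exact (h.abs_le s _ _).trans (Real.le_norm_self _)

theorem locallyIntegrable_runningCost (h : IsLipschitzIntegrand ℓ l₀ l₁ l₂) (c : ℝ) (ξ : E)
    {y : ℝ → E} (hy : LocallyIntegrable y) : LocallyIntegrable (runningCost ℓ c ξ y) :=
  h.locallyIntegrable_comp (continuous_trajectory c ξ hy) hy

end IsLipschitzIntegrand

theorem trajectory_self (c : ℝ) (ξ : E) (y : ℝ → E) : trajectory c ξ y c = ξ := by
  simp [trajectory]

/-- A trajectory may be based at any of its points. -/
theorem trajectory_rebase (c : ℝ) (ξ : E) {y : ℝ → E} (hy : LocallyIntegrable y) (c' : ℝ) :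
    trajectory c' (trajectory c ξ y c') y = trajectory c ξ y := by
  funext s
  rw [trajectory, trajectory, trajectory, add_assoc,
    intervalIntegral.integral_add_adjacent_intervals
      (intervalIntegrable_of_locallyIntegrable hy c c')
      (intervalIntegrable_of_locallyIntegrable hy c' s)]

theorem trajectory_congr {c : ℝ} {ξ : E} {y z : ℝ → E} {s : ℝ}
    (h : ∀ᵐ τ, τ ∈ uIoc c s → y τ = z τ) : trajectory c ξ y s = trajectory c ξ z s := by
  rw [trajectory, trajectory, intervalIntegral.integral_congr_ae h]

variable [CompleteSpace E]

theorem ae_hasDerivAt_trajectory (c : ℝ) (ξ : E) {y : ℝ → E} (hy : LocallyIntegrable y) :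
    ∀ᵐ s, HasDerivAt (trajectory c ξ y) (y s) s := by
  filter_upwards [_root_.LocallyIntegrable.ae_hasDerivAt_integral hy] with s hs
  exact (hs c).const_add ξ

theorem isArc_trajectory (c : ℝ) (ξ : E) {y : ℝ → E} (hy : LocallyIntegrable y) :
    IsArc (trajectory c ξ y) := by
  have hd := ae_hasDerivAt_trajectory c ξ hy
  refine ⟨ae_restrict_of_ae (hd.mono fun s hs => hs.differentiableAt),
    (hy.congr (hd.mono fun s hs => hs.deriv.symm)).locallyIntegrableOn _, fun t _ => ?_⟩
  rw [intervalIntegral.integral_congr_ae (hd.mono fun s hs _ => hs.deriv)]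
  conv_lhs => rw [← trajectory_rebase c ξ hy 0]
  rfl

theorem IsProcess.mem_admissible {Γ : ℝ → E → Set E} {t : ℝ} {ξ : E} {y : ℝ → E}
    (h : IsProcess Γ t ξ y) : trajectory t ξ y ∈ admissible Γ t ξ := by
  refine ⟨isArc_trajectory t ξ h.1, ?_, trajectory_self t ξ y⟩
  filter_upwards [h.2, ae_restrict_of_ae (ae_hasDerivAt_trajectory t ξ h.1)] with s h1 h2
  rwa [h2.deriv]

omit [CompleteSpace E] in
/-- The velocity of an admissible arc, extended by zero. -/
theorem exists_isProcess_of_mem_admissible {Γ : ℝ → E → Set E} {t : ℝ} (ht : 0 ≤ t) {ξ : E}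
    {x : ℝ → E} (h : x ∈ admissible Γ t ξ) :
    ∃ y, IsProcess Γ t ξ y ∧ (∀ s, 0 ≤ s → y s = deriv x s) ∧
      ∀ s, 0 ≤ s → x s = trajectory t ξ y s := by
  obtain ⟨⟨-, hloc, hint⟩, hinc, hxt⟩ := h
  let y : ℝ → E := (Ici (0 : ℝ)).indicator (deriv x)
  have hy : LocallyIntegrable y := locallyIntegrable_indicator_Ici hloc
  have hyx : ∀ s, 0 ≤ s → y s = deriv x s := fun s hs => indicator_of_mem (mem_Ici.2 hs) _
  have h0 : ∀ s, 0 ≤ s → x s = trajectory 0 (x 0) y s := by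
    intro s hs
    rw [hint s hs, trajectory]
    congr 1
    refine intervalIntegral.integral_congr fun τ hτ => (hyx τ ?_).symm
    rw [uIcc_of_le hs] at hτ
    exact hτ.1
  have h1 : ∀ s, 0 ≤ s → x s = trajectory t ξ y s := by
    intro s hs
    rw [← hxt, h0 t ht, trajectory_rebase 0 (x 0) hy t]
    exact h0 s hs
  refine ⟨y, ⟨hy, ?_⟩, hyx, h1⟩
  filter_upwards [hinc, ae_restrict_mem measurableSet_Ici] with s hs hts
  have hs0 : 0 ≤ s := ht.trans hts
  rwa [← h1 s hs0, hyx s hs0]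

section Value

variable {ℓ : ℝ → E → E → ℝ} {l₀ l₁ l₂ : ℝ → ℝ} {L : ℝ → E → E → EReal} {Γ : ℝ → E → Set E}

theorem ae_restrict_Ici_of_nonneg {p : ℝ → Prop} (h : ∀ᵐ s ∂volume.restrict (Ici (0 : ℝ)), p s)
    {t : ℝ} (ht : 0 ≤ t) : ∀ᵐ s ∂volume.restrict (Ici t), p s :=
  ae_mono (Measure.restrict_mono (Ici_subset_Ici.2 ht) le_rfl) h

theorem value_le (hℓ : IsLipschitzIntegrand ℓ l₀ l₁ l₂)
    (hL : ∀ᵐ s ∂volume.restrict (Ici (0 : ℝ)), ∀ x y, L s x y = (ℓ s x y : EReal)) {t : ℝ}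
    (ht : 0 ≤ t) {ξ : E} {y : ℝ → E} (hy : IsProcess Γ t ξ y) {I : EReal}
    (hI : Tendsto (fun T => ((∫ s in t..T, runningCost ℓ t ξ y s : ℝ) : EReal)) atTop (𝓝 I)) :
    value L Γ t ξ ≤ I := by
  refine sInf_le ⟨trajectory t ξ y, hy.mem_admissible, ?_⟩
  rw [hasImproperIntegral_iff (g := runningCost ℓ t ξ y) ?_
    (hℓ.locallyIntegrable_runningCost t ξ hy.1)]
  · exact hI
  · filter_upwards [ae_restrict_Ici_of_nonneg hL ht,
      ae_restrict_of_ae (ae_hasDerivAt_trajectory t ξ hy.1)] with s h1 h2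
    rw [along, h2.deriv, h1]
    rfl

omit [CompleteSpace E] in
theorem hasImproperIntegral_along_iff (hℓ : IsLipschitzIntegrand ℓ l₀ l₁ l₂)
    (hL : ∀ᵐ s ∂volume.restrict (Ici (0 : ℝ)), ∀ x y, L s x y = (ℓ s x y : EReal)) {t : ℝ}
    (ht : 0 ≤ t) {ξ : E} {x y : ℝ → E} (hy : LocallyIntegrable y)
    (hyx : ∀ s, 0 ≤ s → y s = deriv x s) (hx : ∀ s, 0 ≤ s → x s = trajectory t ξ y s) {I : EReal} :
    HasImproperIntegral (along L x) t I ↔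
      Tendsto (fun T => ((∫ s in t..T, runningCost ℓ t ξ y s : ℝ) : EReal)) atTop (𝓝 I) := by
  refine hasImproperIntegral_iff ?_ (hℓ.locallyIntegrable_runningCost t ξ hy)
  filter_upwards [ae_restrict_Ici_of_nonneg hL ht, ae_restrict_mem measurableSet_Ici] with s h1 hs
  have hs0 : 0 ≤ s := ht.trans hs
  rw [along, h1, ← hyx s hs0, hx s hs0]
  rfl

-- Each admissible arc is the trajectory of its own velocity, so a lower bound tested on processes
-- with real running costs bounds the infimum over all arcs.
omit [CompleteSpace E] in
theorem le_value (hℓ : IsLipschitzIntegrand ℓ l₀ l₁ l₂)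
    (hL : ∀ᵐ s ∂volume.restrict (Ici (0 : ℝ)), ∀ x y, L s x y = (ℓ s x y : EReal)) {t : ℝ}
    (ht : 0 ≤ t) {ξ : E} {a : EReal}
    (h : ∀ y, IsProcess Γ t ξ y → ∀ I : EReal,
      Tendsto (fun T => ((∫ s in t..T, runningCost ℓ t ξ y s : ℝ) : EReal)) atTop (𝓝 I) → a ≤ I) :
    a ≤ value L Γ t ξ := by
  refine le_sInf ?_
  rintro I ⟨x, hx, hI⟩
  obtain ⟨y, hy, hyx, hxy⟩ := exists_isProcess_of_mem_admissible ht hx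
  exact h y hy I ((hasImproperIntegral_along_iff hℓ hL ht hy.1 hyx hxy).1 hI)

end Value

end Processes

end

end InfHorizon

namespace InfHorizon

noncomputable section

/-! ### Operations on velocity multifunctions and processes -/

section Processes

variable {E : Type*} [NormedAddCommGroup E] [NormedSpace ℝ E]

open Classical in
/-- The multifunction that agrees with `Γ` at the times in `S` and imposes no constraint at other
times. -/
def restrictVelocity (S : Set ℝ) (Γ : ℝ → E → Set E) (s : ℝ) (x : E) : Set E :=
  if s ∈ S then Γ s x else univ

omit [NormedAddCommGroup E] [NormedSpace ℝ E] in
theorem restrictVelocity_of_mem {S : Set ℝ} {s : ℝ} (hs : s ∈ S) (Γ : ℝ → E → Set E) (x : E) :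
    restrictVelocity S Γ s x = Γ s x := if_pos hs

omit [NormedAddCommGroup E] [NormedSpace ℝ E] in
theorem restrictVelocity_of_notMem {S : Set ℝ} {s : ℝ} (hs : s ∉ S) (Γ : ℝ → E → Set E) (x : E) :
    restrictVelocity S Γ s x = univ := if_neg hs

omit [NormedSpace ℝ E] in
theorem isLipschitzVelocity_restrictVelocity {S : Set ℝ} (hS : MeasurableSet S)
    {Γ : ℝ → E → Set E} {γ : ℝ → ℝ} (hne : ∀ s ∈ S, ∀ x, (Γ s x).Nonempty)
    (hcl : ∀ s ∈ S, ∀ x, IsClosed (Γ s x))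
    (hm : ∀ x v, AEMeasurable (fun s => Metric.infDist v (Γ s x)) (volume.restrict S))
    (hγ0 : ∀ s ∈ S, 0 ≤ γ s) (hγ : LocallyIntegrable (S.indicator γ))
    (hlip : ∀ s ∈ S, ∀ x x' v,
      Metric.infDist v (Γ s x) ≤ Metric.infDist v (Γ s x') + γ s * ‖x - x'‖) :
    IsLipschitzVelocity (restrictVelocity S Γ) (S.indicator γ) where
  nonempty s x := by
    by_cases hs : s ∈ S
    · rw [restrictVelocity_of_mem hs]
      exact hne s hs x
    · rw [restrictVelocity_of_notMem hs]
      exact univ_nonempty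
  closed s x := by
    by_cases hs : s ∈ S
    · rw [restrictVelocity_of_mem hs]
      exact hcl s hs x
    · rw [restrictVelocity_of_notMem hs]
      exact isClosed_univ
  aemeasurable x v := by
    have h : (fun s => Metric.infDist v (restrictVelocity S Γ s x)) =
        S.indicator fun s => Metric.infDist v (Γ s x) := by
      funext s
      by_cases hs : s ∈ S
      · rw [restrictVelocity_of_mem hs, indicator_of_mem hs]
      · rw [restrictVelocity_of_notMem hs, indicator_of_notMem hs,
          Metric.infDist_zero_of_mem (mem_univ v)]
    rw [h, aemeasurable_indicator_iff hS]
    exact hm x v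
  nonneg s := indicator_nonneg hγ0 s
  locallyIntegrable := hγ
  lip s x x' v := by
    by_cases hs : s ∈ S
    · rw [restrictVelocity_of_mem hs, restrictVelocity_of_mem hs, indicator_of_mem hs]
      exact hlip s hs x x' v
    · rw [restrictVelocity_of_notMem hs, restrictVelocity_of_notMem hs, indicator_of_notMem hs]
      simp

omit [NormedSpace ℝ E] in
theorem IsLipschitzVelocity.restrict {Γ : ℝ → E → Set E} {γ : ℝ → ℝ}
    (h : IsLipschitzVelocity Γ γ) {S : Set ℝ} (hS : MeasurableSet S) :
    IsLipschitzVelocity (restrictVelocity S Γ) (S.indicator γ) :=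
  isLipschitzVelocity_restrictVelocity hS (fun s _ => h.nonempty s) (fun s _ => h.closed s)
    (fun x v => (h.aemeasurable x v).restrict) (fun s _ => h.nonneg s)
    (h.locallyIntegrable.indicator hS) (fun s _ => h.lip s)

theorem value_restrictVelocity (L : ℝ → E → E → EReal) (Γ : ℝ → E → Set E) {t : ℝ} (ht : 0 ≤ t) :
    value L (restrictVelocity (Ici 0) Γ) t = value L Γ t := by
  have h : ∀ ξ, admissible (restrictVelocity (Ici 0) Γ) t ξ = admissible Γ t ξ := by
    intro ξ
    ext x
    refine and_congr_right fun _ => and_congr_left fun _ => eventually_congr ?_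
    filter_upwards [ae_restrict_mem measurableSet_Ici] with s hs
    rw [restrictVelocity_of_mem (mem_Ici.2 (ht.trans hs))]
  funext ξ
  rw [value, value, h]

variable {ℓ : ℝ → E → E → ℝ} {l₀ l₁ l₂ : ℝ → ℝ} {L : ℝ → E → E → EReal} {Γ : ℝ → E → Set E}
  {γ : ℝ → ℝ}

theorem IsProcess.tail {t : ℝ} {ξ : E} {y : ℝ → E} (h : IsProcess Γ t ξ y) {c : ℝ} (hc : t ≤ c) :
    IsProcess Γ c (trajectory t ξ y c) y := by
  refine ⟨h.1, ?_⟩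
  rw [trajectory_rebase t ξ h.1 c]
  exact ae_mono (Measure.restrict_mono (Ici_subset_Ici.2 hc) le_rfl) h.2

theorem runningCost_rebase {c : ℝ} {ξ : E} {y : ℝ → E} (hy : LocallyIntegrable y) (c' : ℝ) :
    runningCost ℓ c' (trajectory c ξ y c') y = runningCost ℓ c ξ y := by
  funext s
  rw [runningCost, trajectory_rebase c ξ hy c', runningCost]

open Classical in
/-- The velocity that follows `y₁` up to the time `c` and `y₂` afterwards. -/
def concat (c : ℝ) (y₁ y₂ : ℝ → E) : ℝ → E := (Iic c).piecewise y₁ y₂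

omit [NormedAddCommGroup E] [NormedSpace ℝ E] in
theorem concat_of_le {c s : ℝ} (h : s ≤ c) (y₁ y₂ : ℝ → E) : concat c y₁ y₂ s = y₁ s :=
  piecewise_eq_of_mem _ _ _ h

omit [NormedAddCommGroup E] [NormedSpace ℝ E] in
theorem concat_of_lt {c s : ℝ} (h : c < s) (y₁ y₂ : ℝ → E) : concat c y₁ y₂ s = y₂ s :=
  piecewise_eq_of_notMem _ _ _ (not_le.2 h)

omit [NormedSpace ℝ E] in
theorem locallyIntegrable_concat {y₁ y₂ : ℝ → E} (h₁ : LocallyIntegrable y₁)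
    (h₂ : LocallyIntegrable y₂) (c : ℝ) : LocallyIntegrable (concat c y₁ y₂) := by
  have h : concat c y₁ y₂ = (Iic c).indicator y₁ + (Ioi c).indicator y₂ := by
    funext s
    rcases le_or_gt s c with hs | hs
    · rw [concat_of_le hs, Pi.add_apply, indicator_of_mem (mem_Iic.2 hs),
        indicator_of_notMem (notMem_Ioi.2 hs), add_zero]
    · rw [concat_of_lt hs, Pi.add_apply, indicator_of_notMem (notMem_Iic.2 hs),
        indicator_of_mem (mem_Ioi.2 hs), zero_add]
  rw [h]
  exact (h₁.indicator measurableSet_Iic).add (h₂.indicator measurableSet_Ioi)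

theorem trajectory_concat_of_le {t c s : ℝ} (ht : t ≤ c) (hs : s ≤ c) (ξ : E) (y₁ y₂ : ℝ → E) :
    trajectory t ξ (concat c y₁ y₂) s = trajectory t ξ y₁ s :=
  trajectory_congr (Eventually.of_forall fun _ hτ => concat_of_le (hτ.2.trans (max_le ht hs)) _ _)

theorem trajectory_concat_of_ge {t c s : ℝ} (ht : t ≤ c) (hs : c ≤ s) (ξ : E) {y₁ y₂ : ℝ → E}
    (h₁ : LocallyIntegrable y₁) (h₂ : LocallyIntegrable y₂) :
    trajectory t ξ (concat c y₁ y₂) s = trajectory c (trajectory t ξ y₁ c) y₂ s := by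
  rw [← trajectory_rebase t ξ (locallyIntegrable_concat h₁ h₂ c) c,
    trajectory_concat_of_le ht le_rfl]
  refine trajectory_congr (Eventually.of_forall fun τ hτ => concat_of_lt ?_ _ _)
  rw [uIoc_of_le hs] at hτ
  exact hτ.1

theorem IsProcess.concat {t c : ℝ} (htc : t ≤ c) {ξ : E} {y₁ y₂ : ℝ → E}
    (h₁ : LocallyIntegrable y₁)
    (hΓ : ∀ᵐ s, s ∈ Icc t c → y₁ s ∈ Γ s (trajectory t ξ y₁ s))
    (h₂ : IsProcess Γ c (trajectory t ξ y₁ c) y₂) : IsProcess Γ t ξ (concat c y₁ y₂) := by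
  refine ⟨locallyIntegrable_concat h₁ h₂.1 c, ?_⟩
  rw [ae_restrict_iff' measurableSet_Ici]
  filter_upwards [hΓ, (ae_restrict_iff' measurableSet_Ici).1 h₂.2] with s hs1 hs2 hts
  rcases le_or_gt s c with hs | hs
  · rw [concat_of_le hs, trajectory_concat_of_le htc hs]
    exact hs1 ⟨hts, hs⟩
  · rw [concat_of_lt hs, trajectory_concat_of_ge htc hs.le ξ h₁ h₂.1]
    exact hs2 hs.le

theorem integral_runningCost_concat (hℓ : IsLipschitzIntegrand ℓ l₀ l₁ l₂) {t c T : ℝ}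
    (htc : t ≤ c) (hcT : c ≤ T) {ξ : E} {y₁ y₂ : ℝ → E} (h₁ : LocallyIntegrable y₁)
    (h₂ : LocallyIntegrable y₂) :
    ∫ s in t..T, runningCost ℓ t ξ (concat c y₁ y₂) s =
      (∫ s in t..c, runningCost ℓ t ξ y₁ s) +
        ∫ s in c..T, runningCost ℓ c (trajectory t ξ y₁ c) y₂ s := by
  have hi := hℓ.locallyIntegrable_runningCost t ξ (locallyIntegrable_concat h₁ h₂ c)
  rw [← intervalIntegral.integral_add_adjacent_intervals
    (intervalIntegrable_of_locallyIntegrable hi t c)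
    (intervalIntegrable_of_locallyIntegrable hi c T)]
  congr 1
  · refine intervalIntegral.integral_congr fun s hs => ?_
    rw [uIcc_of_le htc] at hs
    simp only [runningCost]
    rw [concat_of_le hs.2, trajectory_concat_of_le htc hs.2]
  · refine intervalIntegral.integral_congr_ae (Eventually.of_forall fun s hs => ?_)
    rw [uIoc_of_le hcT] at hs
    simp only [runningCost]
    rw [concat_of_lt hs.1, trajectory_concat_of_ge htc hs.1.le ξ h₁ h₂]

/-- Dynamic programming inequality. -/
theorem value_le_add [CompleteSpace E] (hℓ : IsLipschitzIntegrand ℓ l₀ l₁ l₂)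
    (hL : ∀ᵐ s ∂volume.restrict (Ici (0 : ℝ)), ∀ x y, L s x y = (ℓ s x y : EReal)) {t c : ℝ}
    (ht : 0 ≤ t) (htc : t ≤ c) {ξ : E} {y₁ y₂ : ℝ → E} (h₁ : LocallyIntegrable y₁)
    (hΓ : ∀ᵐ s, s ∈ Icc t c → y₁ s ∈ Γ s (trajectory t ξ y₁ s))
    (h₂ : IsProcess Γ c (trajectory t ξ y₁ c) y₂) {I : EReal}
    (hI : Tendsto (fun T => ((∫ s in c..T, runningCost ℓ c (trajectory t ξ y₁ c) y₂ s : ℝ) : EReal))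
      atTop (𝓝 I)) :
    value L Γ t ξ ≤ ((∫ s in t..c, runningCost ℓ t ξ y₁ s : ℝ) : EReal) + I := by
  refine value_le hℓ hL ht (IsProcess.concat htc h₁ hΓ h₂) ?_
  -- The limit `I` may be infinite; addition is still continuous there because the other summand is
  -- real.
  have h := (EReal.continuousAt_add (p := (((∫ s in t..c, runningCost ℓ t ξ y₁ s : ℝ) : EReal), I))
    (.inl (EReal.coe_ne_top _)) (.inl (EReal.coe_ne_bot _))).tendsto.comp
    (tendsto_const_nhds.prodMk_nhds hI)
  refine h.congr' ?_
  filter_upwards [eventually_ge_atTop c] with T hT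
  rw [integral_runningCost_concat hℓ htc hT h₁ h₂.1, EReal.coe_add]
  rfl

/-- The cost-to-go of the optimal process `y₀` at time `t`, for the total cost `C`. -/
def costToGo (ℓ : ℝ → E → E → ℝ) (ξ₀ : E) (y₀ : ℝ → E) (C t : ℝ) : ℝ :=
  C - ∫ s in (0 : ℝ)..t, runningCost ℓ 0 ξ₀ y₀ s

theorem tendsto_costToGo (hℓ : IsLipschitzIntegrand ℓ l₀ l₁ l₂) {ξ₀ : E} {y₀ : ℝ → E}
    (hy₀ : LocallyIntegrable y₀) {C : ℝ}
    (hC : Tendsto (fun T => ∫ s in (0 : ℝ)..T, runningCost ℓ 0 ξ₀ y₀ s) atTop (𝓝 C)) (t : ℝ) :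
    Tendsto (fun T => ∫ s in t..T, runningCost ℓ 0 ξ₀ y₀ s) atTop
      (𝓝 (costToGo ℓ ξ₀ y₀ C t)) := by
  have hi := hℓ.locallyIntegrable_runningCost 0 ξ₀ hy₀
  refine (hC.sub_const _).congr fun T => ?_
  rw [intervalIntegral.integral_interval_sub_left (intervalIntegrable_of_locallyIntegrable hi 0 T)
    (intervalIntegrable_of_locallyIntegrable hi 0 t)]

end Processes

end

end InfHorizon

namespace InfHorizon

noncomputable section

/-! ### Growth of the value function around the optimal trajectory -/

section Growth

variable {E : Type*} [NormedAddCommGroup E] [NormedSpace ℝ E]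
  {ℓ : ℝ → E → E → ℝ} {l₀ l₁ l₂ : ℝ → ℝ} {L : ℝ → E → E → EReal} {Γ : ℝ → E → Set E}
  {γ : ℝ → ℝ}

/-- A positive weight with integral at most one on `[0, ∞)` that stays small when multiplied by
`l₂`. -/
def weight (l₂ : ℝ → ℝ) (s : ℝ) : ℝ := Real.exp (-s) / (1 + l₂ s)

theorem weight_pos (h : ∀ s, 0 ≤ l₂ s) (s : ℝ) : 0 < weight l₂ s :=
  div_pos (Real.exp_pos _) (by linarith [h s])

theorem weight_le (h : ∀ s, 0 ≤ l₂ s) (s : ℝ) : weight l₂ s ≤ Real.exp (-s) :=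
  div_le_self (Real.exp_pos _).le (by linarith [h s])

theorem mul_weight_le (h : ∀ s, 0 ≤ l₂ s) (s : ℝ) : l₂ s * weight l₂ s ≤ Real.exp (-s) := by
  have h1 : 0 < 1 + l₂ s := by linarith [h s]
  rw [weight, mul_div_assoc', div_le_iff₀ h1]
  nlinarith [Real.exp_pos (-s)]

theorem locallyIntegrable_weight (h : ∀ s, 0 ≤ l₂ s) (hm : AEStronglyMeasurable l₂) :
    LocallyIntegrable (weight l₂) := by
  have hc : Continuous fun s : ℝ => Real.exp (-s) := by fun_prop
  refine hc.locallyIntegrable.mono (hc.measurable.aemeasurable.div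
    (hm.aemeasurable.const_add 1)).aestronglyMeasurable (Eventually.of_forall fun s => ?_)
  rw [Real.norm_of_nonneg (weight_pos h s).le, Real.norm_of_nonneg (Real.exp_pos _).le]
  exact weight_le h s

theorem integral_weight_le_one (h : ∀ s, 0 ≤ l₂ s) (hm : AEStronglyMeasurable l₂) {t s : ℝ}
    (ht : 0 ≤ t) (hts : t ≤ s) : ∫ τ in t..s, weight l₂ τ ≤ 1 := by
  have h1 : IntegrableOn (fun τ : ℝ => Real.exp (-τ)) (Ioi 0) := integrableOn_exp_neg_Ioi 0
  have h2 : ∫ τ in t..s, weight l₂ τ ≤ ∫ τ in t..s, Real.exp (-τ) := by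
    refine intervalIntegral.integral_mono hts (intervalIntegrable_of_locallyIntegrable
      (locallyIntegrable_weight h hm) t s) ?_ fun τ => weight_le h τ
    exact Continuous.intervalIntegrable (by fun_prop) t s
  refine h2.trans ?_
  rw [intervalIntegral.integral_of_le hts, ← integral_exp_neg_Ioi_zero]
  exact setIntegral_mono_set h1 (Eventually.of_forall fun τ => (Real.exp_pos _).le)
    (LE.le.eventuallyLE fun τ hτ => ht.trans_lt hτ.1)

/-- The density of the Lipschitz modulus of the value function. -/
def growthDensity (γ l₁ l₂ : ℝ → ℝ) (s : ℝ) : ℝ :=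
  -- Both extra constants come from the tolerance `weight l₂` in Filippov's theorem: it raises the
  -- Gronwall exponent by at most `2` and contributes at most `2 * exp (-s)` to the cost.
  Real.exp 2 * (Real.exp (∫ τ in (0 : ℝ)..s, γ τ) * (l₁ s + l₂ s * γ s)) + 2 * Real.exp (-s)

theorem integrableOn_growthDensity
    (h : IntegrableOn (fun s => Real.exp (∫ τ in (0 : ℝ)..s, γ τ) * (l₁ s + l₂ s * γ s)) (Ioi 0)) :
    IntegrableOn (growthDensity γ l₁ l₂) (Ioi 0) :=
  (h.const_mul _).add ((integrableOn_exp_neg_Ioi 0).const_mul 2)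

theorem tendsto_integral_Ioi_atTop {f : ℝ → ℝ} (hf : IntegrableOn f (Ioi 0)) :
    Tendsto (fun t => ∫ s in Ioi t, f s) atTop (𝓝 0) := by
  have h1 := intervalIntegral_tendsto_integral_Ioi 0 hf tendsto_id
  have h2 := h1.const_sub (∫ s in Ioi 0, f s)
  rw [sub_self] at h2
  refine h2.congr' ?_
  filter_upwards [eventually_ge_atTop 0] with t ht
  have h3 := setIntegral_union (Ioc_disjoint_Ioi_same (a := (0 : ℝ)) (b := t)) measurableSet_Ioi
    (hf.mono_set Ioc_subset_Ioi_self) (hf.mono_set (Ioi_subset_Ioi ht))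
  rw [Ioc_union_Ioi_eq_Ioi ht] at h3
  rw [id, intervalIntegral.integral_of_le ht, h3]
  ring

/-- A process starting from a displaced point that stays close to a given one. -/
theorem exists_isProcess_displaced [CompleteSpace E] [TopologicalSpace.SeparableSpace E]
    (hℓ : IsLipschitzIntegrand ℓ l₀ l₁ l₂) (hΓ : IsLipschitzVelocity Γ γ)
    {t : ℝ} (ht : 0 ≤ t) {x : E} {y₀ : ℝ → E} (hp : IsProcess Γ t x y₀) {w : E} (hw : w ≠ 0) :
    ∃ y, IsProcess Γ t (x + w) y ∧ ∀ᵐ s, s ∈ Ioi t →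
      |runningCost ℓ t (x + w) y s - runningCost ℓ t x y₀ s| ≤ ‖w‖ * growthDensity γ l₁ l₂ s := by
  have hw0 : 0 < ‖w‖ := norm_pos_iff.2 hw
  have hl₂m := hℓ.integrable₂.1
  let a := weight l₂
  have ha : LocallyIntegrable a := locallyIntegrable_weight hℓ.nonneg₂ hl₂m
  have ha0 : ∀ s, 0 < a s := weight_pos hℓ.nonneg₂
  let γ' : ℝ → ℝ := (Ici t).indicator γ
  have hΓ' : IsLipschitzVelocity (restrictVelocity (Ici t) Γ) γ' := hΓ.restrict measurableSet_Ici
  have ha2 : LocallyIntegrable fun s => 2 * a s := ha.smul (2 : ℝ)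
  -- Putting the tolerance into the exponent lets one exponential `Ψ` absorb both the Lipschitz
  -- growth and the source term `2 * a`.
  let β : ℝ → ℝ := fun s => γ' s + 2 * a s
  have hβ : LocallyIntegrable β := hΓ'.locallyIntegrable.add ha2
  have hβ0 : ∀ s, 0 ≤ β s := fun s => by
    have h1 := hΓ'.nonneg s
    have h2 := ha0 s
    show 0 ≤ γ' s + 2 * a s
    linarith
  let Ψ : ℝ → ℝ := fun s => Real.exp (∫ τ in t..s, β τ)
  have hΨc : Continuous Ψ :=
    Real.continuous_exp.comp (continuous_primitive_of_locallyIntegrable hβ t)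
  have hΨ1 : ∀ s, t ≤ s → 1 ≤ Ψ s := fun s hs =>
    Real.one_le_exp (intervalIntegral.integral_nonneg hs fun τ _ => hβ0 τ)
  have hM1 : LocallyIntegrable fun s => γ' s * Ψ s + 2 * a s :=
    (hΓ'.locallyIntegrable.mul_continuous hΨc).add ha2
  -- The integral of `M` is at most `‖w‖ * (Ψ - 1)`. With initial defect at most `γ' * ‖w‖` and
  -- tolerance `‖w‖ * a`, the supersolution inequality then closes exactly.
  let M : ℝ → ℝ := fun s => ‖w‖ * (γ' s * Ψ s + 2 * a s)
  have hM : LocallyIntegrable M := hM1.smul ‖w‖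
  have hM0 : ∀ s, 0 ≤ M s := fun s => by
    have h1 := mul_nonneg (hΓ'.nonneg s) (Real.exp_pos (∫ τ in t..s, β τ)).le
    exact mul_nonneg hw0.le (by linarith [ha0 s, show 0 ≤ γ' s * Ψ s from h1])
  have hMint : ∀ s, t ≤ s → ∫ τ in uIoc t s, M τ ≤ ‖w‖ * (Ψ s - 1) := by
    intro s hs
    rw [uIoc_of_le hs, ← intervalIntegral.integral_of_le hs, intervalIntegral.integral_const_mul]
    refine mul_le_mul_of_nonneg_left ?_ hw0.le
    refine le_trans ?_ (integral_mul_exp_primitive_le hβ hβ0 hs)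
    refine intervalIntegral.integral_mono_on hs (intervalIntegrable_of_locallyIntegrable hM1 t s)
      (intervalIntegrable_of_locallyIntegrable (hβ.mul_continuous hΨc) t s) fun τ hτ => ?_
    show γ' τ * Ψ τ + 2 * a τ ≤ (γ' τ + 2 * a τ) * Ψ τ
    nlinarith [hΨ1 τ hτ.1, ha0 τ]
  have hsup : ∀ᵐ s, defect (restrictVelocity (Ici t) Γ) t (x + w) y₀ s + 2 * (‖w‖ * a s) +
      γ' s * ∫ τ in uIoc t s, M τ ≤ M s := by
    filter_upwards [(ae_restrict_iff' measurableSet_Ici).1 hp.2] with s hs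
    by_cases hts : t ≤ s
    -- The reference trajectory is the given one translated by `w`, so its distance to the given
    -- trajectory is constantly `‖w‖`.
    · have h1 : defect (restrictVelocity (Ici t) Γ) t (x + w) y₀ s ≤ γ' s * ‖w‖ := by
        have h2 := hΓ'.lip s (trajectory t (x + w) y₀ s) (trajectory t x y₀ s) (y₀ s)
        rw [restrictVelocity_of_mem (mem_Ici.2 hts) Γ (trajectory t x y₀ s),
          Metric.infDist_zero_of_mem (hs hts), zero_add] at h2
        rwa [show trajectory t (x + w) y₀ s - trajectory t x y₀ s = w by
          simp only [trajectory]; abel] at h2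
      have h3 := mul_le_mul_of_nonneg_left (hMint s hts) (hΓ'.nonneg s)
      show _ ≤ ‖w‖ * (γ' s * Ψ s + 2 * a s)
      linarith
    · have h1 : γ' s = 0 := indicator_of_notMem (by simpa using hts) _
      have h2 : defect (restrictVelocity (Ici t) Γ) t (x + w) y₀ s = 0 := by
        rw [defect, restrictVelocity_of_notMem (by simpa using hts),
          Metric.infDist_zero_of_mem (mem_univ _)]
      show _ ≤ ‖w‖ * (γ' s * Ψ s + 2 * a s)
      rw [h1, h2]
      linarith
  obtain ⟨y, hy, hyΓ, hyM⟩ := hΓ'.exists_trajectory t (x + w) hp.1 (ha.smul ‖w‖)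
    (fun s => mul_pos hw0 (ha0 s)) hM hsup hM0
  refine ⟨y, ⟨hy, ?_⟩, ?_⟩
  · rw [ae_restrict_iff' measurableSet_Ici]
    filter_upwards [hyΓ] with s hs hts
    rwa [restrictVelocity_of_mem hts] at hs
  · filter_upwards [hyM] with s hs hts
    have hts' : t ≤ s := (mem_Ioi.1 hts).le
    have h1 : γ' s = γ s := indicator_of_mem (mem_Ici.2 hts') _
    have h2 : ‖trajectory t (x + w) y s - trajectory t x y₀ s‖ ≤ ‖w‖ * Ψ s := by
      have h3 := norm_trajectory_sub_le t (x + w) hy hp.1 hM hyM s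
      have h4 : trajectory t (x + w) y s - trajectory t x y₀ s =
          (trajectory t (x + w) y s - trajectory t (x + w) y₀ s) + w := by
        simp only [trajectory]; abel
      rw [h4]
      refine (norm_add_le _ _).trans ?_
      linarith [hMint s hts']
    have h3 : Ψ s ≤ Real.exp 2 * Real.exp (∫ τ in (0 : ℝ)..s, γ τ) := by
      rw [← Real.exp_add]
      refine Real.exp_le_exp.2 ?_
      have hγi := fun u v => intervalIntegrable_of_locallyIntegrable hΓ.locallyIntegrable u v
      have h5 : ∫ τ in t..s, β τ = (∫ τ in t..s, γ' τ) + ∫ τ in t..s, 2 * a τ :=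
        intervalIntegral.integral_add
          (intervalIntegrable_of_locallyIntegrable hΓ'.locallyIntegrable t s)
          (intervalIntegrable_of_locallyIntegrable ha2 t s)
      have h6 : ∫ τ in t..s, γ' τ = ∫ τ in t..s, γ τ :=
        intervalIntegral.integral_congr fun τ hτ => by
          rw [uIcc_of_le hts'] at hτ
          exact indicator_of_mem (mem_Ici.2 hτ.1) _
      have h7 := integral_weight_le_one hℓ.nonneg₂ hl₂m ht hts'
      have h8 := intervalIntegral.integral_add_adjacent_intervals (hγi 0 t) (hγi t s)
      have h9 : 0 ≤ ∫ τ in (0 : ℝ)..t, γ τ :=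
        intervalIntegral.integral_nonneg ht fun τ _ => hΓ.nonneg τ
      have h10 : ∫ τ in t..s, 2 * a τ = 2 * ∫ τ in t..s, weight l₂ τ :=
        intervalIntegral.integral_const_mul _ _
      rw [h5, h6, h10]
      linarith
    have h4 := hℓ.abs_sub_le s (trajectory t (x + w) y s) (y s) (trajectory t x y₀ s) (y₀ s)
    have h5 := mul_weight_le hℓ.nonneg₂ s
    have hl1 := hℓ.nonneg₁ s
    have hl2 := hℓ.nonneg₂ s
    have hs' : ‖y s - y₀ s‖ ≤ ‖w‖ * (γ s * Ψ s + 2 * a s) := by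
      rw [← h1]
      exact hs
    calc |runningCost ℓ t (x + w) y s - runningCost ℓ t x y₀ s|
        ≤ l₁ s * ‖trajectory t (x + w) y s - trajectory t x y₀ s‖ + l₂ s * ‖y s - y₀ s‖ := h4
      _ ≤ l₁ s * (‖w‖ * Ψ s) + l₂ s * (‖w‖ * (γ s * Ψ s + 2 * a s)) := by gcongr
      _ = ‖w‖ * (Ψ s * (l₁ s + l₂ s * γ s) + 2 * (l₂ s * a s)) := by ring
      _ ≤ ‖w‖ * ((Real.exp 2 * Real.exp (∫ τ in (0 : ℝ)..s, γ τ)) * (l₁ s + l₂ s * γ s) +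
          2 * Real.exp (-s)) := by
        have h6 : 0 ≤ l₁ s + l₂ s * γ s := add_nonneg hl1 (mul_nonneg hl2 (hΓ.nonneg s))
        gcongr
      _ = ‖w‖ * growthDensity γ l₁ l₂ s := by rw [growthDensity]; ring

/-- The value function grows at most linearly around a process that realizes it, with a rate that
vanishes at infinity. -/
theorem value_le_add_norm_mul [CompleteSpace E] [TopologicalSpace.SeparableSpace E]
    (hℓ : IsLipschitzIntegrand ℓ l₀ l₁ l₂)
    (hL : ∀ᵐ s ∂volume.restrict (Ici (0 : ℝ)), ∀ x y, L s x y = (ℓ s x y : EReal))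
    (hΓ : IsLipschitzVelocity Γ γ)
    (hint : IntegrableOn (fun s => Real.exp (∫ τ in (0 : ℝ)..s, γ τ) * (l₁ s + l₂ s * γ s)) (Ioi 0))
    {t : ℝ} (ht : 0 ≤ t) {x : E} {y₀ : ℝ → E} (hp : IsProcess Γ t x y₀) {c : ℝ}
    (hc : Tendsto (fun T => ∫ s in t..T, runningCost ℓ t x y₀ s) atTop (𝓝 c)) (w : E) :
    value L Γ t (x + w) ≤
      ((c + ‖w‖ * ∫ s in Ioi t, growthDensity γ l₁ l₂ s : ℝ) : EReal) := by
  -- Zero displacement is separate because the tolerance in the construction is proportional to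
  -- `‖w‖` and must be positive.
  rcases eq_or_ne w 0 with rfl | hw
  · rw [add_zero, norm_zero, zero_mul, add_zero]
    exact value_le hℓ hL ht hp ((continuous_coe_real_ereal.tendsto c).comp hc)
  obtain ⟨y, hy, hyd⟩ := exists_isProcess_displaced hℓ hΓ ht hp hw
  have hi := hℓ.locallyIntegrable_runningCost t (x + w) hy.1
  have hi₀ := hℓ.locallyIntegrable_runningCost t x hp.1
  have hφ : IntegrableOn (fun s => ‖w‖ * growthDensity γ l₁ l₂ s) (Ioi t) :=
    ((integrableOn_growthDensity hint).mono_set (Ioi_subset_Ioi ht)).const_mul _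
  let d : ℝ → ℝ := fun s => runningCost ℓ t (x + w) y s - runningCost ℓ t x y₀ s
  have hyd' := (ae_restrict_iff' measurableSet_Ioi).2 hyd
  have hd : IntegrableOn d (Ioi t) :=
    Integrable.mono' hφ (hi.sub hi₀).aestronglyMeasurable.restrict hyd'
  have hlim : Tendsto (fun T => ∫ s in t..T, runningCost ℓ t (x + w) y s) atTop
      (𝓝 (c + ∫ s in Ioi t, d s)) := by
    refine (hc.add (intervalIntegral_tendsto_integral_Ioi t hd tendsto_id)).congr fun T => ?_
    have h1 : ∫ s in t..T, d s = _ :=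
      intervalIntegral.integral_sub (intervalIntegrable_of_locallyIntegrable hi t T)
        (intervalIntegrable_of_locallyIntegrable hi₀ t T)
    rw [id, h1, add_sub_cancel]
  refine (value_le hℓ hL ht hy ((continuous_coe_real_ereal.tendsto _).comp hlim)).trans ?_
  rw [EReal.coe_le_coe_iff, ← integral_const_mul]
  exact add_le_add le_rfl
    (setIntegral_mono_ae_restrict hd hφ (hyd'.mono fun s hs => (le_abs_self _).trans hs))

end Growth

end

end InfHorizon

namespace InfHorizon

noncomputable section

/-! ### Backward variations of the optimal process -/

section BackwardVariation

variable {E : Type*} [NormedAddCommGroup E] [NormedSpace ℝ E]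
  {ℓ : ℝ → E → E → ℝ} {l₀ l₁ l₂ : ℝ → ℝ} {L : ℝ → E → E → EReal} {Γ : ℝ → E → Set E}
  {γ : ℝ → ℝ}

/-- A trajectory that arrives at `ξ` at time `t + h` with velocity close to `y` on `[t, t + h]`. -/
theorem exists_backward_variation [CompleteSpace E] [TopologicalSpace.SeparableSpace E]
    (hΓ : IsLipschitzVelocity Γ γ) {t h δ K : ℝ} (hh : 0 < h) (hδ : 0 < δ) {x ξ y : E}
    (hy : ∀ s ∈ Ioc t (t + h), Metric.infDist y (Γ s x) ≤ δ) (hξ : ‖ξ - x‖ + h * ‖y‖ ≤ K * h)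
    (hg1 : (∫ s in t..t + h, γ s) * K ≤ δ) (hg2 : ∫ s in t..t + h, γ s ≤ 1 / 2) :
    ∃ z : ℝ → E, LocallyIntegrable z ∧
      (∀ᵐ s, s ∈ Ioc t (t + h) → z s ∈ Γ s (trajectory (t + h) ξ z s)) ∧
      ∫ s in t..t + h, ‖z s - y‖ ≤ 8 * δ * h ∧
      ∀ s ∈ Icc t (t + h), ‖trajectory (t + h) ξ z s - x‖ ≤ (K + 8 * δ) * h := by
  have hth : t ≤ t + h := by linarith
  have hKh : 0 ≤ K * h := (by positivity : 0 ≤ ‖ξ - x‖ + h * ‖y‖).trans hξ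
  let γ' : ℝ → ℝ := (Ioc t (t + h)).indicator γ
  have hΓ' : IsLipschitzVelocity (restrictVelocity (Ioc t (t + h)) Γ) γ' :=
    hΓ.restrict measurableSet_Ioc
  -- An a priori bound for the distance to `x`: `K * h` along the constant velocity `y`, plus `8 * δ
  -- * h` for its correction.
  let D : ℝ := K * h + 8 * δ * h
  have hD : 0 ≤ D := by positivity
  let M : ℝ → ℝ := fun s => 3 * δ + γ' s * D
  have hM : LocallyIntegrable M := by
    have h1 : LocallyIntegrable fun s => γ' s * D :=
      hΓ'.locallyIntegrable.mul_continuous continuous_const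
    exact (locallyIntegrable_const (3 * δ)).add h1
  have hM0 : ∀ s, 0 ≤ M s := fun s =>
    add_nonneg (by linarith) (mul_nonneg (hΓ'.nonneg s) hD)
  -- The constant `8` reproduces itself: the integral is at most `3 * δ * h` from the constant term,
  -- `δ * h` from `hg1`, and half of `8 * δ * h` from `hg2`.
  have hMint : ∫ s in t..t + h, M s ≤ 8 * δ * h := by
    have h1 : ∫ s in t..t + h, γ' s = ∫ s in t..t + h, γ s := by
      refine intervalIntegral.integral_congr_ae (Eventually.of_forall fun s hs => ?_)
      rw [uIoc_of_le hth] at hs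
      exact indicator_of_mem hs _
    have h2 : ∫ s in t..t + h, M s = h * (3 * δ) + (∫ s in t..t + h, γ s) * D := by
      rw [← h1, ← intervalIntegral.integral_mul_const, intervalIntegral.integral_add
        (by simp) ((intervalIntegrable_of_locallyIntegrable hΓ'.locallyIntegrable _ _).mul_const D)]
      simp
      ring
    rw [h2]
    have h3 := mul_le_mul_of_nonneg_right hg1 hh.le
    have h4 := mul_le_mul_of_nonneg_right hg2 (by positivity : 0 ≤ 8 * δ * h)
    show h * (3 * δ) + (∫ s in t..t + h, γ s) * (K * h + 8 * δ * h) ≤ _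
    linarith
  have hMint' : ∀ s ∈ Icc t (t + h), ∫ τ in uIoc (t + h) s, M τ ≤ 8 * δ * h := by
    intro s hs
    refine le_trans ?_ hMint
    rw [uIoc_comm, uIoc_of_le hs.2, intervalIntegral.integral_of_le hth]
    refine setIntegral_mono_set ?_ (Eventually.of_forall hM0)
      (LE.le.eventuallyLE (Ioc_subset_Ioc_left hs.1))
    rw [← uIoc_of_le hth]
    exact integrableOn_uIoc_of_locallyIntegrable hM _ _
  have hconst : ∀ s ∈ Icc t (t + h), ‖trajectory (t + h) ξ (fun _ => y) s - x‖ ≤ K * h := by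
    intro s hs
    have h1 : trajectory (t + h) ξ (fun _ => y) s - x = (ξ - x) + (s - (t + h)) • y := by
      rw [trajectory, intervalIntegral.integral_const]
      abel
    rw [h1]
    refine (norm_add_le _ _).trans (le_trans ?_ hξ)
    rw [norm_smul, Real.norm_of_nonpos (by linarith [hs.2])]
    gcongr
    linarith [hs.1]
  have hsup : ∀ᵐ s, defect (restrictVelocity (Ioc t (t + h)) Γ) (t + h) ξ (fun _ => y) s + 2 * δ +
      γ' s * ∫ τ in uIoc (t + h) s, M τ ≤ M s := by
    refine Eventually.of_forall fun s => ?_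
    show _ ≤ 3 * δ + γ' s * (K * h + 8 * δ * h)
    by_cases hs : s ∈ Ioc t (t + h)
    · have hs' : s ∈ Icc t (t + h) := ⟨hs.1.le, hs.2⟩
      have h1 := hΓ'.lip s (trajectory (t + h) ξ (fun _ => y) s) x y
      rw [restrictVelocity_of_mem hs Γ x] at h1
      have h2 := mul_le_mul_of_nonneg_left (hconst s hs') (hΓ'.nonneg s)
      have h3 := mul_le_mul_of_nonneg_left (hMint' s hs') (hΓ'.nonneg s)
      rw [defect]
      linarith [hy s hs]
    · have h1 : γ' s = 0 := indicator_of_notMem hs _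
      rw [defect, restrictVelocity_of_notMem hs, Metric.infDist_zero_of_mem (mem_univ _), h1]
      linarith
  have hy' : LocallyIntegrable fun _ : ℝ => y := locallyIntegrable_const y
  obtain ⟨z, hz, hzΓ, hzM⟩ := hΓ'.exists_trajectory (t + h) ξ hy'
    (locallyIntegrable_const δ) (fun _ => hδ) hM hsup hM0
  refine ⟨z, hz, ?_, ?_, fun s hs => ?_⟩
  · filter_upwards [hzΓ] with s hs hst
    rwa [restrictVelocity_of_mem hst] at hs
  · refine le_trans ?_ hMint
    exact intervalIntegral.integral_mono_ae hth
      (intervalIntegrable_of_locallyIntegrable (hz.sub hy') _ _).norm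
      (intervalIntegrable_of_locallyIntegrable hM _ _) hzM
  · have h1 := norm_trajectory_sub_le (t + h) ξ hz hy' hM hzM s
    have h2 := norm_sub_le_norm_sub_add_norm_sub (trajectory (t + h) ξ z s)
      (trajectory (t + h) ξ (fun _ => y) s) x
    linarith [hMint' s hs, hconst s hs]

/-- The cost of a backward variation, compared with the frozen integrand. -/
theorem integral_runningCost_le_of_close (hℓ : IsLipschitzIntegrand ℓ l₀ l₁ l₂) {t h R η M₂ : ℝ}
    (hh : 0 < h) (c : ℝ) {x ξ y : E} {z : ℝ → E} (hz : LocallyIntegrable z)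
    (hM₂ : ∀ s ≤ t + h, l₂ s ≤ M₂) (hη : ∫ s in t..t + h, ‖z s - y‖ ≤ η)
    (hR : ∀ s ∈ Icc t (t + h), ‖trajectory c ξ z s - x‖ ≤ R) :
    ∫ s in t..t + h, runningCost ℓ c ξ z s ≤
      (∫ s in t..t + h, ℓ s x y) + (∫ s in t..t + h, l₁ s) * R + M₂ * η := by
  have hth : t ≤ t + h := by linarith
  have hM₂0 : 0 ≤ M₂ := (hℓ.nonneg₂ t).trans (hM₂ t hth)
  have hi1 := intervalIntegrable_of_locallyIntegrable
    (hℓ.locallyIntegrable_runningCost c ξ hz) t (t + h)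
  have hi2 := intervalIntegrable_of_locallyIntegrable (hℓ.locallyIntegrable_comp
    (continuous_const (y := x)) (locallyIntegrable_const y)) t (t + h)
  have hi3 := intervalIntegrable_of_locallyIntegrable hℓ.integrable₁.locallyIntegrable t (t + h)
  have hi4 := (intervalIntegrable_of_locallyIntegrable
    (hz.sub (locallyIntegrable_const y)) t (t + h)).norm
  have hi5 := (hi2.add (hi3.mul_const R)).add (hi4.const_mul M₂)
  have key := intervalIntegral.integral_mono_on hth hi1 hi5 fun s hs => by
    have h1 := hℓ.lip s (trajectory c ξ z s) (z s) x y
    have h2 := mul_le_mul_of_nonneg_left (hR s hs) (hℓ.nonneg₁ s)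
    have h3 := mul_le_mul_of_nonneg_right (hM₂ s hs.2) (norm_nonneg (z s - y))
    show ℓ s (trajectory c ξ z s) (z s) ≤ ℓ s x y + l₁ s * R + M₂ * ‖z s - y‖
    linarith
  refine key.trans ?_
  have h1 := intervalIntegral.integral_add (hi2.add (hi3.mul_const R)) (hi4.const_mul M₂)
  have h2 := intervalIntegral.integral_add hi2 (hi3.mul_const R)
  have h3 := mul_le_mul_of_nonneg_left hη hM₂0
  rw [intervalIntegral.integral_const_mul] at h1
  rw [intervalIntegral.integral_mul_const] at h2
  simp only [Pi.sub_apply] at h1 h2 ⊢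
  linarith

theorem tendsto_integral_nhdsGT_zero {f : ℝ → ℝ} (hf : LocallyIntegrable f) (t : ℝ) :
    Tendsto (fun h => ∫ s in t..t + h, f s) (𝓝[>] 0) (𝓝 0) := by
  have hc : Continuous fun h => ∫ s in t..t + h, f s :=
    (continuous_primitive_of_locallyIntegrable hf t).comp (continuous_const.add continuous_id)
  have := (hc.tendsto 0).mono_left (nhdsWithin_le_nhds (s := Ioi 0))
  simpa using this

theorem eventually_abs_integral_sub_mul_le {f : ℝ → ℝ} (hf : LocallyIntegrable f) {t a : ℝ}
    (hd : HasDerivAt (fun T => ∫ s in (0 : ℝ)..T, f s) a t) {δ : ℝ} (hδ : 0 < δ) :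
    ∀ᶠ h in 𝓝[>] (0 : ℝ), |(∫ s in t..t + h, f s) - h * a| ≤ δ * h := by
  have h1 := (Metric.tendsto_nhds.1 hd.tendsto_slope_zero_right) δ hδ
  filter_upwards [h1, self_mem_nhdsWithin] with h hh hpos
  replace hpos : 0 < h := hpos
  rw [intervalIntegral.integral_interval_sub_left (intervalIntegrable_of_locallyIntegrable hf _ _)
    (intervalIntegrable_of_locallyIntegrable hf _ _), Real.dist_eq, smul_eq_mul] at hh
  have h2 : (∫ s in t..t + h, f s) - h * a = h * (h⁻¹ * (∫ s in t..t + h, f s) - a) := by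
    field_simp
  rw [h2, abs_mul, abs_of_pos hpos, mul_comm]
  gcongr

/-- The maximum principle at a time where the optimal process and the integrand are
differentiable. -/
theorem apply_sub_le_of_mem_gateauxSubdiff_value [CompleteSpace E]
    [TopologicalSpace.SeparableSpace E] (hℓ : IsLipschitzIntegrand ℓ l₀ l₁ l₂)
    (hL : ∀ᵐ s ∂volume.restrict (Ici (0 : ℝ)), ∀ x y, L s x y = (ℓ s x y : EReal))
    (hΓ : IsLipschitzVelocity Γ γ) {ξ₀ : E} {y₀ : ℝ → E} (hp : IsProcess Γ 0 ξ₀ y₀) {C : ℝ}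
    (hC : Tendsto (fun T => ∫ s in (0 : ℝ)..T, runningCost ℓ 0 ξ₀ y₀ s) atTop (𝓝 C)) {t : ℝ}
    (ht : 0 ≤ t) (hV : value L Γ t (trajectory 0 ξ₀ y₀ t) = costToGo ℓ ξ₀ y₀ C t)
    {p : StrongDual ℝ E} (hpV : -p ∈ gateauxSubdiff (value L Γ t) (trajectory 0 ξ₀ y₀ t))
    (hX : HasDerivAt (trajectory 0 ξ₀ y₀) (y₀ t) t)
    (hrc : HasDerivAt (fun T => ∫ s in (0 : ℝ)..T, runningCost ℓ 0 ξ₀ y₀ s)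
      (runningCost ℓ 0 ξ₀ y₀ t) t) {y : E}
    (hℓy : HasDerivAt (fun T => ∫ s in (0 : ℝ)..T, ℓ s (trajectory 0 ξ₀ y₀ t) y)
      (ℓ t (trajectory 0 ξ₀ y₀ t) y) t)
    (hlsc : ∀ δ : ℝ, 0 < δ → ∀ᶠ s in 𝓝[>] t,
      Metric.infDist y (Γ s (trajectory 0 ξ₀ y₀ t)) ≤ δ) :
    p y - ℓ t (trajectory 0 ξ₀ y₀ t) y ≤
      p (y₀ t) - ℓ t (trajectory 0 ξ₀ y₀ t) (y₀ t) := by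
  set x := trajectory 0 ξ₀ y₀ t with hx
  refine le_of_forall_pos_le_add fun ε hε => ?_
  obtain ⟨M₂, hM₂⟩ := hℓ.bdd₂ (t + 1)
  have hM₂0 : 0 ≤ M₂ := (hℓ.nonneg₂ t).trans (hM₂ t (by linarith))
  -- The direction `y₀ t - y` is the limiting displacement at time `t` when the last stretch of
  -- length `h` is run at velocity `y` instead of along the optimal trajectory.
  have hsub := (mem_gateauxSubdiff_iff hV).1 hpV (y₀ t - y) (ε / 2) (by linarith)
  obtain ⟨⟨r, r'⟩, ⟨hr, hr'⟩, hsub⟩ :=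
    (Metric.nhds_basis_ball.prod (nhdsGT_basis (0 : ℝ))).eventually_iff.1 hsub
  -- The displacement quotient is off by at most `δ` from the slope and `8 * δ` from the velocity.
  -- The cost is off by three errors `δ * h` and by `8 * M₂ * δ * h` from the velocity.
  let δ := min (r / 10) (ε / 2 / (3 + 8 * M₂))
  have hδ : 0 < δ := by positivity
  have hδr : 9 * δ < r := by
    have : δ ≤ r / 10 := min_le_left _ _
    linarith [show (0 : ℝ) < r from hr]
  have hδε : (3 + 8 * M₂) * δ ≤ ε / 2 := by
    have : δ ≤ ε / 2 / (3 + 8 * M₂) := min_le_right _ _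
    rwa [le_div_iff₀' (by positivity)] at this
  let K := ‖y₀ t‖ + δ + ‖y‖
  have e1 : ∀ᶠ h in 𝓝[>] (0 : ℝ), h < r' ∧ h < 1 :=
    nhdsWithin_le_nhds ((eventually_lt_nhds hr').and (eventually_lt_nhds one_pos))
  have e2 := (Metric.tendsto_nhds.1 hX.tendsto_slope_zero_right) δ hδ
  have e3 := eventually_abs_integral_sub_mul_le (hℓ.locallyIntegrable_comp
    (continuous_const (y := x)) (locallyIntegrable_const y)) hℓy hδ
  have e4 := eventually_abs_integral_sub_mul_le
    (hℓ.locallyIntegrable_runningCost 0 ξ₀ hp.1) hrc hδ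
  have tγ := tendsto_integral_nhdsGT_zero hΓ.locallyIntegrable t
  have tl := tendsto_integral_nhdsGT_zero hℓ.integrable₁.locallyIntegrable t
  have e5 : ∀ᶠ h in 𝓝[>] (0 : ℝ), (∫ s in t..t + h, γ s) * K < δ :=
    (tγ.mul_const K).eventually_lt_const (by simpa using hδ)
  have e6 : ∀ᶠ h in 𝓝[>] (0 : ℝ), ∫ s in t..t + h, γ s < 1 / 2 :=
    tγ.eventually_lt_const (by norm_num)
  have e7 : ∀ᶠ h in 𝓝[>] (0 : ℝ), (∫ s in t..t + h, l₁ s) * (K + 8 * δ) < δ :=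
    (tl.mul_const (K + 8 * δ)).eventually_lt_const (by simpa using hδ)
  have e8 : ∀ᶠ h in 𝓝[>] (0 : ℝ), ∀ s ∈ Ioc t (t + h), Metric.infDist y (Γ s x) ≤ δ := by
    obtain ⟨b, hb, hb'⟩ := (nhdsGT_basis t).eventually_iff.1 (hlsc δ hδ)
    have : ∀ᶠ h in 𝓝[>] (0 : ℝ), h < b - t := nhdsWithin_le_nhds (eventually_lt_nhds (by linarith))
    filter_upwards [this] with h hh s hs
    exact hb' ⟨hs.1, by linarith [hs.2]⟩
  obtain ⟨h, ⟨⟨⟨h1, h1'⟩, h2⟩, ⟨h3, h4⟩, ⟨h5, h6⟩, h7, h8⟩, hh⟩ :=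
    (((e1.and e2).and ((e3.and e4).and ((e5.and e6).and (e7.and e8)))).and
      self_mem_nhdsWithin).exists
  replace hh : 0 < h := hh
  have hth : t ≤ t + h := by linarith
  rw [dist_eq_norm] at h2
  set ξ := trajectory 0 ξ₀ y₀ (t + h) with hξ
  have hslope : ‖ξ - x‖ ≤ (‖y₀ t‖ + δ) * h := by
    have : ‖h⁻¹ • (ξ - x)‖ ≤ ‖y₀ t‖ + δ := by
      have := norm_sub_norm_le (h⁻¹ • (ξ - x)) (y₀ t)
      linarith
    rw [norm_smul, norm_inv, Real.norm_of_nonneg hh.le, inv_mul_le_iff₀ hh] at this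
    linarith
  obtain ⟨z, hz, hzΓ, hzy, hzx⟩ := exists_backward_variation hΓ hh hδ h8
    (show ‖ξ - x‖ + h * ‖y‖ ≤ K * h by
      show ‖ξ - x‖ + h * ‖y‖ ≤ (‖y₀ t‖ + δ + ‖y‖) * h
      linarith) h5.le h6.le
  set ζ := trajectory (t + h) ξ z t with hζ
  have hreb : trajectory t ζ z = trajectory (t + h) ξ z := trajectory_rebase (t + h) ξ hz t
  have hend : trajectory t ζ z (t + h) = ξ := by rw [hreb, trajectory_self]
  have hzΓ' : ∀ᵐ s, s ∈ Icc t (t + h) → z s ∈ Γ s (trajectory t ζ z s) := by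
    rw [hreb]
    have hne : ∀ᵐ s : ℝ, s ≠ t := Measure.ae_ne volume t
    filter_upwards [hzΓ, hne] with s hs hst hs'
    exact hs ⟨lt_of_le_of_ne hs'.1 (Ne.symm hst), hs'.2⟩
  -- After reaching `ξ` at time `t + h`, the competitor continues with the optimal velocity.
  have hdp := value_le_add hℓ hL ht hth hz hzΓ' (y₂ := y₀)
    (hend ▸ hp.tail (by linarith)) (I := costToGo ℓ ξ₀ y₀ C (t + h)) (by
      rw [hend, hξ, runningCost_rebase hp.1]
      exact (continuous_coe_real_ereal.tendsto _).comp (tendsto_costToGo hℓ hp.1 hC (t + h)))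
  have hcost := integral_runningCost_le_of_close hℓ hh (t + h) (ξ := ξ) hz
    (fun s hs => hM₂ s (by linarith)) hzy hzx
  have hrc' : runningCost ℓ t ζ z = runningCost ℓ (t + h) ξ z := by
    rw [hζ, runningCost_rebase hz]
  rw [hrc'] at hdp
  -- This closeness is why the subdifferential must allow perturbed directions: `ζ` lies near the
  -- ray along `y₀ t - y`, not on it.
  have hu : ‖h⁻¹ • (ζ - x) - (y₀ t - y)‖ < r := by
    have hzi := intervalIntegrable_of_locallyIntegrable hz t (t + h)
    have hint : ∫ s in t..t + h, z s = (∫ s in t..t + h, z s - y) + h • y := by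
      rw [intervalIntegral.integral_sub hzi (by simp), intervalIntegral.integral_const]
      simp
    have hζx : ζ - x = (ξ - x) - (∫ s in t..t + h, z s - y) - h • y := by
      rw [hζ, trajectory, intervalIntegral.integral_symm, hint]
      abel
    have hsplit : h⁻¹ • (ζ - x) - (y₀ t - y) =
        (h⁻¹ • (ξ - x) - y₀ t) - h⁻¹ • ∫ s in t..t + h, z s - y := by
      rw [hζx, smul_sub, smul_sub, inv_smul_smul₀ hh.ne']
      abel
    have hn : ‖h⁻¹ • ∫ s in t..t + h, z s - y‖ ≤ 8 * δ := by
      rw [norm_smul, norm_inv, Real.norm_of_nonneg hh.le, inv_mul_le_iff₀ hh]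
      refine (intervalIntegral.norm_integral_le_integral_norm hth).trans ?_
      linarith
    rw [hsplit]
    refine (norm_sub_le _ _).trans_lt ?_
    linarith
  have hmem : (h⁻¹ • (ζ - x), h) ∈ Metric.ball (y₀ t - y) r ×ˢ Ioo 0 r' :=
    ⟨by rwa [Metric.mem_ball, dist_eq_norm], hh, h1⟩
  have hlow := hsub hmem
  simp only [smul_inv_smul₀ hh.ne', add_sub_cancel] at hlow
  have hfin := hlow.trans hdp
  rw [← EReal.coe_add, EReal.coe_le_coe_iff] at hfin
  have hctg : costToGo ℓ ξ₀ y₀ C (t + h) = costToGo ℓ ξ₀ y₀ C t -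
      ∫ s in t..t + h, runningCost ℓ 0 ξ₀ y₀ s := by
    have hi := hℓ.locallyIntegrable_runningCost 0 ξ₀ hp.1
    rw [costToGo, costToGo, ← intervalIntegral.integral_add_adjacent_intervals
      (intervalIntegrable_of_locallyIntegrable hi 0 t)
      (intervalIntegrable_of_locallyIntegrable hi t (t + h))]
    ring
  rw [hctg] at hfin
  have h3' := (abs_le.1 h3).2
  have h4' := (abs_le.1 h4).1
  have h7' := mul_le_mul_of_nonneg_right h7.le hh.le
  have hfin2 : h * ((-p) (y₀ t - y) - ε / 2) ≤
      h * (ℓ t x y - runningCost ℓ 0 ξ₀ y₀ t + (3 + 8 * M₂) * δ) := by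
    linarith
  have hfin3 := le_of_mul_le_mul_left hfin2 hh
  rw [_root_.neg_apply, map_sub] at hfin3
  have : runningCost ℓ 0 ξ₀ y₀ t = ℓ t x (y₀ t) := rfl
  linarith

end BackwardVariation

end

end InfHorizon

namespace InfHorizon

noncomputable section

/-! ### Upper directional derivatives along fixed directions -/

section UpperDerivative

/-- The upper limit of `D` at `0` from the right. -/
def upperLim (D : ℝ → ℝ) : ℝ := ⨅ n : ℕ, ⨆ θ : Ioo (0 : ℝ) (1 / (n + 1)), D θ

/-- The bound on `D` makes the real infimum and suprema meaningful. The countable infimum of suprema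
over intervals is the form whose measurability can be read off. -/
theorem upperLim_le_iff {D : ℝ → ℝ} {B : ℝ} (hD : ∀ θ, 0 < θ → |D θ| ≤ B) {c : ℝ} :
    upperLim D ≤ c ↔ ∀ ε : ℝ, 0 < ε → ∀ᶠ θ in 𝓝[>] (0 : ℝ), D θ ≤ c + ε := by
  have hpos : ∀ n : ℕ, (0 : ℝ) < 1 / (n + 1) := fun n => by positivity
  have hne : ∀ n : ℕ, Nonempty (Ioo (0 : ℝ) (1 / (n + 1))) := fun n => nonempty_Ioo_subtype (hpos n)
  have hba : ∀ n : ℕ, BddAbove (range fun θ : Ioo (0 : ℝ) (1 / (n + 1)) => D θ) := fun n => by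
    refine ⟨B, ?_⟩
    rintro _ ⟨θ, rfl⟩
    exact (le_abs_self _).trans (hD θ θ.2.1)
  have hbb : BddBelow (range fun n : ℕ => ⨆ θ : Ioo (0 : ℝ) (1 / (n + 1)), D θ) := by
    refine ⟨-B, ?_⟩
    rintro _ ⟨n, rfl⟩
    obtain ⟨θ⟩ := hne n
    exact (neg_le_of_abs_le (hD θ θ.2.1)).trans (le_ciSup (hba n) θ)
  constructor
  · intro h ε hε
    obtain ⟨n, hn⟩ := exists_lt_of_ciInf_lt (show upperLim D < c + ε by linarith)
    filter_upwards [Ioo_mem_nhdsGT (hpos n)] with θ hθ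
    exact (le_ciSup (hba n) ⟨θ, hθ⟩).trans hn.le
  · intro h
    refine le_of_forall_pos_le_add fun ε hε => ?_
    obtain ⟨b, hb, hb'⟩ := (nhdsGT_basis (0 : ℝ)).eventually_iff.1 (h ε hε)
    obtain ⟨n, hn⟩ := exists_nat_one_div_lt hb
    refine (ciInf_le hbb n).trans ?_
    have := hne n
    exact ciSup_le fun θ => hb' ⟨θ.2.1, θ.2.2.trans hn⟩

variable {E : Type*} [NormedAddCommGroup E] [NormedSpace ℝ E]

/-- The upper directional derivative of `f` at `x` along `v`. -/
def upperDeriv (f : E → ℝ) (x v : E) : ℝ := upperLim fun θ => (f (x + θ • v) - f x) / θ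

variable {f : E → ℝ} {K : ℝ}

omit [NormedSpace ℝ E] in
theorem abs_sub_le_of_le_add (hf : ∀ y z, f y ≤ f z + K * ‖y - z‖) (y z : E) :
    |f y - f z| ≤ K * ‖y - z‖ := by
  have h1 := hf y z
  have h2 := hf z y
  rw [norm_sub_rev] at h2
  rw [abs_le]
  constructor <;> linarith

theorem abs_quotient_le (hf : ∀ y z, f y ≤ f z + K * ‖y - z‖) (x v : E) {θ : ℝ} (hθ : 0 < θ) :
    |(f (x + θ • v) - f x) / θ| ≤ K * ‖v‖ := by
  rw [abs_div, abs_of_pos hθ, div_le_iff₀ hθ]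
  refine (abs_sub_le_of_le_add hf _ _).trans (le_of_eq ?_)
  rw [add_sub_cancel_left, norm_smul, Real.norm_of_nonneg hθ.le]
  ring

theorem upperDeriv_le_iff (hf : ∀ y z, f y ≤ f z + K * ‖y - z‖) {x v : E} {c : ℝ} :
    upperDeriv f x v ≤ c ↔
      ∀ ε : ℝ, 0 < ε → ∀ᶠ θ in 𝓝[>] (0 : ℝ), f (x + θ • v) ≤ f x + θ * (c + ε) := by
  rw [upperDeriv, upperLim_le_iff fun θ hθ => abs_quotient_le hf x v hθ]
  refine forall_congr' fun ε => forall_congr' fun _ => eventually_congr ?_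
  filter_upwards [self_mem_nhdsWithin] with θ hθ
  rw [div_le_iff₀ hθ, sub_le_iff_le_add', mul_comm θ]

theorem mem_gateauxSuperdiff_iff_upperDeriv_le (hf : ∀ y z, f y ≤ f z + K * ‖y - z‖) {x : E}
    {p : StrongDual ℝ E} :
    p ∈ gateauxSuperdiff (fun y => (f y : EReal)) x ↔ ∀ v, upperDeriv f x v ≤ p v := by
  rw [mem_gateauxSuperdiff_iff_of_lipschitz hf]
  exact forall_congr' fun v => (upperDeriv_le_iff hf).symm

theorem upperDeriv_le_add (hf : ∀ y z, f y ≤ f z + K * ‖y - z‖) (x v w : E) :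
    upperDeriv f x v ≤ upperDeriv f x w + K * ‖v - w‖ := by
  refine (upperDeriv_le_iff hf).2 fun ε hε => ?_
  filter_upwards [(upperDeriv_le_iff hf).1 (le_refl (upperDeriv f x w)) ε hε,
    self_mem_nhdsWithin] with θ h1 hθ
  replace hθ : 0 < θ := hθ
  have h2 := hf (x + θ • v) (x + θ • w)
  rw [add_sub_add_left_eq_sub, ← smul_sub, norm_smul, Real.norm_of_nonneg hθ.le] at h2
  linarith

theorem upperDeriv_smul_le (hf : ∀ y z, f y ≤ f z + K * ‖y - z‖) (x v : E) {r : ℝ} (hr : 0 < r) :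
    upperDeriv f x (r • v) ≤ r * upperDeriv f x v := by
  refine (upperDeriv_le_iff hf).2 fun ε hε => ?_
  have h1 := (upperDeriv_le_iff hf).1 (le_refl (upperDeriv f x v)) (ε / r) (by positivity)
  have ht := tendsto_mul_right_nhdsGT hr
  filter_upwards [ht.eventually h1] with θ hθ
  rw [smul_smul]
  refine hθ.trans (le_of_eq ?_)
  field_simp

theorem mul_upperDeriv_le (hf : ∀ y z, f y ≤ f z + K * ‖y - z‖) (x v : E) {r : ℝ} (hr : 0 < r) :
    r * upperDeriv f x v ≤ upperDeriv f x (r • v) := by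
  have h1 := upperDeriv_smul_le hf x (r • v) (inv_pos.2 hr)
  rwa [inv_smul_smul₀ hr.ne', inv_mul_eq_div, le_div_iff₀' hr] at h1

/-- The sign changes because the selection is built from minorants: a supergradient `p` becomes the
linear minorant `-p`, which keeps the infima finite. -/
theorem isHomLipschitzAbove_neg_upperDeriv (hf : ∀ y z, f y ≤ f z + K * ‖y - z‖) {x : E}
    {p : StrongDual ℝ E} (hp : p ∈ gateauxSuperdiff (fun y => (f y : EReal)) x) :
    IsHomLipschitzAbove K (-p) fun v => -upperDeriv f x v where
  lip v w := by
    have := upperDeriv_le_add hf x w v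
    rw [norm_sub_rev] at this
    linarith
  hom r hr v := by
    linarith [mul_upperDeriv_le hf x v hr]
  ge v := neg_le_neg ((mem_gateauxSuperdiff_iff_upperDeriv_le hf).1 hp v)

/-- A supergradient dominates difference quotients, which are at least `-K * ‖v‖`; using `v` and
`-v` gives both sides. -/
theorem abs_apply_le_of_mem_gateauxSuperdiff (hf : ∀ y z, f y ≤ f z + K * ‖y - z‖) {x : E}
    {p : StrongDual ℝ E} (hp : p ∈ gateauxSuperdiff (fun y => (f y : EReal)) x) (v : E) :
    |p v| ≤ K * ‖v‖ := by
  have lower : ∀ v, -(K * ‖v‖) ≤ p v := by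
    intro v
    refine le_of_forall_pos_le_add fun ε hε => ?_
    obtain ⟨θ, h1, hθ⟩ := (((mem_gateauxSuperdiff_iff_of_lipschitz hf).1 hp v ε hε).and
      self_mem_nhdsWithin).exists
    replace hθ : 0 < θ := hθ
    have h2 := (abs_le.1 (abs_quotient_le hf x v hθ)).1
    refine h2.trans ?_
    rw [div_le_iff₀ hθ]
    linarith
  have h1 := lower v
  have h2 := lower (-v)
  rw [map_neg, norm_neg] at h2
  rw [abs_le]
  constructor <;> linarith

end UpperDerivative

/-! ### Selections of superdifferentials and their integrals -/

section Selection

variable {E : Type*} [NormedAddCommGroup E] [NormedSpace ℝ E]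
  {ℓ : ℝ → E → E → ℝ} {l₀ l₁ l₂ : ℝ → ℝ} {L : ℝ → E → E → EReal} {Γ : ℝ → E → Set E}
  {γ : ℝ → ℝ}

omit [NormedSpace ℝ E] in
theorem IsLipschitzIntegrand.lip_state (hℓ : IsLipschitzIntegrand ℓ l₀ l₁ l₂) (s : ℝ) (v : E) :
    ∀ y z, ℓ s y v ≤ ℓ s z v + l₁ s * ‖y - z‖ := fun y z => by
  simpa using hℓ.lip s y v z v

/-- On each interval of positive `θ` the quotient is continuous in `θ`, so the supremum is a
countable one. -/
theorem aemeasurable_upperDeriv (hℓ : IsLipschitzIntegrand ℓ l₀ l₁ l₂) {x y : ℝ → E}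
    (hx : AEStronglyMeasurable x) (hy : AEStronglyMeasurable y) (v : E) :
    AEMeasurable fun s => upperDeriv (fun z => ℓ s z (y s)) (x s) v := by
  refine AEMeasurable.iInf fun n => aemeasurable_iSup_of_continuous (fun θ => ?_)
    (Eventually.of_forall fun s => ?_)
  · exact ((hℓ.aemeasurable_comp (hx.add aestronglyMeasurable_const) hy).sub
      (hℓ.aemeasurable_comp hx hy)).div_const _
  · have h1 : Continuous fun z => ℓ s z (y s) :=
      continuous_of_le_add_norm (hℓ.lip_state s (y s))
    have h2 : Continuous fun θ : Ioo (0 : ℝ) (1 / ((n : ℝ) + 1)) => x s + (θ : ℝ) • v := by fun_prop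
    exact ((h1.comp h2).sub continuous_const).div continuous_subtype_val fun θ => θ.2.1.ne'

/-- A weak* measurable selection of the partial superdifferentials. -/
theorem exists_superdiff_selection [TopologicalSpace.SeparableSpace E]
    (hℓ : IsLipschitzIntegrand ℓ l₀ l₁ l₂) {x y : ℝ → E} (hx : AEStronglyMeasurable x)
    (hy : AEStronglyMeasurable y)
    (hsuper : ∀ᵐ s ∂volume.restrict (Ici (0 : ℝ)),
      (gateauxSuperdiff (fun z => (ℓ s z (y s) : EReal)) (x s)).Nonempty) :
    ∃ q : ℝ → StrongDual ℝ E,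
      (∀ᵐ s ∂volume.restrict (Ici (0 : ℝ)),
        q s ∈ gateauxSuperdiff (fun z => (ℓ s z (y s) : EReal)) (x s)) ∧
      (∀ v, LocallyIntegrable fun s => q s v) ∧ ∀ᵐ s, ∀ v, |q s v| ≤ l₁ s * ‖v‖ := by
  obtain ⟨Q, hQ, hQm⟩ := exists_aemeasurable_linear_minorant (c := l₁)
    (k := fun s v => -upperDeriv (fun z => ℓ s z (y s)) (x s) v)
    (hsuper.mono fun s ⟨p, hp⟩ => ⟨-p, isHomLipschitzAbove_neg_upperDeriv (hℓ.lip_state s (y s)) hp⟩)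
    fun v => (aemeasurable_upperDeriv hℓ hx hy v).neg.restrict
  have hmem : ∀ᵐ s ∂volume.restrict (Ici (0 : ℝ)),
      -Q s ∈ gateauxSuperdiff (fun z => (ℓ s z (y s) : EReal)) (x s) :=
    hQ.mono fun s hs => (mem_gateauxSuperdiff_iff_upperDeriv_le (hℓ.lip_state s (y s))).2 fun v => by
      rw [_root_.neg_apply]
      linarith [hs v]
  -- Extension by zero to negative times makes the bound and local integrability hold on the whole
  -- line.
  let q : ℝ → StrongDual ℝ E := (Ici (0 : ℝ)).indicator fun s => -Q s
  have hbound : ∀ᵐ s, ∀ v, |q s v| ≤ l₁ s * ‖v‖ := by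
    filter_upwards [(ae_restrict_iff' measurableSet_Ici).1 hmem] with s hs v
    by_cases h0 : s ∈ Ici (0 : ℝ)
    · simp only [q, indicator_of_mem h0]
      exact abs_apply_le_of_mem_gateauxSuperdiff (hℓ.lip_state s (y s)) (hs h0) v
    · simp only [q, indicator_of_notMem h0, _root_.zero_apply, abs_zero]
      exact mul_nonneg (hℓ.nonneg₁ s) (norm_nonneg v)
  refine ⟨q, ?_, fun v => ?_, hbound⟩
  · filter_upwards [hmem, ae_restrict_mem measurableSet_Ici] with s hs h0
    simp only [q, indicator_of_mem h0]
    exact hs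
  · have hb : LocallyIntegrable fun s => l₁ s * ‖v‖ :=
      hℓ.integrable₁.locallyIntegrable.mul_continuous continuous_const
    have hm : AEMeasurable fun s => q s v := by
      have : (fun s => q s v) = (Ici (0 : ℝ)).indicator fun s => -Q s v := by
        funext s
        by_cases h0 : s ∈ Ici (0 : ℝ)
        · simp [q, indicator_of_mem h0]
        · simp [q, indicator_of_notMem h0]
      rw [this, aemeasurable_indicator_iff measurableSet_Ici]
      exact (hQm v).neg
    exact hb.mono hm.aestronglyMeasurable
      (hbound.mono fun s hs => (hs v).trans (Real.le_norm_self _))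

/-- The weak* integral of a family of functionals dominated by an integrable function. -/
theorem exists_weakStar_primitive {q : ℝ → StrongDual ℝ E} {m : ℝ → ℝ} (hm : LocallyIntegrable m)
    (hq : ∀ v, LocallyIntegrable fun s => q s v) (hb : ∀ᵐ s, ∀ v, |q s v| ≤ m s * ‖v‖) :
    ∃ P : ℝ → StrongDual ℝ E, ∀ t v, P t v = ∫ s in (0 : ℝ)..t, q s v := by
  have hi := fun v t => intervalIntegrable_of_locallyIntegrable (hq v) 0 t
  refine ⟨fun t => LinearMap.mkContinuous
    { toFun := fun v => ∫ s in (0 : ℝ)..t, q s v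
      map_add' := fun v w => by
        simp only [map_add]
        exact intervalIntegral.integral_add (hi v t) (hi w t)
      map_smul' := fun r v => by
        simp only [map_smul, smul_eq_mul, RingHom.id_apply]
        exact intervalIntegral.integral_const_mul _ _ } (∫ s in uIoc 0 t, m s) fun v => ?_,
    fun t v => rfl⟩
  refine intervalIntegral.norm_integral_le_integral_norm_uIoc.trans ?_
  rw [← integral_mul_const]
  exact setIntegral_mono_ae (integrableOn_uIoc_of_locallyIntegrable (hq v) 0 t).norm
    ((integrableOn_uIoc_of_locallyIntegrable hm 0 t).mul_const _) (hb.mono fun s hs => hs v)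

/-- Increments of `p` are bounded in norm by increments of the scalar primitive of `m`, which is
absolutely continuous. No measurability of `q` in the norm of the dual is needed. -/
theorem locallyAbsolutelyContinuous_of_weakStar_primitive {q : ℝ → StrongDual ℝ E} {m : ℝ → ℝ}
    (hm : LocallyIntegrable m) (hm0 : ∀ s, 0 ≤ m s) (hq : ∀ v, LocallyIntegrable fun s => q s v)
    (hb : ∀ᵐ s, ∀ v, |q s v| ≤ m s * ‖v‖) {p₀ : StrongDual ℝ E} {p : ℝ → StrongDual ℝ E}
    (hp : ∀ t v, p t v = p₀ v + ∫ s in (0 : ℝ)..t, q s v) : LocallyAbsolutelyContinuous p := by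
  intro τ hτ
  have hF := (intervalIntegrable_of_locallyIntegrable hm 0
    τ).absolutelyContinuousOnInterval_intervalIntegral (left_mem_uIcc (a := (0 : ℝ)) (b := τ))
  have hdist : ∀ a b, dist (p a) (p b) ≤
      dist (∫ s in (0 : ℝ)..a, m s) (∫ s in (0 : ℝ)..b, m s) := by
    intro a b
    have hmi := fun u v => intervalIntegrable_of_locallyIntegrable hm u v
    rw [dist_eq_norm, Real.dist_eq,
      intervalIntegral.integral_interval_sub_left (hmi 0 a) (hmi 0 b)]
    refine ContinuousLinearMap.opNorm_le_bound _ (abs_nonneg _) fun v => ?_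
    have hi := fun u t => intervalIntegrable_of_locallyIntegrable (hq v) u t
    rw [_root_.sub_apply, hp, hp, add_sub_add_left_eq_sub,
      intervalIntegral.integral_interval_sub_left (hi 0 a) (hi 0 b)]
    have h1 : |∫ s in b..a, m s| = ∫ s in uIoc b a, m s := by
      rw [intervalIntegral.abs_integral_eq_abs_integral_uIoc,
        abs_of_nonneg (integral_nonneg fun s => hm0 s)]
    rw [h1, ← integral_mul_const]
    refine intervalIntegral.norm_integral_le_integral_norm_uIoc.trans ?_
    exact setIntegral_mono_ae (integrableOn_uIoc_of_locallyIntegrable (hq v) b a).norm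
      ((integrableOn_uIoc_of_locallyIntegrable hm b a).mul_const _) (hb.mono fun s hs => hs v)
  refine squeeze_zero (fun e => Finset.sum_nonneg fun i _ => dist_nonneg) (fun e => ?_) hF
  exact Finset.sum_le_sum fun i _ => hdist _ _

/-- Lebesgue's differentiation theorem for a family of functions depending on a parameter in a
separable space in a Lipschitz way, with a null set independent of the parameter. -/
theorem ae_forall_hasDerivAt_integral {X : Type*} [PseudoMetricSpace X]
    [TopologicalSpace.SeparableSpace X] {f : ℝ → X → ℝ} {m : ℝ → ℝ} (hm : LocallyIntegrable m)
    (hm0 : ∀ s, 0 ≤ m s) (hf : ∀ v, LocallyIntegrable fun s => f s v)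
    (hlip : ∀ᵐ s, ∀ v w, |f s v - f s w| ≤ m s * dist v w) :
    ∀ᵐ t, ∀ v, HasDerivAt (fun T => ∫ s in (0 : ℝ)..T, f s v) (f t v) t := by
  obtain ⟨S, hSc, hSd⟩ := TopologicalSpace.exists_countable_dense X
  have hS : ∀ᵐ t, ∀ w ∈ S, HasDerivAt (fun T => ∫ s in (0 : ℝ)..T, f s w) (f t w) t :=
    (ae_ball_iff hSc).2 fun w _ =>
      (_root_.LocallyIntegrable.ae_hasDerivAt_integral (hf w)).mono fun t ht => ht 0
  filter_upwards [hS, _root_.LocallyIntegrable.ae_hasDerivAt_integral hm, hlip] with t h1 h2 h3 v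
  have h2 := hasDerivAt_iff_isLittleO.1 (h2 0)
  rw [hasDerivAt_iff_isLittleO, Asymptotics.isLittleO_iff]
  intro c hc
  have hmt := hm0 t
  -- Replacing `v` by `w` costs at most `(m t + 1) * dist v w` in the integral and `m t * dist v w`
  -- in the value, both times `|T - t|`. This radius keeps their sum below `c / 2`.
  obtain ⟨w, hwv, hw⟩ := Metric.dense_iff.1 hSd v (c / (2 * (2 * m t + 1))) (by positivity)
  have hd : (2 * m t + 1) * dist v w ≤ c / 2 := by
    have := (Metric.mem_ball'.1 hwv).le
    rw [le_div_iff₀ (by positivity)] at this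
    linarith
  filter_upwards [Asymptotics.isLittleO_iff.1 (hasDerivAt_iff_isLittleO.1 (h1 w hw)) (half_pos hc),
    Asymptotics.isLittleO_iff.1 h2 one_pos] with T hT1 hT2
  have hi : ∀ u a b, IntervalIntegrable (fun s => f s u) volume a b := fun u =>
    intervalIntegrable_of_locallyIntegrable (hf u)
  rw [intervalIntegral.integral_interval_sub_left (hi _ _ _) (hi _ _ _), smul_eq_mul,
    Real.norm_eq_abs, Real.norm_eq_abs] at hT1 ⊢
  have hmi := intervalIntegrable_of_locallyIntegrable hm
  rw [intervalIntegral.integral_interval_sub_left (hmi _ _) (hmi _ _), smul_eq_mul,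
    Real.norm_eq_abs, Real.norm_eq_abs, one_mul] at hT2
  have hmT : |∫ s in t..T, m s| ≤ (m t + 1) * |T - t| := by
    have := abs_sub_abs_le_abs_sub (∫ s in t..T, m s) ((T - t) * m t)
    rw [abs_mul, abs_of_nonneg hmt] at this
    linarith
  have hfT : |(∫ s in t..T, f s v) - ∫ s in t..T, f s w| ≤ |∫ s in t..T, m s| * dist v w := by
    rw [← intervalIntegral.integral_sub (hi v _ _) (hi w _ _)]
    rw [intervalIntegral.abs_integral_eq_abs_integral_uIoc m,
      abs_of_nonneg (integral_nonneg fun s => hm0 s), ← integral_mul_const]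
    rw [← Real.norm_eq_abs]
    refine intervalIntegral.norm_integral_le_integral_norm_uIoc.trans ?_
    exact setIntegral_mono_ae
      (integrableOn_uIoc_of_locallyIntegrable ((hf v).sub (hf w)) t T).norm
      ((integrableOn_uIoc_of_locallyIntegrable hm t T).mul_const _) (hlip.mono fun s hs => hs v w)
  have hft : |(T - t) * f t w - (T - t) * f t v| ≤ |T - t| * (m t * dist v w) := by
    rw [← mul_sub, abs_mul, abs_sub_comm (f t w)]
    exact mul_le_mul_of_nonneg_left (h3 v w) (abs_nonneg _)
  have hmd := mul_le_mul_of_nonneg_right hmT (dist_nonneg (x := v) (y := w))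
  have hdT := mul_le_mul_of_nonneg_right hd (abs_nonneg (T - t))
  have h4 := abs_add_le ((∫ s in t..T, f s v) - ∫ s in t..T, f s w)
    ((∫ s in t..T, f s w) - (T - t) * f t w)
  have h5 := abs_add_le ((∫ s in t..T, f s v) - (T - t) * f t w) ((T - t) * f t w - (T - t) * f t v)
  rw [sub_add_sub_cancel] at h4 h5
  linarith

end Selection

end

end InfHorizon

namespace InfHorizon

noncomputable section

/-! ### Transport of subgradients of the value function along an optimal trajectory -/

section Transport

variable {E : Type*} [NormedAddCommGroup E] [NormedSpace ℝ E]
  {ℓ : ℝ → E → E → ℝ} {l₀ l₁ l₂ : ℝ → ℝ} {L : ℝ → E → E → EReal} {Γ : ℝ → E → Set E}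
  {γ : ℝ → ℝ}

theorem trajectory_add (c : ℝ) (ξ w : E) (y : ℝ → E) (s : ℝ) :
    trajectory c (ξ + w) y s = trajectory c ξ y s + w := add_right_comm _ _ _

/-- A lower bound of the value function is transported along a translated trajectory. -/
theorem le_value_translate [CompleteSpace E] (hℓ : IsLipschitzIntegrand ℓ l₀ l₁ l₂)
    (hL : ∀ᵐ s ∂volume.restrict (Ici (0 : ℝ)), ∀ x y, L s x y = (ℓ s x y : EReal)) {ξ₀ : E}
    {y₀ : ℝ → E} (hy₀ : LocallyIntegrable y₀) {t : ℝ} (ht : 0 ≤ t) {w : E} {a : ℝ}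
    (ha : (a : EReal) ≤ value L Γ 0 (ξ₀ + w))
    (hw : ∀ᵐ s, s ∈ Icc 0 t → y₀ s ∈ Γ s (trajectory 0 ξ₀ y₀ s + w)) :
    ((a - ∫ s in (0 : ℝ)..t, ℓ s (trajectory 0 ξ₀ y₀ s + w) (y₀ s) : ℝ) : EReal) ≤
      value L Γ t (trajectory 0 ξ₀ y₀ t + w) := by
  refine le_value hℓ hL ht fun y hy I hI => ?_
  rw [← trajectory_add] at hy hI
  have h := ha.trans (value_le_add hℓ hL le_rfl ht hy₀
    (by simpa only [trajectory_add] using hw) hy hI)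
  simp only [runningCost, trajectory_add] at h
  induction I with
  -- A continuation of cost `⊥` would force `a ≤ ⊥`, impossible for the real number `a`.
  | bot =>
    rw [EReal.add_bot, le_bot_iff] at h
    exact absurd h (EReal.coe_ne_bot a)
  | top => exact le_top
  | coe r =>
    norm_cast at h ⊢
    linarith

/-- The principle of optimality. -/
theorem value_eq_costToGo [CompleteSpace E] (hℓ : IsLipschitzIntegrand ℓ l₀ l₁ l₂)
    (hL : ∀ᵐ s ∂volume.restrict (Ici (0 : ℝ)), ∀ x y, L s x y = (ℓ s x y : EReal)) {ξ₀ : E}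
    {y₀ : ℝ → E} (hp : IsProcess Γ 0 ξ₀ y₀) {C : ℝ}
    (hC : Tendsto (fun T => ∫ s in (0 : ℝ)..T, runningCost ℓ 0 ξ₀ y₀ s) atTop (𝓝 C))
    (hV : value L Γ 0 ξ₀ = C) {t : ℝ} (ht : 0 ≤ t) :
    value L Γ t (trajectory 0 ξ₀ y₀ t) = costToGo ℓ ξ₀ y₀ C t := by
  refine le_antisymm (value_le hℓ hL ht (hp.tail ht) ?_) ?_
  · rw [runningCost_rebase hp.1]
    exact EReal.tendsto_coe.2 (tendsto_costToGo hℓ hp.1 hC t)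
  -- The lower bound is the translation inequality without translation; it needs no interiority.
  · have h := le_value_translate (Γ := Γ) (w := 0) hℓ hL hp.1 ht
      (by rw [add_zero, hV]) (by
        filter_upwards [(ae_restrict_iff' measurableSet_Ici).1 hp.2] with s hs h0
        rw [add_zero]
        exact hs h0.1)
    simp only [add_zero] at h
    exact h

/-- The quotients need not converge, but the positive parts of their excess over `q s v` tend to
zero and are dominated by `2 * l₁ s * ‖v‖`. Dominated convergence applies to these positive parts.
-/
theorem eventually_integral_le_of_superdiff (hℓ : IsLipschitzIntegrand ℓ l₀ l₁ l₂) {x y : ℝ → E}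
    (hx : Continuous x) (hy : LocallyIntegrable y) {q : ℝ → StrongDual ℝ E}
    (hq : ∀ᵐ s ∂volume.restrict (Ici (0 : ℝ)),
      q s ∈ gateauxSuperdiff (fun z => (ℓ s z (y s) : EReal)) (x s))
    (hqi : ∀ v, LocallyIntegrable fun s => q s v) (hqb : ∀ᵐ s, ∀ v, |q s v| ≤ l₁ s * ‖v‖)
    {t : ℝ} (ht : 0 ≤ t) (v : E) {ε : ℝ} (hε : 0 < ε) :
    ∀ᶠ θ in 𝓝[>] (0 : ℝ), ∫ s in (0 : ℝ)..t, ℓ s (x s + θ • v) (y s) ≤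
      (∫ s in (0 : ℝ)..t, ℓ s (x s) (y s)) + θ * ((∫ s in (0 : ℝ)..t, q s v) + ε) := by
  have hi : ∀ θ : ℝ, LocallyIntegrable fun s => ℓ s (x s + θ • v) (y s) := fun θ =>
    hℓ.locallyIntegrable_comp (hx.add continuous_const) hy
  have hi0 : LocallyIntegrable fun s => ℓ s (x s) (y s) := hℓ.locallyIntegrable_comp hx hy
  let G : ℝ → ℝ → ℝ := fun θ s => max ((ℓ s (x s + θ • v) (y s) - ℓ s (x s) (y s)) / θ - q s v) 0
  have hGm : ∀ θ, AEStronglyMeasurable (G θ) := fun θ =>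
    ((((hi θ).aestronglyMeasurable.sub hi0.aestronglyMeasurable).aemeasurable.div_const _).sub
      (hqi v).aestronglyMeasurable.aemeasurable).max aemeasurable_const |>.aestronglyMeasurable
  have hGb : ∀ θ, 0 < θ → ∀ᵐ s, ‖G θ s‖ ≤ l₁ s * ‖v‖ + l₁ s * ‖v‖ := fun θ hθ => by
    filter_upwards [hqb] with s hs
    have h1 := abs_quotient_le (hℓ.lip_state s (y s)) (x s) v hθ
    rw [Real.norm_of_nonneg (le_max_right _ _)]
    refine max_le ?_ ?_
    · linarith [le_abs_self ((ℓ s (x s + θ • v) (y s) - ℓ s (x s) (y s)) / θ),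
        neg_abs_le (q s v), hs v]
    · have := mul_nonneg (hℓ.nonneg₁ s) (norm_nonneg v)
      linarith
  have hbi : LocallyIntegrable fun s => l₁ s * ‖v‖ + l₁ s * ‖v‖ :=
    ((hℓ.integrable₁.mul_const _).add (hℓ.integrable₁.mul_const _)).locallyIntegrable
  have hlim : Tendsto (fun θ => ∫ s in (0 : ℝ)..t, G θ s) (𝓝[>] (0 : ℝ))
      (𝓝 (∫ s in (0 : ℝ)..t, (0 : ℝ))) := by
    refine intervalIntegral.tendsto_integral_filter_of_dominated_convergence
      (fun s => l₁ s * ‖v‖ + l₁ s * ‖v‖) (Eventually.of_forall fun θ => (hGm θ).restrict) ?_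
      (intervalIntegrable_of_locallyIntegrable hbi 0 t) ?_
    · filter_upwards [self_mem_nhdsWithin] with θ hθ
      exact (hGb θ hθ).mono fun s hs _ => hs
    · filter_upwards [(ae_restrict_iff' measurableSet_Ici).1 hq] with s hs hst
      rw [uIoc_of_le ht] at hst
      have h1 := (mem_gateauxSuperdiff_iff_of_lipschitz (hℓ.lip_state s (y s))).1 (hs hst.1.le) v
      refine Metric.tendsto_nhds.2 fun δ hδ => ?_
      filter_upwards [h1 (δ / 2) (half_pos hδ), self_mem_nhdsWithin] with θ h2 hθ
      replace hθ : 0 < θ := hθ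
      rw [dist_zero_right, Real.norm_of_nonneg (le_max_right _ _)]
      refine max_lt ?_ hδ
      have h3 : (ℓ s (x s + θ • v) (y s) - ℓ s (x s) (y s)) / θ ≤ q s v + δ / 2 := by
        rw [div_le_iff₀ hθ]
        linarith
      linarith
  rw [intervalIntegral.integral_zero] at hlim
  filter_upwards [hlim.eventually_le_const hε, self_mem_nhdsWithin] with θ h1 hθ
  replace hθ : 0 < θ := hθ
  have hGi : LocallyIntegrable (G θ) :=
    hbi.mono (hGm θ) ((hGb θ hθ).mono fun s hs => hs.trans (Real.le_norm_self _))
  have hI0 := intervalIntegrable_of_locallyIntegrable hi0 0 t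
  have hIq := intervalIntegrable_of_locallyIntegrable (hqi v) 0 t
  have hIG := intervalIntegrable_of_locallyIntegrable hGi 0 t
  calc ∫ s in (0 : ℝ)..t, ℓ s (x s + θ • v) (y s)
      ≤ ∫ s in (0 : ℝ)..t, (ℓ s (x s) (y s) + θ * (q s v + G θ s)) := by
        refine intervalIntegral.integral_mono ht (intervalIntegrable_of_locallyIntegrable (hi θ) 0 t)
          (hI0.add ((hIq.add hIG).const_mul θ)) fun s => ?_
        have h2 : (ℓ s (x s + θ • v) (y s) - ℓ s (x s) (y s)) / θ ≤ q s v + G θ s := by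
          linarith [le_max_left ((ℓ s (x s + θ • v) (y s) - ℓ s (x s) (y s)) / θ - q s v) 0]
        rw [div_le_iff₀ hθ] at h2
        linarith
    _ = (∫ s in (0 : ℝ)..t, ℓ s (x s) (y s)) +
          θ * ((∫ s in (0 : ℝ)..t, q s v) + ∫ s in (0 : ℝ)..t, G θ s) := by
        rw [intervalIntegral.integral_add hI0 ((hIq.add hIG).const_mul θ),
          intervalIntegral.integral_const_mul, intervalIntegral.integral_add hIq hIG]
    _ ≤ _ := by
        have := mul_le_mul_of_nonneg_left h1 hθ.le
        linarith

/-- Subtracting the integral of superdifferentials of the integrand from a subgradient of the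
initial value function gives a subgradient of the value function at a later time. -/
theorem mem_gateauxSubdiff_value_of_superdiff [CompleteSpace E]
    (hℓ : IsLipschitzIntegrand ℓ l₀ l₁ l₂)
    (hL : ∀ᵐ s ∂volume.restrict (Ici (0 : ℝ)), ∀ x y, L s x y = (ℓ s x y : EReal)) {ξ₀ : E}
    {y₀ : ℝ → E} (hp : IsProcess Γ 0 ξ₀ y₀) {C : ℝ}
    (hC : Tendsto (fun T => ∫ s in (0 : ℝ)..T, runningCost ℓ 0 ξ₀ y₀ s) atTop (𝓝 C))
    (hV : value L Γ 0 ξ₀ = C) {q : ℝ → StrongDual ℝ E}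
    (hq : ∀ᵐ s ∂volume.restrict (Ici (0 : ℝ)),
      q s ∈ gateauxSuperdiff (fun z => (ℓ s z (y₀ s) : EReal)) (trajectory 0 ξ₀ y₀ s))
    (hqi : ∀ v, LocallyIntegrable fun s => q s v) (hqb : ∀ᵐ s, ∀ v, |q s v| ≤ l₁ s * ‖v‖)
    {t : ℝ} (ht : 0 ≤ t) {η : ℝ} (hη : 0 < η)
    (hint : ∀ᵐ s, s ∈ Icc 0 t → ∀ x ∈ Metric.ball (trajectory 0 ξ₀ y₀ s) η, y₀ s ∈ Γ s x)
    {xs p : StrongDual ℝ E} (hxs : xs ∈ gateauxSubdiff (value L Γ 0) ξ₀)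
    (hpq : ∀ v, p v = xs v - ∫ s in (0 : ℝ)..t, q s v) :
    p ∈ gateauxSubdiff (value L Γ t) (trajectory 0 ξ₀ y₀ t) := by
  refine (mem_gateauxSubdiff_iff (value_eq_costToGo hℓ hL hp hC hV ht)).2 fun v ε hε => ?_
  have hX := continuous_trajectory 0 ξ₀ hp.1
  have h1 := (mem_gateauxSubdiff_iff hV).1 hxs v (ε / 3) (by linarith)
  have h2 := (tendsto_snd (f := 𝓝 v)).eventually
    (eventually_integral_le_of_superdiff hℓ hX hp.1 hq hqi hqb ht v (show 0 < ε / 3 by linarith))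
  have h3 : ∀ᶠ z : E × ℝ in 𝓝 v ×ˢ 𝓝[>] (0 : ℝ), (∫ s in (0 : ℝ)..t, l₁ s) * ‖z.1 - v‖ < ε / 3 := by
    have hc : Continuous fun u : E => (∫ s in (0 : ℝ)..t, l₁ s) * ‖u - v‖ := by fun_prop
    refine tendsto_fst.eventually ((hc.tendsto v).eventually_lt_const ?_)
    rw [sub_self, norm_zero, mul_zero]
    linarith
  have h4 : ∀ᶠ z : E × ℝ in 𝓝 v ×ˢ 𝓝[>] (0 : ℝ), ‖z.2 • z.1‖ < η := by
    have hc : Continuous fun z : E × ℝ => ‖z.2 • z.1‖ := by fun_prop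
    have hle : 𝓝 v ×ˢ 𝓝[>] (0 : ℝ) ≤ 𝓝 (v, 0) := by
      rw [nhds_prod_eq]
      exact prod_mono le_rfl nhdsWithin_le_nhds
    refine ((hc.tendsto (v, 0)).mono_left hle).eventually_lt_const ?_
    rwa [zero_smul, norm_zero]
  filter_upwards [h1, h2, h3, h4, eventually_snd_pos _] with ⟨u, θ⟩ h1 h2 h3 h4 hθ
  simp only at h1 h2 h3 h4 hθ ⊢
  refine le_trans (EReal.coe_le_coe_iff.2 ?_) (le_value_translate hℓ hL hp.1 ht h1 ?_)
  -- The superdifferential estimate is known along the fixed `v`. The Lipschitz bound transfers it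
  -- to nearby `u`, and the three errors of `ε / 3` add up.
  · have hl : ∫ s in (0 : ℝ)..t, ℓ s (trajectory 0 ξ₀ y₀ s + θ • u) (y₀ s) ≤
        (∫ s in (0 : ℝ)..t, ℓ s (trajectory 0 ξ₀ y₀ s + θ • v) (y₀ s)) +
          (∫ s in (0 : ℝ)..t, l₁ s) * (θ * ‖u - v‖) := by
      have hi : ∀ w, IntervalIntegrable (fun s => ℓ s (trajectory 0 ξ₀ y₀ s + w) (y₀ s))
          volume 0 t := fun w => intervalIntegrable_of_locallyIntegrable
        (hℓ.locallyIntegrable_comp (hX.add continuous_const) hp.1) 0 t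
      have hi1 := hℓ.integrable₁.intervalIntegrable (a := 0) (b := t)
      rw [← intervalIntegral.integral_mul_const,
        ← intervalIntegral.integral_add (hi _) (hi1.mul_const _)]
      refine intervalIntegral.integral_mono ht (hi _) ((hi _).add (hi1.mul_const _)) fun s => ?_
      have := hℓ.lip_state s (y₀ s) (trajectory 0 ξ₀ y₀ s + θ • u) (trajectory 0 ξ₀ y₀ s + θ • v)
      rwa [add_sub_add_left_eq_sub, ← smul_sub, norm_smul, Real.norm_of_nonneg hθ.le] at this
    have h5 := mul_le_mul_of_nonneg_left h3.le hθ.le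
    have h6 : costToGo ℓ ξ₀ y₀ C t =
      C - ∫ s in (0 : ℝ)..t, ℓ s (trajectory 0 ξ₀ y₀ s) (y₀ s) := rfl
    rw [hpq, h6]
    linarith
  · filter_upwards [hint] with s hs hst
    refine hs hst _ ?_
    rwa [Metric.mem_ball, dist_eq_norm, add_sub_cancel_left]

/-- The subgradient inequality bounds `φ` below along a ray and the growth condition bounds it
above. Comparing slopes at `v` and at `-v` bounds `p` on both sides. -/
theorem norm_le_of_mem_gateauxSubdiff {φ : E → EReal} {x : E} {c κ : ℝ} (hφ : φ x = c)
    (hκ : 0 ≤ κ) (hle : ∀ w, φ (x + w) ≤ ((c + ‖w‖ * κ : ℝ) : EReal)) {p : StrongDual ℝ E}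
    (hp : p ∈ gateauxSubdiff φ x) : ‖p‖ ≤ κ := by
  have h : ∀ v, p v ≤ κ * ‖v‖ := by
    intro v
    refine le_of_forall_pos_le_add fun ε hε => ?_
    obtain ⟨θ, h1, hθ⟩ := (((tendsto_const_prod_nhds v _).eventually
      ((mem_gateauxSubdiff_iff hφ).1 hp v ε hε)).and self_mem_nhdsWithin).exists
    replace hθ : 0 < θ := hθ
    have h2 := EReal.coe_le_coe_iff.1 (h1.trans (hle _))
    simp only [norm_smul, Real.norm_of_nonneg hθ.le] at h2
    have h3 : θ * (p v) ≤ θ * (κ * ‖v‖ + ε) := by linarith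
    exact le_of_mul_le_mul_left h3 hθ
  refine ContinuousLinearMap.opNorm_le_bound _ hκ fun v => ?_
  rw [Real.norm_eq_abs, abs_le]
  have h1 := h (-v)
  rw [map_neg, norm_neg] at h1
  exact ⟨by linarith, h v⟩

end Transport

end

end InfHorizon

namespace InfHorizon

noncomputable section

/-! ### The costate of an optimal process -/

section Costate

variable {E : Type*} [NormedAddCommGroup E] [NormedSpace ℝ E]

/-- The core of the theorem, for a real integrand with estimates valid at every time. A single
selection `q` defines `p` on the whole half-line, so the conclusions at different times concern the
same costate. -/
theorem exists_costate [CompleteSpace E] [TopologicalSpace.SeparableSpace E]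
    {ℓ : ℝ → E → E → ℝ} {l₀ l₁ l₂ : ℝ → ℝ} {L : ℝ → E → E → EReal} {Γ : ℝ → E → Set E}
    {γ : ℝ → ℝ} (hℓ : IsLipschitzIntegrand ℓ l₀ l₁ l₂)
    (hL : ∀ᵐ s ∂volume.restrict (Ici (0 : ℝ)), ∀ x y, L s x y = (ℓ s x y : EReal))
    (hΓ : IsLipschitzVelocity Γ γ)
    (hint : IntegrableOn (fun s => Real.exp (∫ τ in (0 : ℝ)..s, γ τ) * (l₁ s + l₂ s * γ s)) (Ioi 0))
    (hlsc : ∀ t : ℝ, 0 ≤ t → ∀ x, ∀ y ∈ Γ t x, ∀ δ : ℝ, 0 < δ →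
      ∀ᶠ s in 𝓝[>] t, Metric.infDist y (Γ s x) ≤ δ)
    {ξ₀ : E} {y₀ : ℝ → E} (hp : IsProcess Γ 0 ξ₀ y₀) {C : ℝ}
    (hC : Tendsto (fun T => ∫ s in (0 : ℝ)..T, runningCost ℓ 0 ξ₀ y₀ s) atTop (𝓝 C))
    (hV : value L Γ 0 ξ₀ = C)
    (hinterior : ∀ t : ℝ, 0 ≤ t → ∃ η : ℝ, 0 < η ∧
      ∀ᵐ s, s ∈ Icc 0 t → ∀ x ∈ Metric.ball (trajectory 0 ξ₀ y₀ s) η, y₀ s ∈ Γ s x)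
    (hsuper : ∀ᵐ s ∂volume.restrict (Ici (0 : ℝ)),
      (gateauxSuperdiff (fun z => (ℓ s z (y₀ s) : EReal)) (trajectory 0 ξ₀ y₀ s)).Nonempty)
    {xs : StrongDual ℝ E} (hxs : xs ∈ gateauxSubdiff (value L Γ 0) ξ₀) :
    ∃ p : ℝ → StrongDual ℝ E, LocallyAbsolutelyContinuous p ∧ p 0 = -xs ∧
      (∀ t : ℝ, 0 ≤ t → -p t ∈ gateauxSubdiff (value L Γ t) (trajectory 0 ξ₀ y₀ t)) ∧
      (∀ᵐ t ∂volume.restrict (Ici (0 : ℝ)),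
        ∃ q ∈ gateauxSuperdiff (fun z => (ℓ t z (y₀ t) : EReal)) (trajectory 0 ξ₀ y₀ t),
          HasWeakStarDerivAt p q t) ∧
      (∀ᵐ t ∂volume.restrict (Ici (0 : ℝ)), ∀ y ∈ Γ t (trajectory 0 ξ₀ y₀ t),
        p t y - ℓ t (trajectory 0 ξ₀ y₀ t) y ≤
          p t (y₀ t) - ℓ t (trajectory 0 ξ₀ y₀ t) (y₀ t)) ∧
      Tendsto p atTop (𝓝 0) := by
  have hX := continuous_trajectory 0 ξ₀ hp.1
  obtain ⟨q, hq, hqi, hqb⟩ := exists_superdiff_selection hℓ hX.aestronglyMeasurable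
    hp.1.aestronglyMeasurable hsuper
  have hl₁ := hℓ.integrable₁.locallyIntegrable
  obtain ⟨P, hP⟩ := exists_weakStar_primitive hl₁ hqi hqb
  have hpP : ∀ t v, (P t - xs) v = (-xs) v + ∫ s in (0 : ℝ)..t, q s v := fun t v => by
    rw [_root_.sub_apply, _root_.neg_apply, hP]
    ring
  have hsub : ∀ t : ℝ, 0 ≤ t →
      -(P t - xs) ∈ gateauxSubdiff (value L Γ t) (trajectory 0 ξ₀ y₀ t) := by
    intro t ht
    obtain ⟨η, hη, hη'⟩ := hinterior t ht
    refine mem_gateauxSubdiff_value_of_superdiff hℓ hL hp hC hV hq hqi hqb ht hη hη' hxs fun v => ?_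
    rw [_root_.neg_apply, hpP, _root_.neg_apply]
    ring
  refine ⟨fun t => P t - xs,
    locallyAbsolutelyContinuous_of_weakStar_primitive hl₁ hℓ.nonneg₁ hqi hqb hpP, ?_, hsub,
    ?_, ?_, ?_⟩
  · ext v
    rw [hpP, intervalIntegral.integral_same, add_zero]
  · have hd := ae_forall_hasDerivAt_integral (f := fun s v => q s v) hl₁ hℓ.nonneg₁ hqi
      (hqb.mono fun s hs v w => by
        rw [← map_sub, dist_eq_norm]
        exact hs _)
    filter_upwards [hq, ae_restrict_of_ae hd] with t h1 h2
    refine ⟨q t, h1, fun v => ?_⟩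
    simp only [hpP]
    exact (h2 v).const_add _
  -- The exceptional null set must not depend on state and velocity: at time `t` the integrand is
  -- frozen at `x₀ t` and at an arbitrary admissible `y`.
  · have hd := ae_forall_hasDerivAt_integral (f := fun s (z : E × E) => ℓ s z.1 z.2)
      (m := fun s => l₁ s + l₂ s) (hℓ.integrable₁.add hℓ.integrable₂).locallyIntegrable
      (fun s => add_nonneg (hℓ.nonneg₁ s) (hℓ.nonneg₂ s))
      (fun z => hℓ.locallyIntegrable_comp continuous_const (locallyIntegrable_const z.2))
      (Eventually.of_forall fun s z w => by
        refine (hℓ.abs_sub_le s _ _ _ _).trans ?_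
        rw [add_mul, dist_eq_norm]
        exact add_le_add (mul_le_mul_of_nonneg_left (norm_fst_le (z - w)) (hℓ.nonneg₁ s))
          (mul_le_mul_of_nonneg_left (norm_snd_le (z - w)) (hℓ.nonneg₂ s)))
    filter_upwards [ae_restrict_mem measurableSet_Ici, ae_restrict_of_ae hd,
      ae_restrict_of_ae (ae_hasDerivAt_trajectory 0 ξ₀ hp.1),
      ae_restrict_of_ae (_root_.LocallyIntegrable.ae_hasDerivAt_integral
        (hℓ.locallyIntegrable_runningCost 0 ξ₀ hp.1))] with t ht h1 h2 h3 y hy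
    exact apply_sub_le_of_mem_gateauxSubdiff_value hℓ hL hΓ hp hC ht
      (value_eq_costToGo hℓ hL hp hC hV ht) (hsub t ht) h2 (h3 0)
      (h1 (trajectory 0 ξ₀ y₀ t, y)) (hlsc t ht _ y hy)
  · refine squeeze_zero_norm' ?_ (tendsto_integral_Ioi_atTop (integrableOn_growthDensity hint))
    filter_upwards [eventually_ge_atTop 0] with t ht
    rw [← norm_neg]
    refine norm_le_of_mem_gateauxSubdiff (value_eq_costToGo hℓ hL hp hC hV ht)
      (integral_nonneg fun s => ?_) (fun w => ?_) (hsub t ht)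
    · have h1 := hℓ.nonneg₁ s
      have h2 := hℓ.nonneg₂ s
      have h3 := hΓ.nonneg s
      simp only [growthDensity, Pi.zero_apply]
      positivity
    · refine value_le_add_norm_mul hℓ hL hΓ hint ht (hp.tail ht) ?_ w
      rw [runningCost_rebase hp.1]
      exact tendsto_costToGo hℓ hp.1 hC t

end Costate

end

end InfHorizon

namespace InfHorizon

noncomputable section

/-! ### Real valued integrands and measurable velocity sets -/

section Reduction

variable {E : Type*} [NormedAddCommGroup E]

theorem ne_top_and_ne_bot_of_abs_ne_top {a : EReal} (h : a.abs ≠ ⊤) : a ≠ ⊤ ∧ a ≠ ⊥ :=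
  ⟨fun ha => h (by rw [ha, EReal.abs_top]), fun ha => h (by rw [ha, EReal.abs_bot])⟩

/-- Finiteness at the origin propagates: an infinite value elsewhere would make the difference
infinite. -/
theorem coe_toReal_of_abs_sub_le {f : E → E → EReal} {a b c : ℝ}
    (h₀ : (f 0 0).abs ≤ ENNReal.ofReal a)
    (h : ∀ x y x' y', (f x y - f x' y').abs ≤ ENNReal.ofReal (b * ‖x - x'‖ + c * ‖y - y'‖))
    (x y : E) : ((f x y).toReal : EReal) = f x y := by
  obtain ⟨h1, h2⟩ := ne_top_and_ne_bot_of_abs_ne_top (ne_top_of_le_ne_top ENNReal.ofReal_ne_top h₀)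
  obtain ⟨h3, h4⟩ := ne_top_and_ne_bot_of_abs_ne_top
    (ne_top_of_le_ne_top ENNReal.ofReal_ne_top (h x y 0 0))
  rw [← EReal.coe_toReal h1 h2] at h3 h4
  refine EReal.coe_toReal (fun h5 => h3 ?_) fun h5 => h4 ?_
  · rw [h5, EReal.top_sub_coe]
  · rw [h5, EReal.bot_sub]

/-- An extended real valued integrand that is Lipschitz at almost every time agrees at almost every
time with a real valued one. -/
theorem exists_isLipschitzIntegrand {L : ℝ → E → E → EReal}
    (hLmeas : ∀ x y : E, AEMeasurable (fun t => L t x y) (volume.restrict (Ici (0 : ℝ))))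
    {l₀ l₁ l₂ : ℝ → ℝ}
    (hl₀_nonneg : ∀ t : ℝ, 0 ≤ t → 0 ≤ l₀ t) (hl₀ : IntegrableOn l₀ (Ici 0))
    (hl₁_nonneg : ∀ t : ℝ, 0 ≤ t → 0 ≤ l₁ t) (hl₁ : IntegrableOn l₁ (Ici 0))
    (hl₂_nonneg : ∀ t : ℝ, 0 ≤ t → 0 ≤ l₂ t) (hl₂ : IntegrableOn l₂ (Ici 0))
    (hl₂_bdd : ∀ T : ℝ, ∃ M : ℝ, ∀ t ∈ Icc (0 : ℝ) T, l₂ t ≤ M)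
    (hLlip : ∀ᵐ t ∂volume.restrict (Ici (0 : ℝ)),
      (L t 0 0).abs ≤ ENNReal.ofReal (l₀ t) ∧
      ∀ x y x' y' : E, (L t x y - L t x' y').abs ≤
        ENNReal.ofReal (l₁ t * ‖x - x'‖ + l₂ t * ‖y - y'‖)) :
    ∃ ℓ : ℝ → E → E → ℝ,
      IsLipschitzIntegrand ℓ ((Ici 0).indicator l₀) ((Ici 0).indicator l₁)
        ((Ici 0).indicator l₂) ∧
      ∀ᵐ s ∂volume.restrict (Ici (0 : ℝ)), ∀ x y, L s x y = (ℓ s x y : EReal) := by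
  classical
  -- The integrand is replaced by zero at the exceptional times, so the estimates hold everywhere
  -- while the two integrands agree at almost every nonnegative time.
  let good : ℝ → Prop := fun t => 0 ≤ t ∧ (L t 0 0).abs ≤ ENNReal.ofReal (l₀ t) ∧
    ∀ x y x' y' : E, (L t x y - L t x' y').abs ≤
      ENNReal.ofReal (l₁ t * ‖x - x'‖ + l₂ t * ‖y - y'‖)
  let ℓ : ℝ → E → E → ℝ := fun t x y => if good t then (L t x y).toReal else 0
  have hpos : ∀ t, good t → ∀ x y, ℓ t x y = (L t x y).toReal := fun t ht x y => if_pos ht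
  have hneg : ∀ t, ¬ good t → ∀ x y, ℓ t x y = 0 := fun t ht x y => if_neg ht
  have hcoe : ∀ t, good t → ∀ x y, L t x y = (ℓ t x y : EReal) := fun t ht x y => by
    rw [hpos t ht, coe_toReal_of_abs_sub_le ht.2.1 ht.2.2]
  have hgood : ∀ᵐ t ∂volume.restrict (Ici (0 : ℝ)), good t := by
    filter_upwards [hLlip, ae_restrict_mem measurableSet_Ici] with t h1 h2
    exact ⟨h2, h1⟩
  have h0 := fun t => indicator_nonneg (s := Ici (0 : ℝ)) hl₀_nonneg t
  have h1 := fun t => indicator_nonneg (s := Ici (0 : ℝ)) hl₁_nonneg t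
  have h2 := fun t => indicator_nonneg (s := Ici (0 : ℝ)) hl₂_nonneg t
  refine ⟨ℓ, ⟨fun x y => ?_, hl₀.integrable_indicator measurableSet_Ici,
    hl₁.integrable_indicator measurableSet_Ici, hl₂.integrable_indicator measurableSet_Ici, h1, h2,
    fun T => ?_, fun s => ?_, fun s x y x' y' => ?_⟩, hgood.mono hcoe⟩
  · have h : AEMeasurable ((Ici (0 : ℝ)).indicator fun t => (L t x y).toReal) :=
      (aemeasurable_indicator_iff measurableSet_Ici).2 (hLmeas x y).ereal_toReal
    refine h.congr ?_
    filter_upwards [(ae_restrict_iff' measurableSet_Ici).1 hgood] with t ht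
    by_cases h0 : t ∈ Ici (0 : ℝ)
    · rw [indicator_of_mem h0, hpos t (ht h0)]
    · rw [indicator_of_notMem h0, hneg t fun hg => h0 hg.1]
  · obtain ⟨M, hM⟩ := hl₂_bdd T
    refine ⟨max M 0, fun s hs => ?_⟩
    by_cases h0 : s ∈ Ici (0 : ℝ)
    · rw [indicator_of_mem h0]
      exact le_max_of_le_left (hM s ⟨h0, hs⟩)
    · rw [indicator_of_notMem h0]
      exact le_max_right _ _
  · by_cases hs : good s
    · have h := hs.2.1
      rw [hcoe s hs, EReal.abs_def, ENNReal.ofReal_le_ofReal_iff (hl₀_nonneg s hs.1)] at h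
      rwa [indicator_of_mem (mem_Ici.2 hs.1)]
    · rw [hneg s hs, abs_zero]
      exact h0 s
  · by_cases hs : good s
    · have h := hs.2.2 x y x' y'
      have h3 := hl₁_nonneg s hs.1
      have h4 := hl₂_nonneg s hs.1
      rw [hcoe s hs, hcoe s hs, ← EReal.coe_sub, EReal.abs_def,
        ENNReal.ofReal_le_ofReal_iff (by positivity)] at h
      rw [indicator_of_mem (mem_Ici.2 hs.1), indicator_of_mem (mem_Ici.2 hs.1)]
      linarith [le_abs_self (ℓ s x y - ℓ s x' y')]
    · rw [hneg s hs, hneg s hs]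
      have h3 := h1 s
      have h4 := h2 s
      positivity

/-- A point of `F s` in the open ball of radius `r` around `v` persists, as a point of `F s'` in
that ball, for nearby `s'`. -/
theorem upperSemicontinuousOn_infDist {α : Type*} [TopologicalSpace α] {F : α → Set E} {S : Set α}
    (hF : LowerHemicontinuousOn F S) (hne : ∀ s ∈ S, (F s).Nonempty) (v : E) :
    UpperSemicontinuousOn (fun s => Metric.infDist v (F s)) S := by
  intro s hs r hr
  obtain ⟨y, hy, hyr⟩ := (Metric.infDist_lt_iff (hne s hs)).1 hr
  have h := hF s hs (Metric.ball v r) ⟨Metric.isOpen_ball, y, hy, Metric.mem_ball'.2 hyr⟩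
  filter_upwards [h] with s' hs'
  obtain ⟨-, z, hz, hzr⟩ := hs'
  exact (Metric.infDist_le_dist_of_mem hz).trans_lt (Metric.mem_ball'.1 hzr)

theorem aemeasurable_infDist_of_lowerHemicontinuousOn {F : ℝ → Set E} {S : Set ℝ}
    (hS : MeasurableSet S) (hF : LowerHemicontinuousOn F S) (hne : ∀ s ∈ S, (F s).Nonempty) (v : E) :
    AEMeasurable (fun s => Metric.infDist v (F s)) (volume.restrict S) :=
  aemeasurable_restrict_of_measurable_subtype hS (upperSemicontinuousOn_iff_restrict.2
    (upperSemicontinuousOn_infDist hF hne v)).measurable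

theorem infDist_le_add_of_subset_add_ball [NormedSpace ℝ E] {A B : Set E} (hA : A.Nonempty) {r : ℝ}
    (hr : 0 ≤ r) (h : A ⊆ B + r • Metric.ball (0 : E) 1) (v : E) :
    Metric.infDist v B ≤ Metric.infDist v A + r := by
  rw [← sub_le_iff_le_add]
  refine (Metric.le_infDist hA).2 fun y hy => ?_
  obtain ⟨b, hb, z, ⟨u, hu, rfl⟩, rfl⟩ := h hy
  have h1 : dist v b ≤ dist v (b + r • u) + dist (b + r • u) b := dist_triangle _ _ _
  have h2 : dist (b + r • u) b ≤ r := by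
    rw [dist_eq_norm, add_sub_cancel_left, norm_smul, Real.norm_of_nonneg hr]
    exact mul_le_of_le_one_right hr (mem_ball_zero_iff.1 hu).le
  have h3 := Metric.infDist_le_dist_of_mem (x := v) hb
  simp only
  linarith

theorem integral_indicator_Ici {f : ℝ → ℝ} {s : ℝ} (hs : 0 ≤ s) :
    ∫ τ in (0 : ℝ)..s, (Ici (0 : ℝ)).indicator f τ = ∫ τ in (0 : ℝ)..s, f τ := by
  refine intervalIntegral.integral_congr fun τ hτ => indicator_of_mem ?_ _
  rw [uIcc_of_le hs] at hτ
  exact hτ.1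

/-- The factor `1 + ∫ γ₀` is at least one, so dividing by it is multiplication by a function bounded
by one and keeps integrability. -/
theorem integrableOn_exp_mul_indicator {γ₀ γ₁ l₁ l₂ : ℝ → ℝ} (hγ₀_nonneg : ∀ t : ℝ, 0 ≤ t → 0 ≤ γ₀ t)
    (hγ₀ : LocallyIntegrableOn γ₀ (Ici 0))
    (hint : IntegrableOn (fun s : ℝ => Real.exp (∫ τ in (0 : ℝ)..s, γ₁ τ) *
      (1 + ∫ τ in (0 : ℝ)..s, γ₀ τ) * (l₁ s + l₂ s * γ₁ s)) (Ici 0)) :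
    IntegrableOn (fun s => Real.exp (∫ τ in (0 : ℝ)..s, (Ici (0 : ℝ)).indicator γ₁ τ) *
      ((Ici (0 : ℝ)).indicator l₁ s + (Ici (0 : ℝ)).indicator l₂ s * (Ici (0 : ℝ)).indicator γ₁ s))
      (Ioi 0) := by
  let G : ℝ → ℝ := fun s => ∫ τ in (0 : ℝ)..s, (Ici (0 : ℝ)).indicator γ₀ τ
  have hG : Continuous G :=
    continuous_primitive_of_locallyIntegrable (locallyIntegrable_indicator_Ici hγ₀) 0
  have hG0 : ∀ s, 0 ≤ s → 0 ≤ G s := fun s hs =>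
    intervalIntegral.integral_nonneg hs fun τ _ => indicator_nonneg hγ₀_nonneg τ
  have h := Integrable.bdd_mul (c := 1) (f := fun s => (1 + G s)⁻¹)
    (hint.mono_set Ioi_subset_Ici_self)
    ((measurable_const.add hG.measurable).inv.aestronglyMeasurable) (by
      filter_upwards [ae_restrict_mem measurableSet_Ioi] with s hs
      have h1 := hG0 s (le_of_lt hs)
      rw [Real.norm_of_nonneg (by positivity)]
      exact inv_le_one_of_one_le₀ (by linarith))
  refine Integrable.congr h ?_
  filter_upwards [ae_restrict_mem measurableSet_Ioi] with s hs
  have hs0 : s ∈ Ici (0 : ℝ) := Ioi_subset_Ici_self hs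
  have h1 := hG0 s hs0
  have h2 : ∫ τ in (0 : ℝ)..s, γ₀ τ = G s := (integral_indicator_Ici hs0).symm
  rw [h2, indicator_of_mem hs0, indicator_of_mem hs0, indicator_of_mem hs0,
    integral_indicator_Ici hs0]
  field_simp

end Reduction

end

end InfHorizon

/-! ### The Euler-Lagrange condition and the maximum principle -/

theorem mainTheorem1
    {E : Type*} [NormedAddCommGroup E] [NormedSpace ℝ E] [CompleteSpace E]
    [TopologicalSpace.SeparableSpace E]
    -- the integrand, with values in `ℝ ∪ {+∞}`, and the velocity multifunction
    (L : ℝ → E → E → EReal) (Γ : ℝ → E → Set E)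
    (hL : ∀ t : ℝ, 0 ≤ t → ∀ x y : E, L t x y ≠ ⊥)
    -- admissible trajectories exist
    (hAdm : ∀ t : ℝ, 0 ≤ t → ∀ ξ : E, (InfHorizon.admissible Γ t ξ).Nonempty)
    -- measurability of the integrand
    (hLmeas : ∀ x y : E, AEMeasurable (fun t => L t x y) (volume.restrict (Ici (0 : ℝ))))
    -- integrable bound and Lipschitz continuity of the integrand
    (l₀ l₁ l₂ : ℝ → ℝ)
    (hl₀_nonneg : ∀ t : ℝ, 0 ≤ t → 0 ≤ l₀ t) (hl₀ : IntegrableOn l₀ (Ici 0))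
    (hl₁_nonneg : ∀ t : ℝ, 0 ≤ t → 0 ≤ l₁ t) (hl₁ : IntegrableOn l₁ (Ici 0))
    (hl₂_nonneg : ∀ t : ℝ, 0 ≤ t → 0 ≤ l₂ t) (hl₂ : IntegrableOn l₂ (Ici 0))
    (hl₂_bdd : ∀ T : ℝ, ∃ M : ℝ, ∀ t ∈ Icc (0 : ℝ) T, l₂ t ≤ M)
    (hLlip : ∀ᵐ t ∂volume.restrict (Ici (0 : ℝ)),
      (L t 0 0).abs ≤ ENNReal.ofReal (l₀ t) ∧
      ∀ x y x' y' : E, (L t x y - L t x' y').abs ≤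
        ENNReal.ofReal (l₁ t * ‖x - x'‖ + l₂ t * ‖y - y'‖))
    -- nonempty closed velocity sets, lower semicontinuous in time
    (hΓne : ∀ t : ℝ, 0 ≤ t → ∀ x : E, (Γ t x).Nonempty)
    (hΓclosed : ∀ t : ℝ, 0 ≤ t → ∀ x : E, IsClosed (Γ t x))
    (hΓlsc : ∀ x : E, LowerHemicontinuousOn (fun t => Γ t x) (Ici (0 : ℝ)))
    -- bound and Lipschitz continuity of the velocity multifunction
    (γ₀ γ₁ : ℝ → ℝ)
    (hγ₀_nonneg : ∀ t : ℝ, 0 ≤ t → 0 ≤ γ₀ t) (hγ₀ : LocallyIntegrableOn γ₀ (Ici 0))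
    (hγ₁_nonneg : ∀ t : ℝ, 0 ≤ t → 0 ≤ γ₁ t) (hγ₁ : LocallyIntegrableOn γ₁ (Ici 0))
    (hΓbdd : ∀ t : ℝ, 0 ≤ t → Γ t 0 ⊆ γ₀ t • Metric.ball (0 : E) 1)
    (hΓlip : ∀ t : ℝ, 0 ≤ t → ∀ x x' : E,
      Γ t x ⊆ Γ t x' + (γ₁ t * ‖x - x'‖) • Metric.ball (0 : E) 1)
    -- integrability of the Lipschitz moduli
    (hint₁ : IntegrableOn (fun s : ℝ => Real.exp (∫ τ in (0 : ℝ)..s, γ₁ τ) *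
      (1 + ∫ τ in (0 : ℝ)..s, γ₀ τ) * (l₁ s + l₂ s * γ₁ s)) (Ici 0))
    (hint₂ : IntegrableOn (fun s : ℝ => l₂ s * γ₀ s) (Ici 0))
    -- the optimal trajectory and the interiority condition along it
    (ξ₀ : E) (x₀ : ℝ → E) (hx₀ : InfHorizon.IsOptimal L Γ 0 ξ₀ x₀)
    (hinterior : ∀ t : ℝ, 0 ≤ t → ∃ η : ℝ, 0 < η ∧ ∀ᵐ s ∂volume.restrict (Icc (0 : ℝ) t),
      ∀ x ∈ Metric.ball (x₀ s) η, deriv x₀ s ∈ Γ s x)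
    -- nonemptiness of the Gateaux partial superdifferentials of the integrand
    (hsuper : ∀ᵐ t ∂volume.restrict (Ici (0 : ℝ)),
      (InfHorizon.gateauxSuperdiff (fun x => L t x (deriv x₀ t)) (x₀ t)).Nonempty)
    (hsub : (InfHorizon.gateauxSubdiff (InfHorizon.value L Γ 0) (x₀ 0)).Nonempty) :
    (∀ xs ∈ InfHorizon.gateauxSubdiff (InfHorizon.value L Γ 0) (x₀ 0),
      ∃ p : ℝ → StrongDual ℝ E,
        InfHorizon.LocallyAbsolutelyContinuous p ∧ p 0 = -xs ∧
        (∀ t : ℝ, 0 ≤ t → -p t ∈ InfHorizon.gateauxSubdiff (InfHorizon.value L Γ t) (x₀ t)) ∧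
        (∀ᵐ t ∂volume.restrict (Ici (0 : ℝ)),
          p t ∈ InfHorizon.clarkeSubdiff (fun y => L t (x₀ t) y) (deriv x₀ t) +
            InfHorizon.clarkeNormalCone (Γ t (x₀ t)) (deriv x₀ t)) ∧
        (∀ᵐ t ∂volume.restrict (Ici (0 : ℝ)),
          ∃ q ∈ InfHorizon.gateauxSuperdiff (fun x => L t x (deriv x₀ t)) (x₀ t),
            InfHorizon.HasWeakStarDerivAt p q t) ∧
        (∀ᵐ t ∂volume.restrict (Ici (0 : ℝ)),
          InfHorizon.hamiltonian L Γ t (x₀ t) (p t) =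
            ((p t (deriv x₀ t) : ℝ) : EReal) - L t (x₀ t) (deriv x₀ t)) ∧
        Tendsto p atTop (𝓝 0)) ∧
    (∀ t : ℝ, 0 ≤ t →
      (InfHorizon.gateauxSubdiff (InfHorizon.value L Γ t) (x₀ t)).Nonempty) := by
  have hγ0 : ∀ t ∈ Ici (0 : ℝ), ∀ x x' : E, 0 ≤ γ₁ t * ‖x - x'‖ := fun t ht x x' =>
    mul_nonneg (hγ₁_nonneg t ht) (norm_nonneg _)
  obtain ⟨ℓ, hℓ, hLℓ⟩ := InfHorizon.exists_isLipschitzIntegrand hLmeas hl₀_nonneg hl₀ hl₁_nonneg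
    hl₁ hl₂_nonneg hl₂ hl₂_bdd hLlip
  -- Dropping the constraint at negative times gives a multifunction regular on the whole line;
  -- values at times `t ≥ 0` do not change.
  have hΓ := InfHorizon.isLipschitzVelocity_restrictVelocity measurableSet_Ici hΓne hΓclosed
    (fun x v => InfHorizon.aemeasurable_infDist_of_lowerHemicontinuousOn measurableSet_Ici
      (hΓlsc x) (fun s hs => hΓne s hs x) v) hγ₁_nonneg
    (InfHorizon.locallyIntegrable_indicator_Ici hγ₁) fun t ht x x' v => by
      rw [norm_sub_rev]
      exact InfHorizon.infDist_le_add_of_subset_add_ball (hΓne t ht x') (hγ0 t ht x' x)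
        (hΓlip t ht x' x) v
  have hlsc : ∀ t : ℝ, 0 ≤ t → ∀ x, ∀ y ∈ InfHorizon.restrictVelocity (Ici 0) Γ t x, ∀ δ : ℝ,
      0 < δ → ∀ᶠ s in 𝓝[>] t, Metric.infDist y (InfHorizon.restrictVelocity (Ici 0) Γ s x) ≤ δ := by
    intro t ht x y hy δ hδ
    rw [InfHorizon.restrictVelocity_of_mem (mem_Ici.2 ht)] at hy
    have h1 := InfHorizon.upperSemicontinuousOn_infDist (hΓlsc x) (fun s hs => hΓne s hs x) y t ht δ
      ((Metric.infDist_zero_of_mem hy).trans_lt hδ)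
    have h2 : Ioi t ⊆ Ici 0 := fun s hs => ht.trans (le_of_lt hs)
    filter_upwards [h1.filter_mono (nhdsWithin_mono t h2), self_mem_nhdsWithin] with s hs hts
    rw [InfHorizon.restrictVelocity_of_mem (h2 hts)]
    exact hs.le
  have hV := fun t (ht : 0 ≤ t) => InfHorizon.value_restrictVelocity L Γ ht
  obtain ⟨y₀, hy₀, hyx, hxX⟩ := InfHorizon.exists_isProcess_of_mem_admissible le_rfl hx₀.1
  have hp : InfHorizon.IsProcess (InfHorizon.restrictVelocity (Ici 0) Γ) 0 ξ₀ y₀ := by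
    refine ⟨hy₀.1, ?_⟩
    filter_upwards [hy₀.2, ae_restrict_mem measurableSet_Ici] with s h1 h2
    rwa [InfHorizon.restrictVelocity_of_mem h2]
  obtain ⟨C, hVC⟩ : ∃ C : ℝ, InfHorizon.value L Γ 0 ξ₀ = C :=
    ⟨_, (EReal.coe_toReal hx₀.2.2.2 hx₀.2.2.1).symm⟩
  have hC := (InfHorizon.hasImproperIntegral_along_iff hℓ hLℓ le_rfl hy₀.1 hyx hxX).1 hx₀.2.1
  rw [hVC, EReal.tendsto_coe] at hC
  have hae : ∀ᵐ t ∂volume.restrict (Ici (0 : ℝ)), 0 ≤ t ∧ x₀ t = InfHorizon.trajectory 0 ξ₀ y₀ t ∧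
      deriv x₀ t = y₀ t ∧ L t = fun x y => (ℓ t x y : EReal) := by
    filter_upwards [hLℓ, ae_restrict_mem measurableSet_Ici] with t h1 h2
    exact ⟨h2, hxX t h2, (hyx t h2).symm, funext fun x => funext fun y => h1 x y⟩
  refine (and_iff_left_of_imp fun main t ht => ?_).2 fun xs hxs => ?_
  · obtain ⟨xs, hxs⟩ := hsub
    obtain ⟨p, -, -, h, -⟩ := main xs hxs
    exact ⟨_, h t ht⟩
  obtain ⟨p, hp1, hp2, hp3, hp4, hp5, hp6⟩ := InfHorizon.exists_costate hℓ hLℓ hΓ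
    (InfHorizon.integrableOn_exp_mul_indicator hγ₀_nonneg hγ₀ hint₁) hlsc hp hC
    (by rw [hV 0 le_rfl, hVC])
    (fun t ht => by
      obtain ⟨η, hη, h⟩ := hinterior t ht
      refine ⟨η, hη, ?_⟩
      filter_upwards [(ae_restrict_iff' measurableSet_Icc).1 h] with s hs hst x hx
      rw [InfHorizon.restrictVelocity_of_mem (mem_Ici.2 hst.1), hyx s hst.1]
      rw [← hxX s hst.1] at hx
      exact hs hst x hx)
    (by
      filter_upwards [hsuper, hae] with t h1 ⟨_, h2, h3, h4⟩
      rwa [h2, h3, h4] at h1)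
    (xs := xs) (by rwa [hV 0 le_rfl, ← hx₀.1.2.2])
  -- This minimality of `ℓ - p` over the velocity set yields both the normal cone inclusion and the
  -- Hamiltonian identity.
  have hmin : ∀ᵐ t ∂volume.restrict (Ici (0 : ℝ)), ∀ y ∈ Γ t (x₀ t),
      p t y - ℓ t (x₀ t) y ≤ p t (deriv x₀ t) - ℓ t (x₀ t) (deriv x₀ t) := by
    filter_upwards [hp5, hae] with t h1 ⟨h0, h2, h3, _⟩
    rw [h2, h3]
    rwa [InfHorizon.restrictVelocity_of_mem (mem_Ici.2 h0)] at h1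
  refine ⟨p, hp1, hp2, fun t ht => ?_, ?_, ?_, ?_, hp6⟩
  · have := hp3 t ht
    rwa [hV t ht, ← hxX t ht] at this
  · filter_upwards [hmin, hae, hx₀.1.2.1] with t h1 ⟨_, _, _, h4⟩ h5
    rw [h4]
    refine InfHorizon.mem_clarkeSubdiff_add_clarkeNormalCone
      (K := (Ici (0 : ℝ)).indicator l₂ t) (fun y z => ?_) (hℓ.nonneg₂ t) h5 fun y hy => ?_
    · simpa using hℓ.lip t (x₀ t) y (x₀ t) z
    · linarith [h1 y hy]
  · filter_upwards [hp4, hae] with t h1 ⟨_, h2, h3, h4⟩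
    rwa [h2, h3, h4]
  · filter_upwards [hmin, hae, hx₀.1.2.1] with t h1 ⟨_, _, _, h4⟩ h5
    rw [InfHorizon.hamiltonian]
    refine le_antisymm (iSup₂_le fun y hy => ?_) (le_iSup₂_of_le (deriv x₀ t) h5 le_rfl)
    rw [h4]
    exact EReal.coe_le_coe_iff.2 (h1 y hy)
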